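/- **Theorem** ($Qm|rej|C_{\max}$ can be solved in $\widetilde{O}((p_{\max}+w_{\max})^{(m+2)(m+3)}\cdot n)$ time). Fix a number $m\ge 1$ of related machines. An instance of $Qm|rej|C_{\max}$ consists of $n\ge 1$ jobs with processing requirements $p_1,\dots,p_n\in\mathbb{N}$ and weights $w_1,\dots,w_n\in\mathbb{N}$, positive rational machine speeds $q_1,\dots,q_m$ (job $j$ takes time $p_j/q_i$ on machine $M_i$), and a bound $W\in\mathbb{N}$ (here $0\in\mathbb{N}$). A feasible schedule assigns each job to one of the machines or rejects it, such that the rejected jobs have total weight at most $W$; its makespan is $\max_{i}\sum_{j \text{ assigned to } M_i} p_j/q_i$. Let $p_{\max}=\max_j p_j$ and $w_{\max}=\max_j w_j$, and suppose that $p_{\max}+w_{\max}\ge 1$. There is an algorithm that computes, for every such instance, a feasible schedule of minimum makespan in time $$\widetilde{O}\big((p_{\max}+w_{\max})^{(m+2)(m+3)}\cdot n\big).$$ Precisely, for every $m\ge 1$ there are a word-RAM program and constants $\kappa,c,k\in\mathbb{N}$, depending only on $m$, such that on every such instance the program halts with an optimal schedule after at most $$c\,(p_{\max}+w_{\max})^{(m+2)(m+3)}\,n\,\lfloor\log_2(n+p_{\max}+w_{\max})\rfloor^{k}$$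 steps, where all computed words are smaller than $N^{\kappa}$ (i.e. have $O(\log N)$ bits) for $N=2+n+p_{\max}+w_{\max}+W+\sum_i(a_i+b_i)$, with $q_i=a_i/b_i$ in lowest terms. One step is one word operation (addition, truncated subtraction, multiplication, integer division, memory access, or control operation). -/

import Mathlib

namespace SchedRej

/-! ### The problem: makespan minimization on `m` related machines with job rejection -/

/-- An instance with `m` related machines: `n` jobs with processing requirements `p j` and weights
`w j`, a bound `W` on the total weight of the rejected jobs, and positive rational machine speeds
`q i`. Job `j` takes time `p j / q i` on machine `i`. -/
structure Instance (m : ℕ) where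
  n : ℕ
  p : Fin n → ℕ
  w : Fin n → ℕ
  W : ℕ
  q : Fin m → ℚ≥0
  q_pos : ∀ i, 0 < q i

namespace Instance

variable {m : ℕ}

/-- The largest processing requirement. -/
def pmax (I : Instance m) : ℕ := Finset.univ.sup I.p

/-- The largest weight. -/
def wmax (I : Instance m) : ℕ := Finset.univ.sup I.w

/-- A schedule of a subset of the jobs: `σ j = some i` if job `j` runs on machine `i`, and
`σ j = none` if job `j` is rejected. -/
abbrev Schedule (I : Instance m) : Type := Fin I.n → Option (Fin m)

/-- Total processing time on machine `i`. -/
def machineLoad (I : Instance m) (σ : I.Schedule) (i : Fin m) : ℚ≥0 :=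
  ∑ j ∈ Finset.univ.filter (fun j => σ j = some i), (I.p j : ℚ≥0) / I.q i

/-- The makespan `max_i M_i(σ)`. -/
def makespan (I : Instance m) (σ : I.Schedule) : ℚ≥0 :=
  Finset.univ.sup (I.machineLoad σ)

/-- Total weight of the rejected jobs. -/
def rejectedWeight (I : Instance m) (σ : I.Schedule) : ℕ :=
  ∑ j ∈ Finset.univ.filter (fun j => σ j = none), I.w j

/-- The rejected jobs have total weight at most `W`. -/
def Feasible (I : Instance m) (σ : I.Schedule) : Prop := I.rejectedWeight σ ≤ I.W

/-- A feasible schedule of minimum makespan. -/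
def IsOptimal (I : Instance m) (σ : I.Schedule) : Prop :=
  I.Feasible σ ∧ ∀ τ : I.Schedule, I.Feasible τ → I.makespan σ ≤ I.makespan τ

/-- An integer, at least `2`, that bounds the number of jobs and all numbers in the input. -/
def magnitude (I : Instance m) : ℕ :=
  2 + I.n + I.pmax + I.wmax + I.W + ∑ i, ((I.q i).num + (I.q i).den)

end Instance

/-! ### The machine model: a word RAM with structured control flow

Memory consists of variables and of arrays, named by natural numbers; a program is a finite term and
mentions only finitely many of them, while array positions are computed at run time. A word is a
natural number below `B`. Every operation, memory access and command takes one step. A run is stuck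
as soon as a number that is not a word would be computed, accessed or used as an array position. -/

structure State where
  var : ℕ → ℕ
  arr : ℕ → ℕ → ℕ

namespace State

def setVar (s : State) (x v : ℕ) : State :=
  { s with var := Function.update s.var x v }

def setArr (s : State) (a i v : ℕ) : State :=
  { s with arr := Function.update s.arr a (Function.update (s.arr a) i v) }

end State

inductive Expr : Type
  | const (v : ℕ)
  | var (x : ℕ)
  | get (a : ℕ) (i : Expr)
  | add (e f : Expr)
  | sub (e f : Expr)
  | mul (e f : Expr)
  | div (e f : Expr)

namespace Expr

/-- Value in a state: subtraction is truncated at `0`, division rounds down, `x / 0 = 0`. -/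
def val (s : State) : Expr → ℕ
  | const v => v
  | var x => s.var x
  | get a i => s.arr a (i.val s)
  | add e f => e.val s + f.val s
  | sub e f => e.val s - f.val s
  | mul e f => e.val s * f.val s
  | div e f => e.val s / f.val s

/-- All values that occur in the evaluation are words. -/
def Fits (B : ℕ) (s : State) : Expr → Prop
  | const v => v < B
  | var x => s.var x < B
  | get a i => i.Fits B s ∧ s.arr a (i.val s) < B
  | add e f => e.Fits B s ∧ f.Fits B s ∧ e.val s + f.val s < B
  | sub e f => e.Fits B s ∧ f.Fits B s
  | mul e f => e.Fits B s ∧ f.Fits B s ∧ e.val s * f.val s < B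
  | div e f => e.Fits B s ∧ f.Fits B s

/-- Number of steps of an evaluation. -/
def cost : Expr → ℕ
  | const _ => 1
  | var _ => 1
  | get _ i => i.cost + 1
  | add e f => e.cost + f.cost + 1
  | sub e f => e.cost + f.cost + 1
  | mul e f => e.cost + f.cost + 1
  | div e f => e.cost + f.cost + 1

end Expr

inductive Program : Type
  | skip
  | assign (x : ℕ) (e : Expr)
  | store (a : ℕ) (i e : Expr)
  | seq (P Q : Program)
  | ite (e : Expr) (P Q : Program)
  | loop (e : Expr) (P : Program)

/-- `Run B P s t s'`: with words below `B`, program `P` started in state `s` halts after exactly `t`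
steps in state `s'`. A test succeeds if its value is nonzero; `loop e P` repeats `P` as long as the
test `e` succeeds. -/
inductive Run (B : ℕ) : Program → State → ℕ → State → Prop
  | skip (s : State) : Run B .skip s 1 s
  | assign (x : ℕ) (e : Expr) (s : State) (he : e.Fits B s) :
      Run B (.assign x e) s (e.cost + 1) (s.setVar x (e.val s))
  | store (a : ℕ) (i e : Expr) (s : State) (hi : i.Fits B s) (he : e.Fits B s) :
      Run B (.store a i e) s (i.cost + e.cost + 1) (s.setArr a (i.val s) (e.val s))
  | seq {P Q : Program} {s s' s'' : State} {t t' : ℕ} (hP : Run B P s t s')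
      (hQ : Run B Q s' t' s'') : Run B (.seq P Q) s (t + t' + 1) s''
  | ite_true {e : Expr} {P Q : Program} {s s' : State} {t : ℕ} (he : e.Fits B s)
      (h : e.val s ≠ 0) (hP : Run B P s t s') : Run B (.ite e P Q) s (e.cost + t + 1) s'
  | ite_false {e : Expr} {P Q : Program} {s s' : State} {t : ℕ} (he : e.Fits B s)
      (h : e.val s = 0) (hQ : Run B Q s t s') : Run B (.ite e P Q) s (e.cost + t + 1) s'
  | loop_done {e : Expr} {P : Program} {s : State} (he : e.Fits B s) (h : e.val s = 0) :
      Run B (.loop e P) s (e.cost + 1) s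
  | loop_step {e : Expr} {P : Program} {s s' s'' : State} {t t' : ℕ} (he : e.Fits B s)
      (h : e.val s ≠ 0) (hP : Run B P s t s') (hL : Run B (.loop e P) s' t' s'') :
      Run B (.loop e P) s (e.cost + t + t' + 1) s''

/-! ### Input and output -/

/-- A finite sequence as the contents of an array, padded with zeros. -/
def toArr {k : ℕ} (f : Fin k → ℕ) (j : ℕ) : ℕ := if h : j < k then f ⟨j, h⟩ else 0

/-- The input: variables `0` and `1` hold `n` and `W`; arrays `0`, `1`, `2`, `3` hold the processing
requirements, the weights, and the numerators and denominators of the speeds. Everything else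
is `0`. -/
def Instance.init {m : ℕ} (I : Instance m) : State where
  var x := match x with
    | 0 => I.n
    | 1 => I.W
    | _ => 0
  arr a := match a with
    | 0 => toArr I.p
    | 1 => toArr I.w
    | 2 => toArr (fun i => (I.q i).num)
    | 3 => toArr (fun i => (I.q i).den)
    | _ => fun _ => 0

/-- The output: array `4` holds, at position `j`, the number `0` if job `j` is rejected and `i + 1`
if it runs on machine `i`, where `i = 0, ..., m - 1`. -/
def Instance.Outputs {m : ℕ} (I : Instance m) (s : State) (σ : I.Schedule) : Prop :=
  ∀ j : Fin I.n, s.arr 4 j = (σ j).elim 0 (fun i => (i : ℕ) + 1)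

/-- `P` solves `I` in at most `T` steps on words below `B`: it halts within `T` steps and outputs
an optimal schedule. -/
def Solves {m : ℕ} (P : Program) (I : Instance m) (B T : ℕ) : Prop :=
  ∃ (t : ℕ) (s : State) (σ : I.Schedule),
    Run B P I.init t s ∧ t ≤ T ∧ I.Outputs s σ ∧ I.IsOptimal σ

end SchedRej

/-!
A greedy guide schedule rejects jobs in order of increasing weight per unit of size until one more
job would exceed the budget `W`, and runs each accepted job on the machine that would complete it
first. Choose an optimal schedule `s` that disagrees with the guide on as few jobs as possible. If
`s` disagreed on jobs of total size more than `O(m⁵ M^(m+4))`, where `M` is the largest `p j + w j`,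
then by the pigeonhole principle there would be either many jobs of one kind that `s` newly accepts
on one machine and many of one kind that it newly rejects, or a cycle of machines along which `s`
moves many jobs of one size from each machine to the next. Undoing the first change on equal total
weights does not increase the load, because the guide rejects the jobs of smallest ratio; undoing
the second on equal total sizes does not change any load. Both would bring `s` closer to the guide.

Therefore on every prefix of the jobs each load of `s`, and the total rejected size, differs from
that of the guide by at most `O(m⁵ M^(m+4))`. A dynamic program whose states are these `m + 1`
differences, written as the digits of one machine word, and whose values are the largest remaining
rejection budgets has `O(M^((m+1)(m+4)))` states per job, and `(m+1)(m+4) ≤ (m+2)(m+3)`.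
-/

namespace SchedRej

open Finset

infixl:65 " +ₑ " => Expr.add
infixl:65 " -ₑ " => Expr.sub
infixl:70 " *ₑ " => Expr.mul
infixl:70 " /ₑ " => Expr.div
infix:50 " ≔ " => Program.assign
infixr:45 " ;; " => Program.seq

namespace State

theorem var_setVar_self (s : State) (x v : ℕ) : (s.setVar x v).var x = v :=
  Function.update_self ..

theorem var_setVar_of_ne (s : State) {x y : ℕ} (v : ℕ) (h : y ≠ x) :
    (s.setVar x v).var y = s.var y :=
  Function.update_of_ne h ..

theorem arr_setVar (s : State) (x v a : ℕ) : (s.setVar x v).arr a = s.arr a := rfl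

theorem var_setArr (s : State) (a i v x : ℕ) : (s.setArr a i v).var x = s.var x := rfl

theorem arr_setArr_self (s : State) (a i v : ℕ) :
    (s.setArr a i v).arr a = Function.update (s.arr a) i v :=
  Function.update_self ..

theorem arr_setArr_of_ne (s : State) {a c : ℕ} (i v : ℕ) (h : c ≠ a) :
    (s.setArr a i v).arr c = s.arr c :=
  Function.update_of_ne h ..

end State

/-- Total correctness: on words below `B`, the program `P` started in `s` halts after some number
`t` of steps in some state `s'` such that `Q t s'`. -/
def WP (B : ℕ) (P : Program) (s : State) (Q : ℕ → State → Prop) : Prop :=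
  ∃ t s', Run B P s t s' ∧ Q t s'

section WP

variable {B : ℕ} {P P' : Program} {s : State} {Q R : ℕ → State → Prop}

theorem WP.mono (h : WP B P s Q) (hQR : ∀ t s', Q t s' → R t s') : WP B P s R :=
  let ⟨t, s', hrun, hQ⟩ := h
  ⟨t, s', hrun, hQR t s' hQ⟩

theorem wp_skip : WP B .skip s Q ↔ Q 1 s := by
  refine ⟨?_, fun h => ⟨_, _, .skip s, h⟩⟩
  rintro ⟨t, s', ⟨⟩, hQ⟩
  exact hQ

theorem wp_assign {x : ℕ} {e : Expr} :
    WP B (x ≔ e) s Q ↔ e.Fits B s ∧ Q (e.cost + 1) (s.setVar x (e.val s)) := by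
  refine ⟨?_, fun h => ⟨_, _, .assign x e s h.1, h.2⟩⟩
  rintro ⟨t, s', ⟨⟩, hQ⟩
  exact ⟨‹_›, hQ⟩

theorem wp_store {a : ℕ} {i e : Expr} :
    WP B (.store a i e) s Q ↔
      i.Fits B s ∧ e.Fits B s ∧ Q (i.cost + e.cost + 1) (s.setArr a (i.val s) (e.val s)) := by
  refine ⟨?_, fun h => ⟨_, _, .store a i e s h.1 h.2.1, h.2.2⟩⟩
  rintro ⟨t, s', ⟨⟩, hQ⟩
  exact ⟨‹_›, ‹_›, hQ⟩

theorem wp_seq :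
    WP B (P ;; P') s Q ↔
      WP B P s fun t s' => WP B P' s' fun t' s'' => Q (t + t' + 1) s'' := by
  constructor
  · rintro ⟨t, s', ⟨_⟩, hQ⟩
    exact ⟨_, _, ‹_›, _, _, ‹_›, hQ⟩
  · rintro ⟨t, s', hP, t', s'', hP', hQ⟩
    exact ⟨_, _, .seq hP hP', hQ⟩

theorem wp_ite {e : Expr} :
    WP B (.ite e P P') s Q ↔
      e.Fits B s ∧ (e.val s ≠ 0 → WP B P s fun t s' => Q (e.cost + t + 1) s') ∧
        (e.val s = 0 → WP B P' s fun t s' => Q (e.cost + t + 1) s') := by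
  constructor
  · rintro ⟨t, s', hrun, hQ⟩
    cases hrun with
    | ite_true he h hP => exact ⟨he, fun _ => ⟨_, _, hP, hQ⟩, fun h' => absurd h' h⟩
    | ite_false he h hP' => exact ⟨he, fun h' => absurd h h', fun _ => ⟨_, _, hP', hQ⟩⟩
  · rintro ⟨he, htrue, hfalse⟩
    by_cases h : e.val s = 0
    · obtain ⟨t, s', hrun, hQ⟩ := hfalse h
      exact ⟨_, _, .ite_false he h hrun, hQ⟩
    · obtain ⟨t, s', hrun, hQ⟩ := htrue h
      exact ⟨_, _, .ite_true he h hrun, hQ⟩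

end WP

namespace Program

/-- The variables that a program may write, with repetitions. -/
def writtenVars : Program → List ℕ
  | skip => []
  | assign x _ => [x]
  | store _ _ _ => []
  | seq P Q => P.writtenVars ++ Q.writtenVars
  | ite _ P Q => P.writtenVars ++ Q.writtenVars
  | loop _ P => P.writtenVars

/-- The arrays that a program may write, with repetitions. -/
def writtenArrs : Program → List ℕ
  | skip => []
  | assign _ _ => []
  | store a _ _ => [a]
  | seq P Q => P.writtenArrs ++ Q.writtenArrs
  | ite _ P Q => P.writtenArrs ++ Q.writtenArrs
  | loop _ P => P.writtenArrs

end Program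

/-- The states agree except on the variables and arrays that `P` may write. -/
structure Frame (P : Program) (s s' : State) : Prop where
  var : ∀ {x : ℕ}, x ∉ P.writtenVars → s'.var x = s.var x
  arr : ∀ {a : ℕ}, a ∉ P.writtenArrs → s'.arr a = s.arr a

section Frame

variable {P P' : Program} {s s' s'' : State}

theorem Frame.refl (P : Program) (s : State) : Frame P s s := ⟨fun _ => rfl, fun _ => rfl⟩

theorem Frame.trans (h : Frame P s s') (h' : Frame P s' s'') : Frame P s s'' :=
  ⟨fun hx => (h'.var hx).trans (h.var hx), fun ha => (h'.arr ha).trans (h.arr ha)⟩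

theorem Frame.mono (h : Frame P s s') (hvar : P.writtenVars ⊆ P'.writtenVars)
    (harr : P.writtenArrs ⊆ P'.writtenArrs) : Frame P' s s' :=
  ⟨fun hx => h.var fun hx' => hx (hvar hx'), fun ha => h.arr fun ha' => ha (harr ha')⟩

theorem Frame.setVar {x : ℕ} (hx : x ∈ P.writtenVars) (s : State) (v : ℕ) :
    Frame P s (s.setVar x v) :=
  ⟨fun hy => s.var_setVar_of_ne v fun h => hy (h ▸ hx), fun _ => rfl⟩

theorem Frame.setArr {a : ℕ} (ha : a ∈ P.writtenArrs) (s : State) (i v : ℕ) :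
    Frame P s (s.setArr a i v) :=
  ⟨fun _ => rfl, fun hc => s.arr_setArr_of_ne i v fun h => hc (h ▸ ha)⟩

variable {B t : ℕ} {Q : ℕ → State → Prop}

theorem Run.frame (h : Run B P s t s') : Frame P s s' := by
  induction h with
  | skip s => exact .refl _ s
  | assign x e s _ => exact .setVar (List.mem_singleton_self x) s _
  | store a i e s _ _ => exact .setArr (List.mem_singleton_self a) s _ _
  | seq _ _ hP hQ =>
    exact (hP.mono (List.subset_append_left ..) (List.subset_append_left ..)).trans
      (hQ.mono (List.subset_append_right ..) (List.subset_append_right ..))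
  | ite_true _ _ _ hP => exact hP.mono (List.subset_append_left ..) (List.subset_append_left ..)
  | ite_false _ _ _ hQ => exact hQ.mono (List.subset_append_right ..) (List.subset_append_right ..)
  | loop_done _ _ => exact .refl _ _
  | loop_step _ _ _ _ hP hL => exact Frame.trans ⟨hP.var, hP.arr⟩ hL

theorem WP.frame (h : WP B P s Q) : WP B P s fun t s' => Q t s' ∧ Frame P s s' :=
  let ⟨t, s', hrun, hQ⟩ := h
  ⟨t, s', hrun, hQ, hrun.frame⟩

end Frame

/-- The loop that runs `P` for `x = 0, 1, ..., N - 1`, where `N` is the value of the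
variable `y`. -/
def forLoop (x y : ℕ) (P : Program) : Program :=
  x ≔ .const 0 ;; .loop (.var y -ₑ .var x) (P ;; x ≔ .var x +ₑ .const 1)

section ForLoop

variable {B N T x y : ℕ} {P : Program} {s : State} {I : ℕ → State → Prop}

theorem Frame.forLoop_of_body {s' : State} (h : Frame P s s') : Frame (forLoop x y P) s s' :=
  h.mono (by simp [forLoop, Program.writtenVars]) (by simp [forLoop, Program.writtenArrs])

theorem Frame.forLoop_counter (x y v : ℕ) (P : Program) (s : State) :
    Frame (forLoop x y P) s (s.setVar x v) :=
  .setVar (by simp [forLoop, Program.writtenVars]) s v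

theorem wp_counter_step {i d : ℕ} (hN : N < B) (hx : x ∉ P.writtenVars) (hxi : s.var x = i)
    (hyN : s.var y = N) (hid : i + (d + 1) = N) (hI : ∀ i s v, I i s → I i (s.setVar x v))
    (body : WP B P s fun t s' => t ≤ T ∧ I (i + 1) s')
    (rest : ∀ s', Frame (forLoop x y P) s s' → s'.var x = i + 1 → I (i + 1) s' →
      WP B (.loop (.var y -ₑ .var x) (P ;; x ≔ .var x +ₑ .const 1)) s' fun t s'' =>
        t ≤ d * (T + 10) + 4 ∧ I N s'') :
    WP B (.loop (.var y -ₑ .var x) (P ;; x ≔ .var x +ₑ .const 1)) s fun t s' =>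
      t ≤ (d + 1) * (T + 10) + 4 ∧ I N s' := by
  obtain ⟨t, s', hrun, ⟨ht, hI'⟩, hF⟩ := body.frame
  have hxi' : s'.var x = i := (hF.var hx).trans hxi
  have hstep : Run B (x ≔ .var x +ₑ .const 1) s' 4 (s'.setVar x (i + 1)) := by
    have hfits : (Expr.var x +ₑ .const 1).Fits B s' := by
      simp only [Expr.Fits, Expr.val, hxi']
      omega
    simpa only [Expr.val, hxi', Expr.cost] using Run.assign x _ s' hfits
  obtain ⟨t', s'', hloop, ht', hIN⟩ := rest (s'.setVar x (i + 1))
    (hF.forLoop_of_body.trans (.forLoop_counter ..)) (s'.var_setVar_self ..) (hI _ _ _ hI')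
  refine ⟨_, s'', .loop_step ?_ ?_ (.seq hrun hstep) hloop, ?_, hIN⟩
  · simp only [Expr.Fits, hxi, hyN]
    omega
  · simp only [Expr.val, hxi, hyN]
    omega
  · simp only [Expr.cost]
    linarith

theorem wp_counting_loop (hN : N < B) (hx : x ∉ P.writtenVars)
    (hy : y ∉ (forLoop x y P).writtenVars) (hyN : s.var y = N)
    (hI : ∀ i s v, I i s → I i (s.setVar x v))
    (body : ∀ i < N, ∀ s', Frame (forLoop x y P) s s' → s'.var x = i → I i s' →
      WP B P s' fun t s'' => t ≤ T ∧ I (i + 1) s'')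
    (d : ℕ) : ∀ i s', i + d = N → Frame (forLoop x y P) s s' → s'.var x = i → I i s' →
      WP B (.loop (.var y -ₑ .var x) (P ;; x ≔ .var x +ₑ .const 1)) s' fun t s'' =>
        t ≤ d * (T + 10) + 4 ∧ I N s'' := by
  induction d with
  | zero =>
    rintro i s' rfl hF hxi hIi
    have hyN' := (hF.var hy).trans hyN
    refine ⟨_, s', .loop_done ?_ ?_, ?_, hIi⟩
    · simp only [Expr.Fits, hxi, hyN']
      omega
    · simp only [Expr.val, hxi, hyN']
      omega
    · simp only [Expr.cost]
      omega
  | succ d ih =>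
    intro i s' hid hF hxi hIi
    exact wp_counter_step hN hx hxi ((hF.var hy).trans hyN) hid hI
      (body i (by omega) s' hF hxi hIi)
      fun s'' hF' hxi' hI' => ih (i + 1) s'' (by omega) (hF.trans hF') hxi' hI'

theorem wp_forLoop (N : ℕ) (I : ℕ → State → Prop) (hN : N < B) (hx : x ∉ P.writtenVars)
    (hy : y ∉ (forLoop x y P).writtenVars) (hyN : s.var y = N)
    (hI : ∀ i s v, I i s → I i (s.setVar x v)) (h0 : I 0 s)
    (body : ∀ i < N, ∀ s', Frame (forLoop x y P) s s' → s'.var x = i → I i s' →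
      WP B P s' fun t s'' => t ≤ T ∧ I (i + 1) s'') :
    WP B (forLoop x y P) s fun t s' => t ≤ N * (T + 10) + 8 ∧ I N s' := by
  rw [forLoop, wp_seq, wp_assign]
  refine ⟨by simp only [Expr.Fits]; omega, ?_⟩
  refine (wp_counting_loop hN hx hy hyN hI body N 0 _ (Nat.zero_add N)
    (.forLoop_counter ..) (s.var_setVar_self ..) (hI _ _ _ h0)).mono ?_
  rintro t s' ⟨ht, hIN⟩
  exact ⟨by simp only [Expr.cost]; omega, hIN⟩

end ForLoop

/-! ### Optimal schedules near a balanced greedy schedule -/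

section Combinatorics

theorem exists_perm_eqOn_periodicPts {α : Type*} (f : α → α) :
    ∃ π : Equiv.Perm α, (∀ x ∈ Function.periodicPts f, π x = f x) ∧
      ∀ x ∉ Function.periodicPts f, π x = x := by
  classical
  let e : Equiv.Perm (Function.periodicPts f) :=
    (Function.bijOn_periodicPts f).equiv f
  exact ⟨e.ofSubtype, fun x hx => Equiv.Perm.ofSubtype_apply_of_mem e hx,
    fun x hx => Equiv.Perm.ofSubtype_apply_of_not_mem e hx⟩

theorem exists_iterate_mem_periodicPts {α : Type*} [Finite α] (f : α → α) (x : α) :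
    ∃ k, f^[k] x ∈ Function.periodicPts f := by
  obtain ⟨a, b, hab, h⟩ := Finite.exists_ne_map_eq_of_infinite (fun k : ℕ => f^[k] x)
  wlog hlt : a < b generalizing a b
  · exact this b a hab.symm h.symm (by omega)
  refine ⟨a, Function.mk_mem_periodicPts (n := b - a) (by omega) ?_⟩
  rw [Function.IsPeriodicPt, Function.IsFixedPt, ← Function.iterate_add_apply,
    Nat.sub_add_cancel hlt.le]
  exact h.symm

theorem exists_perm_of_cycle {α : Type*} [Finite α] {R : α → α → Prop} (hR : ∀ x, ¬ R x x)
    {u v : α} (huv : R u v) (hvu : Relation.ReflTransGen R v u) :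
    ∃ π : Equiv.Perm α, (∃ x, π x ≠ x) ∧ ∀ x, π x ≠ x → R x (π x) := by
  classical
  let S : Set α := {x | Relation.ReflTransGen R v x ∧ Relation.ReflTransGen R x u}
  have exists_succ : ∀ x ∈ S, ∃ y ∈ S, R x y := by
    rintro x ⟨hvx, hxu⟩
    rcases Relation.ReflTransGen.cases_head hxu with rfl | ⟨y, hxy, hyu⟩
    · exact ⟨v, ⟨.refl, hvu⟩, huv⟩
    · exact ⟨y, ⟨hvx.tail hxy, hyu⟩, hxy⟩
  choose! f hfS hfR using exists_succ
  obtain ⟨π, hπ, hπ'⟩ := exists_perm_eqOn_periodicPts (S.piecewise f id)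
  have eq_f : ∀ x ∈ S, S.piecewise f id x = f x := fun x hx => Set.piecewise_eq_of_mem S f id hx
  have iterate_mem : ∀ k, (S.piecewise f id)^[k] v ∈ S := fun k =>
    Set.MapsTo.iterate (fun x hx => eq_f x hx ▸ hfS x hx) k ⟨.refl, hvu⟩
  obtain ⟨x, hxS, hx⟩ : ∃ x ∈ S, x ∈ Function.periodicPts (S.piecewise f id) :=
    (exists_iterate_mem_periodicPts _ v).imp' _ fun k hk => ⟨iterate_mem k, hk⟩
  refine ⟨π, ⟨x, fun h => hR x ?_⟩, fun x hx => ?_⟩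
  · rw [hπ x hx, eq_f x hxS] at h
    simpa only [h] using hfR x hxS
  · have hper : x ∈ Function.periodicPts (S.piecewise f id) := by
      by_contra h
      exact hx (hπ' x h)
    rw [hπ x hper] at hx ⊢
    by_cases hS : x ∈ S
    · rw [eq_f x hS]
      exact hfR x hS
    · exact absurd (Set.piecewise_eq_of_notMem S f id hS) hx

variable {ι : Type*}

theorem sum_add_sum_sdiff_comm [DecidableEq ι] (q : ι → ℕ) (s t : Finset ι) :
    ∑ j ∈ t, q j + ∑ j ∈ s \ t, q j = ∑ j ∈ s, q j + ∑ j ∈ t \ s, q j := by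
  rw [add_comm, ← sum_union sdiff_disjoint, add_comm (∑ j ∈ s, q j), ← sum_union sdiff_disjoint,
    sdiff_union_self_eq_union, sdiff_union_self_eq_union, union_comm]

theorem exists_lt_card_fiber {κ : Type*} [DecidableEq κ] {D : Finset ι} {t : Finset κ}
    {f : ι → κ} {N : ℕ} (hf : ∀ j ∈ D, f j ∈ t) (h : #t * N < #D) :
    ∃ j ∈ D, N < #{k ∈ D | f k = f j} := by
  obtain ⟨y, -, hy⟩ := exists_lt_card_fiber_of_mul_lt_card_of_maps_to hf h
  obtain ⟨j, hj⟩ := card_pos.1 ((Nat.zero_le _).trans_lt hy)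
  obtain ⟨hjD, rfl⟩ := mem_filter.1 hj
  exact ⟨j, hjD, hy⟩

end Combinatorics

section Proximity

variable {ι α : Type*} [Fintype ι]

/-- The jobs that `G` rejects and `s` accepts. -/
def newlyAccepted (G s : ι → Option α) : Finset ι := {j | G j = none ∧ s j ≠ none}

/-- The jobs that `G` accepts and `s` rejects. -/
def newlyRejected (G s : ι → Option α) : Finset ι := {j | G j ≠ none ∧ s j = none}

theorem mem_newlyAccepted {G s : ι → Option α} {j : ι} :
    j ∈ newlyAccepted G s ↔ G j = none ∧ s j ≠ none := by
  simp [newlyAccepted]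

theorem mem_newlyRejected {G s : ι → Option α} {j : ι} :
    j ∈ newlyRejected G s ↔ G j ≠ none ∧ s j = none := by
  simp [newlyRejected]

variable [DecidableEq α]

/-- The total of the quantity `q` over the jobs that the schedule `σ` maps to `o`: the load of a
machine or the rejected weight. -/
def total (q : ι → ℕ) (σ : ι → Option α) (o : Option α) : ℕ := ∑ j with σ j = o, q j

theorem total_add_sum_leaving {q : ι → ℕ} {σ τ : ι → Option α} {o : Option α} {A B : Finset ι}
    (hA : ∀ j, j ∈ A ↔ σ j = o ∧ τ j ≠ o) (hB : ∀ j, j ∈ B ↔ τ j = o ∧ σ j ≠ o) :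
    total q τ o + ∑ j ∈ A, q j = total q σ o + ∑ j ∈ B, q j := by
  classical
  obtain rfl : A = univ.filter (σ · = o) \ univ.filter (τ · = o) := by ext j; simp [hA]
  obtain rfl : B = univ.filter (τ · = o) \ univ.filter (σ · = o) := by ext j; simp [hB]
  exact sum_add_sum_sdiff_comm q _ _

theorem sum_total (q : ι → ℕ) (σ : ι → Option α) (S : Finset (Option α)) :
    ∑ o ∈ S, total q σ o = ∑ j with σ j ∈ S, q j := by
  rw [← sum_fiberwise_of_maps_to (s := {j | σ j ∈ S}) (t := S) (g := σ) (by simp)]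
  refine sum_congr rfl fun o ho => ?_
  rw [total, filter_filter]
  congr 1
  ext j
  simp only [mem_filter, mem_univ, true_and]
  exact ⟨fun h => ⟨h ▸ ho, h⟩, fun h => h.2⟩

theorem sum_total_add_sum_leaving (q : ι → ℕ) (σ τ : ι → Option α) (S : Finset (Option α)) :
    ∑ o ∈ S, total q τ o + ∑ j with σ j ∈ S ∧ τ j ∉ S, q j =
      ∑ o ∈ S, total q σ o + ∑ j with τ j ∈ S ∧ σ j ∉ S, q j := by
  classical
  rw [sum_total, sum_total, filter_and_not, filter_and_not]
  exact sum_add_sum_sdiff_comm q _ _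

/-- A schedule that rejects jobs greedily by the ratio of size and weight, exhausting the budget `W`
up to one job, and that balances the scaled loads of the machines up to one job. Here `M` bounds all
sizes and weights, and `c i` is the time that machine `i` needs per unit of size. -/
structure IsGuide (p w : ι → ℕ) (W M : ℕ) (c : α → ℕ) (G : ι → Option α) : Prop where
  accepts_of_size_zero : ∀ j, p j = 0 → G j ≠ none
  weight_pos : ∀ j, G j ≠ none → 0 < p j → 0 < w j
  ratio_le : ∀ j k, G j = none → G k ≠ none → 0 < p k → p k * w j ≤ p j * w k
  feasible : total w G none ≤ W
  nearly_full : ∀ j, G j ≠ none → 0 < p j → W ≤ total w G none + M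
  balanced : ∀ i k, c k * total p G (some k) ≤ c i * (total p G (some i) + M)

/-- Among the feasible schedules with no larger loads, `s` is nearest to `G`. -/
def IsNearest (p w : ι → ℕ) (W : ℕ) (G s : ι → Option α) : Prop :=
  ∀ τ : ι → Option α, total w τ none ≤ W → (∀ i, total p τ (some i) ≤ total p s (some i)) →
    #{j | s j ≠ G j} ≤ #{j | τ j ≠ G j}

variable {p w : ι → ℕ} {W M : ℕ} {c : α → ℕ} {G s : ι → Option α}

namespace IsNearest

theorem false_of_nearer (hs : IsNearest p w W G s) (τ : ι → Option α)
    (hτ : total w τ none ≤ W) (hload : ∀ i, total p τ (some i) ≤ total p s (some i))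
    (hne : ∀ j, τ j ≠ G j → s j ≠ G j) (heq : ∃ j, s j ≠ G j ∧ τ j = G j) : False := by
  refine (hs τ hτ hload).not_gt (card_lt_card ?_)
  rw [ssubset_iff_of_subset (monotone_filter_right _ fun j _ => hne j)]
  obtain ⟨j, hj, hj'⟩ := heq
  exact ⟨j, by simpa using hj, by simpa using hj'⟩

theorem size_pos (hs : IsNearest p w W G s) (hG : ∀ j, p j = 0 → G j ≠ none)
    (hW : total w s none ≤ W) {j : ι} (hj : s j ≠ G j) : 0 < p j := by
  classical
  rw [Nat.pos_iff_ne_zero]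
  intro hpj
  let τ := Function.update s j (G j)
  have hτ : ∀ k, τ k = if k = j then G j else s k := fun k => Function.update_apply s j (G j) k
  have total_le : ∀ q o, (G j = o → q j = 0) → total q τ o ≤ total q s o := by
    intro q o hq
    have := total_add_sum_leaving (q := q) (σ := s) (τ := τ) (o := o)
      (A := if s j = o then {j} else ∅) (B := if G j = o then {j} else ∅)
      (by intro k; grind) (by intro k; grind)
    split_ifs at this <;> simp_all
    all_goals omega
  refine hs.false_of_nearer τ ((total_le w none fun h => absurd h (hG j hpj)).trans hW)
    (fun i => total_le p _ fun _ => hpj) (fun k => ?_) ⟨j, hj, by simp [hτ]⟩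
  grind

theorem no_swap (hs : IsNearest p w W G s) (hW : total w s none ≤ W) {i : α}
    {A B : Finset ι} (hA : ∀ j ∈ A, G j = none ∧ s j = some i)
    (hB : ∀ j ∈ B, G j ≠ none ∧ s j = none) (hne : A.Nonempty)
    (hw : ∑ j ∈ A, w j ≤ ∑ j ∈ B, w j) (hp : ∑ j ∈ B, p j ≤ ∑ j ∈ A, p j) : False := by
  classical
  let τ : ι → Option α := fun j => if j ∈ A then none else if j ∈ B then some i else s j
  have hτ : ∀ j, τ j = if j ∈ A then none else if j ∈ B then some i else s j := fun j => rfl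
  refine hs.false_of_nearer τ ?_ (fun k => ?_) (by grind) ?_
  · have := total_add_sum_leaving (q := w) (σ := s) (τ := τ) (o := none) (A := B) (B := A)
      (by grind) (by grind)
    omega
  · obtain rfl | hk := eq_or_ne k i
    · have := total_add_sum_leaving (q := p) (σ := s) (τ := τ) (o := some k) (A := A) (B := B)
        (by grind) (by grind)
      omega
    · have := total_add_sum_leaving (q := p) (σ := s) (τ := τ) (o := some k) (A := ∅) (B := ∅)
        (by grind) (by grind)
      simpa using this.le
  · obtain ⟨j, hj⟩ := hne
    exact ⟨j, by grind⟩

theorem no_cycle (hs : IsNearest p w W G s) (hW : total w s none ≤ W)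
    (π : Equiv.Perm α) (hπ : ∃ x, π x ≠ x) (J : α → Finset ι) {V : ℕ} (hV : 0 < V)
    (hJ : ∀ u, ∀ j ∈ J u, G j = some u ∧ s j = some (π u))
    (hvol : ∀ u, π u ≠ u → ∑ j ∈ J u, p j = V) : False := by
  classical
  let τ : ι → Option α := fun j => if ∃ u, j ∈ J u then G j else s j
  have hτ : ∀ j, (∀ u, j ∉ J u) → τ j = s j := fun j hj => if_neg (by simpa using hj)
  have hτ' : ∀ u, ∀ j ∈ J u, τ j = some u := fun u j hj => (if_pos ⟨u, hj⟩).trans (hJ u j hj).1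
  refine hs.false_of_nearer τ ?_ (fun i => ?_) (by grind) ?_
  · have := total_add_sum_leaving (q := w) (σ := s) (τ := τ) (o := none) (A := ∅) (B := ∅)
      (by grind) (by grind)
    simp only [sum_empty, add_zero] at this
    exact this.trans_le hW
  · obtain hi | hi := eq_or_ne (π i) i
    · have hi' := (Equiv.symm_apply_eq π).2 hi.symm
      have := total_add_sum_leaving (q := p) (σ := s) (τ := τ) (o := some i) (A := ∅) (B := ∅)
        (by grind) (by grind)
      simpa using this.le
    · have hi' : π (π.symm i) ≠ π.symm i := by
        rw [Equiv.apply_symm_apply]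
        exact fun h => hi ((Equiv.eq_symm_apply π).1 h)
      have := total_add_sum_leaving (q := p) (σ := s) (τ := τ) (o := some i)
        (A := J (π.symm i)) (B := J i) (by grind) (by grind)
      rw [hvol i hi, hvol _ hi'] at this
      omega
  · obtain ⟨u, hu⟩ := hπ
    obtain ⟨j, hj, -⟩ := exists_ne_zero_of_sum_ne_zero ((hvol u hu).trans_ne hV.ne')
    exact ⟨j, by grind⟩

theorem size_pos_of_mem_newlyRejected (hs : IsNearest p w W G s)
    (hG : ∀ j, p j = 0 → G j ≠ none) (hW : total w s none ≤ W) {j : ι}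
    (hj : j ∈ newlyRejected G s) : 0 < p j :=
  hs.size_pos hG hW (by grind [mem_newlyRejected])

theorem card_newlyRejected_le_sum_weight (hs : IsNearest p w W G s) (hG : IsGuide p w W M c G)
    (hW : total w s none ≤ W) : #(newlyRejected G s) ≤ ∑ j ∈ newlyRejected G s, w j := by
  rw [card_eq_sum_ones]
  exact sum_le_sum fun j hj => hG.weight_pos j (mem_newlyRejected.1 hj).1
    (hs.size_pos_of_mem_newlyRejected hG.accepts_of_size_zero hW hj)

theorem weight_newlyRejected_le (hs : IsNearest p w W G s) (hG : IsGuide p w W M c G)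
    (hW : total w s none ≤ W) :
    ∑ j ∈ newlyRejected G s, w j ≤ ∑ j ∈ newlyAccepted G s, w j + M := by
  obtain h | ⟨j, hj⟩ := (newlyRejected G s).eq_empty_or_nonempty
  · simp [h]
  have hfull : W ≤ total w G none + M := hG.nearly_full j (mem_newlyRejected.1 hj).1
    (hs.size_pos_of_mem_newlyRejected hG.accepts_of_size_zero hW hj)
  have := total_add_sum_leaving (q := w) (σ := G) (τ := s) (o := none)
    (A := newlyAccepted G s) (B := newlyRejected G s)
    (fun j => mem_newlyAccepted) (fun j => mem_newlyRejected.trans and_comm)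
  omega

end IsNearest

variable [Fintype α]

/-- Many jobs of one positive size that `G` runs on `u` are run on `v` by `s`. -/
def BigFlow (p : ι → ℕ) (M : ℕ) (G s : ι → Option α) (u v : α) : Prop :=
  u ≠ v ∧ ∃ x, 0 < x ∧ x ≤ M ∧
    M ^ Fintype.card α ≤ #{j | (G j = some u ∧ s j = some v) ∧ p j = x}

/-- The total of `q` over the jobs that `G` maps to `o` and `s` maps to `o'`. -/
def flow (q : ι → ℕ) (G s : ι → Option α) (o o' : Option α) : ℕ :=
  ∑ j with G j = o ∧ s j = o', q j

theorem sum_le_of_flow_le {q : ι → ℕ} {D : Finset ι} {K : ℕ}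
    (h : ∀ j ∈ D, flow q G s (G j) (s j) ≤ K) :
    ∑ j ∈ D, q j ≤ (Fintype.card α + 1) ^ 2 * K := by
  rw [← sum_fiberwise_of_maps_to (t := (univ : Finset (Option α × Option α)))
    (g := fun j => (G j, s j)) (fun _ _ => mem_univ _)]
  refine (sum_le_card_nsmul _ _ K fun o _ => ?_).trans (by simp [card_univ, sq])
  obtain hD | ⟨j, hj⟩ := ({j ∈ D | (G j, s j) = o} : Finset ι).eq_empty_or_nonempty
  · simp [hD]
  · obtain ⟨hjD, rfl⟩ := mem_filter.1 hj
    exact (sum_le_sum_of_subset fun k hk => by grind).trans (h j hjD)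

namespace IsNearest

/-- The volumes moved along the edges of the cycle are all made equal to the product of the sizes
of the jobs chosen on the edges. -/
theorem no_bigFlow_cycle (hs : IsNearest p w W G s) (hW : total w s none ≤ W)
    {u v : α} (huv : BigFlow p M G s u v)
    (hvu : Relation.ReflTransGen (BigFlow p M G s) v u) : False := by
  obtain ⟨π, hπ, hR⟩ := exists_perm_of_cycle (fun x h => h.1 rfl) huv hvu
  have hM : 0 < M := by
    obtain ⟨-, x, hx, hxM, -⟩ := huv
    exact hx.trans_le hxM
  have exists_size : ∀ u, ∃ x, 0 < x ∧ x ≤ M ∧ (π u ≠ u →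
      M ^ Fintype.card α ≤ #{j | (G j = some u ∧ s j = some (π u)) ∧ p j = x}) := by
    intro u
    obtain h | h := eq_or_ne (π u) u
    · exact ⟨M, hM, le_rfl, fun h' => absurd h h'⟩
    · obtain ⟨-, x, hx, hxM, hcard⟩ := hR u h
      exact ⟨x, hx, hxM, fun _ => hcard⟩
  choose x hx hxM hcard using exists_size
  have prod_erase_le : ∀ u, ∏ k ∈ univ.erase u, x k ≤ M ^ Fintype.card α := fun u =>
    calc ∏ k ∈ univ.erase u, x k ≤ M ^ #(univ.erase u) := prod_le_pow_card _ _ _ fun k _ => hxM k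
      _ ≤ M ^ Fintype.card α := Nat.pow_le_pow_right hM (card_le_univ _)
  have exists_jobs : ∀ u, ∃ J : Finset ι, (∀ j ∈ J, G j = some u ∧ s j = some (π u)) ∧
      (π u ≠ u → ∑ j ∈ J, p j = ∏ k, x k) := by
    intro u
    obtain h | h := eq_or_ne (π u) u
    · exact ⟨∅, by simp, fun h' => absurd h h'⟩
    · obtain ⟨J, hJ, hJcard⟩ := exists_subset_card_eq ((prod_erase_le u).trans (hcard u h))
      refine ⟨J, fun j hj => (mem_filter.1 (hJ hj)).2.1, fun _ => ?_⟩
      rw [sum_const_nat fun j hj => (mem_filter.1 (hJ hj)).2.2, hJcard,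
        prod_erase_mul _ _ (mem_univ u)]
  choose J hJ hvol using exists_jobs
  exact hs.no_cycle hW π hπ J (prod_pos fun k _ => hx k) hJ hvol

/-- If both sets were large, `w b` equal newly accepted jobs `a` on one machine could be exchanged
for `w a` equal newly rejected jobs `b`. -/
theorem card_newlyAccepted_le_or_card_newlyRejected_le (hs : IsNearest p w W G s)
    (hG : IsGuide p w W M c G) (hW : total w s none ≤ W) (hp : ∀ j, p j ≤ M)
    (hw : ∀ j, w j ≤ M) :
    #(newlyAccepted G s) ≤ (M + 1) ^ 2 * (Fintype.card α + 1) * M ∨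
      #(newlyRejected G s) ≤ (M + 1) ^ 2 * M := by
  by_contra! h
  have size_weight_mem : ∀ j, (p j, w j) ∈ range (M + 1) ×ˢ range (M + 1) := fun j => by
    simp [Nat.lt_succ_of_le (hp j), Nat.lt_succ_of_le (hw j)]
  obtain ⟨a, ha, hA⟩ := exists_lt_card_fiber (f := fun j => ((p j, w j), s j))
    (t := (range (M + 1) ×ˢ range (M + 1)) ×ˢ univ)
    (fun j _ => mem_product.2 ⟨size_weight_mem j, mem_univ _⟩)
    (by simpa [card_univ, ← sq] using h.1)
  obtain ⟨b, hb, hB⟩ := exists_lt_card_fiber (f := fun j => (p j, w j))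
    (fun j _ => size_weight_mem j) (by simpa [← sq] using h.2)
  rw [mem_newlyAccepted] at ha
  rw [mem_newlyRejected] at hb
  obtain ⟨i, hi⟩ := Option.ne_none_iff_exists'.1 ha.2
  have hpb : 0 < p b := hs.size_pos hG.accepts_of_size_zero hW (by grind)
  obtain ⟨A, hAsub, hAcard⟩ := exists_subset_card_eq ((hw b).trans hA.le)
  obtain ⟨B, hBsub, hBcard⟩ := exists_subset_card_eq ((hw a).trans hB.le)
  have hA' : ∀ j ∈ A, (G j = none ∧ s j = some i) ∧ p j = p a ∧ w j = w a := fun j hj => by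
    have := hAsub hj
    grind [mem_newlyAccepted]
  have hB' : ∀ j ∈ B, (G j ≠ none ∧ s j = none) ∧ p j = p b ∧ w j = w b := fun j hj => by
    have := hBsub hj
    grind [mem_newlyRejected]
  refine hs.no_swap hW (fun j hj => (hA' j hj).1) (fun j hj => (hB' j hj).1)
    (card_pos.1 (hAcard ▸ hG.weight_pos b hb.1 hpb)) ?_ ?_
  · rw [sum_const_nat fun j hj => (hA' j hj).2.2, sum_const_nat fun j hj => (hB' j hj).2.2,
      hAcard, hBcard, mul_comm]
  · rw [sum_const_nat fun j hj => (hA' j hj).2.1, sum_const_nat fun j hj => (hB' j hj).2.1,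
      hAcard, hBcard]
    linarith [hG.ratio_le a b ha.1 hb.1 hpb]

end IsNearest

theorem sum_entering_le (hL : ∀ i, total p s (some i) ≤ total p G (some i) + M)
    (S : Finset (Option α)) (hS : none ∉ S) :
    ∑ j with s j ∈ S ∧ G j ∉ S, p j ≤
      ∑ j with G j ∈ S ∧ s j ∉ S, p j + Fintype.card α * M := by
  have hcard : #S ≤ Fintype.card α := by
    have := card_le_univ (insert none S)
    rw [card_insert_of_notMem hS, Fintype.card_option] at this
    omega
  have hload : ∑ o ∈ S, total p s o ≤ ∑ o ∈ S, total p G o + Fintype.card α * M :=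
    calc ∑ o ∈ S, total p s o ≤ ∑ o ∈ S, (total p G o + M) := sum_le_sum fun o ho => by
          obtain ⟨i, rfl⟩ := Option.ne_none_iff_exists'.1 (ne_of_mem_of_not_mem ho hS)
          exact hL i
      _ = ∑ o ∈ S, total p G o + #S * M := by rw [sum_add_distrib, sum_const, smul_eq_mul]
      _ ≤ _ := by gcongr
  have := sum_total_add_sum_leaving p G s S
  omega

theorem size_newlyAccepted_le (hL : ∀ i, total p s (some i) ≤ total p G (some i) + M) :
    ∑ j ∈ newlyAccepted G s, p j ≤ ∑ j ∈ newlyRejected G s, p j + Fintype.card α * M := by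
  have hA : newlyAccepted G s =
      univ.filter fun j => s j ∈ univ.erase none ∧ G j ∉ univ.erase none := by
    ext j
    simp [mem_newlyAccepted, and_comm]
  have hB : newlyRejected G s =
      univ.filter fun j => G j ∈ univ.erase none ∧ s j ∉ univ.erase none := by
    ext j
    simp [mem_newlyRejected]
  rw [hA, hB]
  exact sum_entering_le hL _ (notMem_erase none univ)

namespace IsNearest

theorem size_rejection_change_le [Nonempty α] (hs : IsNearest p w W G s)
    (hG : IsGuide p w W M c G) (hW : total w s none ≤ W) (hM : 0 < M) (hp : ∀ j, p j ≤ M)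
    (hw : ∀ j, w j ≤ M) (hL : ∀ i, total p s (some i) ≤ total p G (some i) + M) :
    ∑ j ∈ newlyAccepted G s, p j ≤ 9 * Fintype.card α * M ^ 5 ∧
      ∑ j ∈ newlyRejected G s, p j ≤ 9 * Fintype.card α * M ^ 5 := by
  have hm : 1 ≤ Fintype.card α := Fintype.card_pos
  have le_card_mul : ∀ (q : ι → ℕ) (D : Finset ι), (∀ j, q j ≤ M) → ∑ j ∈ D, q j ≤ #D * M :=
    fun q D hq => sum_le_card_nsmul _ _ _ fun j _ => hq j
  have hpA := le_card_mul p (newlyAccepted G s) hp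
  have hpB := le_card_mul p (newlyRejected G s) hp
  have hwA := le_card_mul w (newlyAccepted G s) hw
  have hwB := hs.weight_newlyRejected_le hG hW
  have hcB := hs.card_newlyRejected_le_sum_weight hG hW
  have hAB := size_newlyAccepted_le hL
  have := hs.card_newlyAccepted_le_or_card_newlyRejected_le hG hW hp hw
  generalize Fintype.card α = m at *
  have hK : (M + 1) ^ 2 * (m + 1) * M ≤ 8 * m * M ^ 3 :=
    calc (M + 1) ^ 2 * (m + 1) * M ≤ (M + M) ^ 2 * (m + m) * M := by gcongr; omega
      _ = 8 * m * M ^ 3 := by ring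
  have hbound : (8 * m * M ^ 3 * M + m * M) * M ≤ 9 * m * M ^ 5 :=
    calc (8 * m * M ^ 3 * M + m * M) * M = 8 * m * M ^ 5 + m * M ^ 2 := by ring
      _ ≤ 8 * m * M ^ 5 + m * M ^ 5 := by gcongr; omega
      _ = 9 * m * M ^ 5 := by ring
  have le_bound : 8 * m * M ^ 3 * M + m * M ≤ 9 * m * M ^ 5 :=
    (Nat.le_mul_of_pos_right _ hM).trans hbound
  rcases this with hA | hB
  · have hA' : #(newlyAccepted G s) * M ≤ 8 * m * M ^ 3 * M := by gcongr; exact hA.trans hK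
    have hB' : #(newlyRejected G s) * M ≤ (8 * m * M ^ 3 * M + m * M) * M := by
      gcongr
      have := Nat.le_mul_of_pos_left M hm
      omega
    omega
  · have hB' : #(newlyRejected G s) * M ≤ 8 * m * M ^ 3 * M := by
      gcongr
      refine hB.trans (le_trans ?_ hK)
      gcongr
      exact Nat.le_mul_of_pos_right _ (by omega)
    omega

theorem flow_le_of_not_bigFlow (hs : IsNearest p w W G s) (hG : ∀ j, p j = 0 → G j ≠ none)
    (hW : total w s none ≤ W) (hM : 0 < M) (hp : ∀ j, p j ≤ M) {u v : α} (huv : u ≠ v)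
    (h : ¬ BigFlow p M G s u v) :
    flow p G s (some u) (some v) ≤ 2 * M ^ (Fintype.card α + 2) := by
  have hcard : #{j | G j = some u ∧ s j = some v} ≤ (M + 1) * M ^ Fintype.card α := by
    by_contra! hcard
    obtain ⟨j, hj, hjcard⟩ := exists_lt_card_fiber (f := p) (t := range (M + 1))
      (fun j _ => by simp [Nat.lt_succ_of_le (hp j)]) (by simpa using hcard)
    rw [filter_filter] at hjcard
    exact h ⟨huv, p j, hs.size_pos hG hW (by grind), hp j, hjcard.le⟩
  calc flow p G s (some u) (some v)
      ≤ #{j | G j = some u ∧ s j = some v} * M := sum_le_card_nsmul _ _ _ fun j _ => hp j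
    _ ≤ (M + M) * M ^ Fintype.card α * M := by
      gcongr
      exact hcard.trans (by gcongr; omega)
    _ = 2 * M ^ (Fintype.card α + 2) := by ring

/-- If the flow from `u` to `v` is big, the machines that are reachable from `v` by big flows
do not include `u`, so this flow enters them and has to be matched by small flows that leave. -/
theorem flow_le (hs : IsNearest p w W G s) (hG : ∀ j, p j = 0 → G j ≠ none)
    (hW : total w s none ≤ W) (hM : 0 < M) (hp : ∀ j, p j ≤ M)
    (hL : ∀ i, total p s (some i) ≤ total p G (some i) + M) {u v : α} (huv : u ≠ v) :
    flow p G s (some u) (some v) ≤ (Fintype.card α + 1) ^ 2 *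
        (2 * M ^ (Fintype.card α + 2) + ∑ j ∈ newlyRejected G s, p j) + Fintype.card α * M := by
  classical
  by_cases hbig : BigFlow p M G s u v
  swap
  · refine (hs.flow_le_of_not_bigFlow hG hW hM hp huv hbig).trans ?_
    exact le_add_right ((Nat.le_add_right _ _).trans (Nat.le_mul_of_pos_left _ (by positivity)))
  let R : α → Prop := Relation.ReflTransGen (BigFlow p M G s) v
  let S : Finset (Option α) := {o | ∃ x, o = some x ∧ R x}
  have mem_S : ∀ x, some x ∈ S ↔ R x := fun x => by simp [S]
  have none_notMem : none ∉ S := by simp [S]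
  have hu : ¬ R u := hs.no_bigFlow_cycle hW hbig
  calc flow p G s (some u) (some v)
      ≤ ∑ j with s j ∈ S ∧ G j ∉ S, p j := sum_le_sum_of_subset fun j hj => by
        have : R v := .refl
        grind
    _ ≤ ∑ j with G j ∈ S ∧ s j ∉ S, p j + Fintype.card α * M := sum_entering_le hL S none_notMem
    _ ≤ _ := by
      gcongr
      refine sum_le_of_flow_le (G := G) (s := s) fun j hj => ?_
      obtain ⟨hjG, hjs⟩ := (mem_filter.1 hj).2
      obtain ⟨x, hx⟩ := Option.ne_none_iff_exists'.1 (ne_of_mem_of_not_mem hjG none_notMem)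
      rw [hx] at hjG ⊢
      cases hjs' : s j with
      | none => exact le_add_left (sum_le_sum_of_subset fun k hk => by grind [mem_newlyRejected])
      | some y =>
        rw [hjs', mem_S] at hjs
        rw [mem_S] at hjG
        exact le_add_right (hs.flow_le_of_not_bigFlow hG hW hM hp
          (fun h => hjs (h ▸ hjG)) fun h => hjs (hjG.tail h))

theorem sum_size_changed_le [Nonempty α] (hs : IsNearest p w W G s) (hG : IsGuide p w W M c G)
    (hW : total w s none ≤ W) (hM : 0 < M) (hp : ∀ j, p j ≤ M) (hw : ∀ j, w j ≤ M)
    (hL : ∀ i, total p s (some i) ≤ total p G (some i) + M) :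
    ∑ j with s j ≠ G j, p j ≤ 180 * Fintype.card α ^ 5 * M ^ (Fintype.card α + 4) := by
  have hm : 1 ≤ Fintype.card α := Fintype.card_pos
  obtain ⟨hA, hB⟩ := hs.size_rejection_change_le hG hW hM hp hw hL
  have hflow := fun u v (huv : u ≠ v) => hs.flow_le hG.accepts_of_size_zero hW hM hp hL huv
  have hsum := sum_le_of_flow_le (q := p) (D := {j | s j ≠ G j}) (G := G) (s := s)
    (K := 45 * Fintype.card α ^ 3 * M ^ (Fintype.card α + 4))
  generalize Fintype.card α = m at *
  have sq_le : (m + 1) ^ 2 ≤ 4 * m ^ 2 := by nlinarith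
  have le_cube : m ≤ m ^ 3 := Nat.le_self_pow (by norm_num) m
  have hrej : 9 * m * M ^ 5 ≤ 9 * m * M ^ (m + 4) := by gcongr; omega
  have hrej' : 9 * m * M ^ (m + 4) ≤ 45 * m ^ 3 * M ^ (m + 4) := by gcongr; norm_num
  have hK : (m + 1) ^ 2 * (2 * M ^ (m + 2) + 9 * m * M ^ 5) + m * M ≤
      45 * m ^ 3 * M ^ (m + 4) :=
    calc (m + 1) ^ 2 * (2 * M ^ (m + 2) + 9 * m * M ^ 5) + m * M
        ≤ 4 * m ^ 2 * (2 * m * M ^ (m + 4) + 9 * m * M ^ (m + 4)) + m ^ 3 * M ^ (m + 4) := by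
          gcongr
          · exact Nat.le_mul_of_pos_right 2 hm
          · omega
          · exact Nat.le_self_pow (by omega) M
      _ = _ := by ring
  refine (hsum fun j hj => ?_).trans ?_
  · have hj : s j ≠ G j := (mem_filter.1 hj).2
    cases hjG : G j with
    | none =>
      refine (sum_le_sum_of_subset fun k hk => ?_).trans (hA.trans (hrej.trans hrej'))
      grind [mem_newlyAccepted]
    | some u =>
      cases hjs : s j with
      | none =>
        refine (sum_le_sum_of_subset fun k hk => ?_).trans (hB.trans (hrej.trans hrej'))
        grind [mem_newlyRejected]
      | some v =>
        exact (hflow u v (by grind)).trans (le_trans (by gcongr) hK)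
  · calc (m + 1) ^ 2 * (45 * m ^ 3 * M ^ (m + 4))
        ≤ 4 * m ^ 2 * (45 * m ^ 3 * M ^ (m + 4)) := by gcongr
      _ = _ := by ring

end IsNearest

theorem exists_near_guide [Nonempty α] (hG : IsGuide p w W M c G) (hM : 0 < M)
    (hp : ∀ j, p j ≤ M) (hw : ∀ j, w j ≤ M) {σ : ι → Option α} (hσ : total w σ none ≤ W)
    (hL : ∀ i, total p σ (some i) ≤ total p G (some i) + M) :
    ∃ s : ι → Option α, total w s none ≤ W ∧ (∀ i, total p s (some i) ≤ total p σ (some i)) ∧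
      ∑ j with s j ≠ G j, p j ≤ 180 * Fintype.card α ^ 5 * M ^ (Fintype.card α + 4) := by
  classical
  obtain ⟨s, hs, hmin⟩ := exists_min_image
    {s : ι → Option α | total w s none ≤ W ∧ ∀ i, total p s (some i) ≤ total p σ (some i)}
    (fun s => #{j | s j ≠ G j}) ⟨σ, by simp [hσ]⟩
  simp only [mem_filter, mem_univ, true_and] at hs hmin
  have hnear : IsNearest p w W G s :=
    fun τ hτ hload => hmin τ ⟨hτ, fun i => (hload i).trans (hs.2 i)⟩
  exact ⟨s, hs.1, hs.2,
    hnear.sum_size_changed_le hG hs.1 hM hp hw fun i => (hs.2 i).trans (hL i)⟩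

end Proximity

/-! ### The dynamic program -/

section Digits

/-- The digit of `x` at position `i` in base `b`. -/
def digit (b i x : ℕ) : ℕ := x / b ^ i % b

/-- The number with the digits `d 0, ..., d (K - 1)` in base `b`. -/
def ofDigits (b K : ℕ) (d : ℕ → ℕ) : ℕ := ∑ i ∈ range K, d i * b ^ i

variable {b K : ℕ} {d : ℕ → ℕ}

theorem ofDigits_eq_finFunctionFinEquiv (hd : ∀ i < K, d i < b) :
    ofDigits b K d = finFunctionFinEquiv fun i : Fin K => (⟨d i, hd i i.2⟩ : Fin b) := by
  rw [ofDigits, sum_range, finFunctionFinEquiv_apply]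

theorem ofDigits_lt (hd : ∀ i < K, d i < b) : ofDigits b K d < b ^ K := by
  rw [ofDigits_eq_finFunctionFinEquiv hd]
  exact Fin.is_lt _

theorem digit_ofDigits (hd : ∀ i < K, d i < b) {i : ℕ} (hi : i < K) :
    digit b i (ofDigits b K d) = d i := by
  rw [ofDigits_eq_finFunctionFinEquiv hd, digit,
    ← finFunctionFinEquiv_symm_apply_val (b := ⟨i, hi⟩), Equiv.symm_apply_apply]

theorem ofDigits_digit {x : ℕ} (hx : x < b ^ K) : ofDigits b K (digit b · x) = x := by
  have := congrArg Fin.val (finFunctionFinEquiv.apply_symm_apply (⟨x, hx⟩ : Fin (b ^ K)))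
  rw [finFunctionFinEquiv_apply] at this
  simpa only [ofDigits, digit, sum_range, finFunctionFinEquiv_symm_apply_val] using this

theorem eq_of_digit_eq {x y : ℕ} (hx : x < b ^ K) (hy : y < b ^ K)
    (h : ∀ i < K, digit b i x = digit b i y) : x = y := by
  rw [← ofDigits_digit hx, ← ofDigits_digit hy]
  exact sum_congr rfl fun i hi => congrArg (· * b ^ i) (h i (mem_range.1 hi))

/-- The number in base `b` obtained from `x` by moving `v` units from digit `c` to digit `g`. -/
def moveDigit (b v c g x : ℕ) : ℕ := x + v * b ^ g - v * b ^ c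

/-- Moving `v` units from digit `c` to digit `g` of `x` causes neither a borrow nor a carry. -/
def CanMoveDigit (b v c g x : ℕ) : Prop := v ≤ digit b c x ∧ digit b g x + v < b

theorem mul_pow_le_of_le_digit {v c x : ℕ} (h : v ≤ digit b c x) : v * b ^ c ≤ x :=
  (Nat.mul_le_mul_right _ (h.trans (Nat.mod_le _ _))).trans (Nat.div_mul_le_self _ _)

theorem CanMoveDigit.spec {v c g x : ℕ} (h : CanMoveDigit b v c g x) (hx : x < b ^ K)
    (hc : c < K) (hg : g < K) :
    moveDigit b v c g x < b ^ K ∧ ∀ i < K, digit b i (moveDigit b v c g x) +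
      (if i = c then v else 0) = digit b i x + if i = g then v else 0 := by
  have hle := mul_pow_le_of_le_digit h.1
  obtain ⟨hvc, hvg⟩ := h
  let d i := digit b i x + (if i = g then v else 0) - if i = c then v else 0
  have hd : ∀ i, d i + (if i = c then v else 0) = digit b i x + if i = g then v else 0 := by
    intro i
    grind
  have hlt : ∀ i < K, d i < b := fun i _ => by
    have : digit b i x < b := Nat.mod_lt _ (by omega)
    have := hd i
    grind
  have sum_single : ∀ k < K, ∑ i ∈ range K, (if i = k then v else 0) * b ^ i = v * b ^ k :=
    fun k hk => by simp [hk]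
  have hmove : moveDigit b v c g x = ofDigits b K d := by
    have : ofDigits b K d + v * b ^ c = x + v * b ^ g := by
      conv_rhs => rw [← ofDigits_digit hx]
      rw [ofDigits, ofDigits, ← sum_single c hc, ← sum_single g hg, ← sum_add_distrib,
        ← sum_add_distrib]
      exact sum_congr rfl fun i _ => by rw [← add_mul, ← add_mul, hd]
    rw [moveDigit]
    omega
  rw [hmove]
  exact ⟨ofDigits_lt hlt, fun i hi => by rw [digit_ofDigits hlt hi, hd]⟩

end Digits

/-- The total of `q` over the jobs before `j` that `f` maps to `c`. -/
def prefixTotal (q f : ℕ → ℕ) (c j : ℕ) : ℕ := ∑ k ∈ range j, if f k = c then q k else 0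

theorem prefixTotal_zero (q f : ℕ → ℕ) (c : ℕ) : prefixTotal q f c 0 = 0 := rfl

theorem prefixTotal_succ (q f : ℕ → ℕ) (c j : ℕ) :
    prefixTotal q f c (j + 1) = prefixTotal q f c j + if f j = c then q j else 0 :=
  sum_range_succ _ _

/-- The data of the dynamic program. A schedule is coded by a function to `{0, ..., K - 1}`, where
`0` stands for rejection and `i + 1` for machine `i`. The dynamic program considers the schedules
whose partial loads differ from those of the schedule `g` by at most `h`; `W` bounds the rejected
weight. -/
structure DynProg where
  K : ℕ
  h : ℕ
  W : ℕ
  p : ℕ → ℕ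
  w : ℕ → ℕ
  g : ℕ → ℕ

namespace DynProg

variable (D : DynProg)

/-- The base in which load differences between `-h` and `h` are encoded, shifted by `h`. -/
def b : ℕ := 2 * D.h + 1

/-- The code of the zero vector of load differences. -/
def origin : ℕ := ofDigits D.b D.K fun _ => D.h

/-- Job `l` may have the outcome `c` if the load differences after this job are coded by `x`. -/
def CanUse (l x c : ℕ) : Prop := CanMoveDigit D.b (D.p l) c (D.g l) x

instance (l x c : ℕ) : Decidable (D.CanUse l x c) := inferInstanceAs (Decidable (_ ∧ _))

/-- The code of the load differences before job `l` if they are coded by `x` after it and the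
job has the outcome `c`. -/
def prev (l x c : ℕ) : ℕ := moveDigit D.b (D.p l) c (D.g l) x

/-- One more than the largest budget that can be left after the first `l` jobs when the load
differences are coded by `x`; it is `0` if this is impossible. -/
def budget : ℕ → ℕ → ℕ
  | 0, x => if x = D.origin then D.W + 1 else 0
  | l + 1, x => (range D.K).sup fun c =>
      if D.CanUse l x c then budget l (D.prev l x c) - (if c = 0 then D.w l else 0) else 0

/-- The value of `budget (l + 1) x` if the outcome of job `l` has to be `c`. -/
def choiceBudget (l x c : ℕ) : ℕ :=
  if D.CanUse l x c then D.budget l (D.prev l x c) - (if c = 0 then D.w l else 0) else 0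

theorem budget_succ (l x : ℕ) : D.budget (l + 1) x = (range D.K).sup (D.choiceBudget l x) := rfl

/-- The outcome `c` of job `l` is optimal when the load differences after it are coded by `x`. -/
def IsBestChoice (l x c : ℕ) : Prop :=
  c < D.K ∧ D.CanUse l x c ∧
    D.budget (l + 1) x = D.budget l (D.prev l x c) - if c = 0 then D.w l else 0

/-- The load differences of `f` and the guide after the first `l` jobs are coded by `x`. -/
def Represents (f : ℕ → ℕ) (l x : ℕ) : Prop :=
  x < D.b ^ D.K ∧
    ∀ i < D.K, digit D.b i x + prefixTotal D.p D.g i l = D.h + prefixTotal D.p f i l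

/-- The table entry at `l` and `x` comes from the schedule `f` of the first `l` jobs. -/
def Attains (f : ℕ → ℕ) (l x : ℕ) : Prop :=
  D.Represents f l x ∧ D.budget l x + prefixTotal D.w f 0 l = D.W + 1

variable {D}

theorem digit_origin {i : ℕ} (hi : i < D.K) : digit D.b i D.origin = D.h :=
  digit_ofDigits (fun _ _ => by rw [b]; omega) hi

theorem origin_lt : D.origin < D.b ^ D.K := ofDigits_lt fun _ _ => by rw [b]; omega

theorem represents_zero {f : ℕ → ℕ} {x : ℕ} : D.Represents f 0 x ↔ x = D.origin := by
  simp only [Represents, prefixTotal_zero, add_zero]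
  refine ⟨fun h => eq_of_digit_eq h.1 origin_lt fun i hi => by rw [h.2 i hi, digit_origin hi], ?_⟩
  rintro rfl
  exact ⟨origin_lt, fun i hi => digit_origin hi⟩

theorem prev_lt {l x c : ℕ} (hx : x < D.b ^ D.K) (hg : D.g l < D.K) (hc : c < D.K)
    (huse : D.CanUse l x c) : D.prev l x c < D.b ^ D.K :=
  (huse.spec hx hc hg).1

theorem represents_prev_iff {f : ℕ → ℕ} {l x : ℕ} (hx : x < D.b ^ D.K) (hg : D.g l < D.K)
    (hf : f l < D.K) (huse : D.CanUse l x (f l)) :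
    D.Represents f l (D.prev l x (f l)) ↔ D.Represents f (l + 1) x := by
  obtain ⟨hlt, hdigit⟩ := huse.spec hx hf hg
  simp only [Represents, prev, hlt, hx, true_and, prefixTotal_succ]
  refine forall₂_congr fun i hi => ?_
  have := hdigit i hi
  simp only [eq_comm (a := i)] at this
  omega

theorem choiceBudget_of_not_canUse {l x c : ℕ} (h : ¬D.CanUse l x c) :
    D.choiceBudget l x c = 0 :=
  if_neg h

theorem choiceBudget_of_canUse {l x c : ℕ} (h : D.CanUse l x c) :
    D.choiceBudget l x c = D.budget l (D.prev l x c) - (1 - c) * D.w l := by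
  rw [choiceBudget, if_pos h]
  rcases Nat.eq_zero_or_pos c with rfl | hc
  · rw [if_pos rfl, Nat.sub_zero, one_mul]
  · rw [if_neg hc.ne', Nat.sub_eq_zero_of_le hc, zero_mul]

theorem isBestChoice_of_choiceBudget_eq {l x c : ℕ} (hc : c < D.K)
    (h : D.choiceBudget l x c = D.budget (l + 1) x) (hx : D.budget (l + 1) x ≠ 0) :
    D.IsBestChoice l x c := by
  rw [choiceBudget] at h
  by_cases huse : D.CanUse l x c
  · exact ⟨hc, huse, by rw [← h, if_pos huse]⟩
  · rw [if_neg huse] at h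
    exact absurd h.symm hx

theorem le_budget_succ {l x c : ℕ} (hc : c < D.K) (huse : D.CanUse l x c) :
    D.budget l (D.prev l x c) - (if c = 0 then D.w l else 0) ≤ D.budget (l + 1) x :=
  calc D.budget l (D.prev l x c) - (if c = 0 then D.w l else 0)
    _ = D.choiceBudget l x c := (if_pos huse).symm
    _ ≤ (range D.K).sup (D.choiceBudget l x) := le_sup (mem_range.2 hc)
    _ = D.budget (l + 1) x := (D.budget_succ l x).symm

theorem budget_le (l x : ℕ) : D.budget l x ≤ D.W + 1 := by
  induction l generalizing x with
  | zero =>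
    rw [budget]
    split_ifs <;> omega
  | succ l ih =>
    refine Finset.sup_le fun c _ => ?_
    have := ih (D.prev l x c)
    split_ifs <;> omega

/-- The total size of the jobs before `j` on which `f` and the guide differ. -/
def deviation (D : DynProg) (f : ℕ → ℕ) (j : ℕ) : ℕ :=
  ∑ k ∈ range j, if f k ≠ D.g k then D.p k else 0

theorem deviation_succ (f : ℕ → ℕ) (j : ℕ) :
    D.deviation f (j + 1) = D.deviation f j + if f j ≠ D.g j then D.p j else 0 :=
  sum_range_succ _ _

theorem prefixTotal_le_add_deviation (f : ℕ → ℕ) (i j : ℕ) :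
    prefixTotal D.p f i j ≤ prefixTotal D.p D.g i j + D.deviation f j := by
  rw [prefixTotal, prefixTotal, deviation, ← sum_add_distrib]
  exact sum_le_sum fun k _ => by grind

theorem prefixTotal_guide_le_add_deviation (f : ℕ → ℕ) (i j : ℕ) :
    prefixTotal D.p D.g i j ≤ prefixTotal D.p f i j + D.deviation f j := by
  rw [prefixTotal, prefixTotal, deviation, ← sum_add_distrib]
  exact sum_le_sum fun k _ => by grind

theorem exists_represents {f : ℕ → ℕ} {l : ℕ} (h : D.deviation f l ≤ D.h) :
    ∃ x, D.Represents f l x := by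
  have hlt : ∀ i < D.K, D.h + prefixTotal D.p f i l - prefixTotal D.p D.g i l < D.b := by
    intro i _
    have := prefixTotal_le_add_deviation (D := D) f i l
    rw [b]
    omega
  refine ⟨_, ofDigits_lt hlt, fun i hi => ?_⟩
  have := prefixTotal_guide_le_add_deviation (D := D) f i l
  rw [digit_ofDigits hlt hi]
  omega

theorem canUse_of_deviation {f : ℕ → ℕ} {l x : ℕ} (hx : D.Represents f (l + 1) x)
    (hg : D.g l < D.K) (hf : f l < D.K) (hdev : D.deviation f (l + 1) + D.p l ≤ D.h) :
    D.CanUse l x (f l) := by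
  have hdigit_f := hx.2 _ hf
  have hdigit_g := hx.2 _ hg
  have hle := prefixTotal_guide_le_add_deviation (D := D) f (f l) (l + 1)
  have hge := prefixTotal_le_add_deviation (D := D) f (D.g l) (l + 1)
  constructor
  · omega
  · rw [b] at *
    omega

theorem le_budget_add_prefixTotal {f : ℕ → ℕ} {M n : ℕ} (hg : ∀ l < n, D.g l < D.K)
    (hf : ∀ l < n, f l < D.K) (hp : ∀ l < n, D.p l ≤ M) (hdev : D.deviation f n + M ≤ D.h)
    {x : ℕ} (hx : D.Represents f n x) :
    D.W + 1 ≤ D.budget n x + prefixTotal D.w f 0 n := by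
  induction n generalizing x with
  | zero =>
    rw [represents_zero] at hx
    simp only [budget, hx, if_true, le_add_iff_nonneg_right, zero_le]
  | succ n ih =>
    have hgn := hg n n.lt_succ_self
    have hfn := hf n n.lt_succ_self
    have hpn := hp n n.lt_succ_self
    have hdev' : D.deviation f n + M ≤ D.h := by
      rw [deviation_succ] at hdev
      omega
    have huse : D.CanUse n x (f n) := canUse_of_deviation hx hgn hfn (by omega)
    have ih := ih (fun l hl => hg l (by omega)) (fun l hl => hf l (by omega))
      (fun l hl => hp l (by omega)) hdev' ((represents_prev_iff hx.1 hgn hfn huse).2 hx)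
    have hstep := le_budget_succ hfn huse
    rw [prefixTotal_succ]
    omega

theorem attains_zero {f : ℕ → ℕ} {x : ℕ} (hx : D.budget 0 x ≠ 0) : D.Attains f 0 x := by
  have hx' : x = D.origin := by
    by_contra hne
    exact hx (if_neg hne)
  exact ⟨represents_zero.2 hx', by simp only [budget, hx', if_true, prefixTotal_zero, add_zero]⟩

theorem IsBestChoice.budget_prev_ne_zero {l x c : ℕ} (h : D.IsBestChoice l x c)
    (hx : D.budget (l + 1) x ≠ 0) : D.budget l (D.prev l x c) ≠ 0 := by
  have := h.2.2
  omega

theorem Attains.succ {f : ℕ → ℕ} {l x : ℕ} (hx : x < D.b ^ D.K) (hg : D.g l < D.K)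
    (hbest : D.IsBestChoice l x (f l)) (hbudget : D.budget (l + 1) x ≠ 0)
    (h : D.Attains f l (D.prev l x (f l))) : D.Attains f (l + 1) x := by
  obtain ⟨hc, huse, hvalue⟩ := hbest
  refine ⟨(represents_prev_iff hx hg hc huse).1 h.1, ?_⟩
  have := h.2
  rw [prefixTotal_succ]
  omega

end DynProg

/-- The number that represents a machine or the rejection in the output and in the dynamic
program. -/
def code {m : ℕ} (o : Option (Fin m)) : ℕ := o.elim 0 (fun i => (i : ℕ) + 1)

theorem code_lt {m : ℕ} (o : Option (Fin m)) : code o < m + 1 := by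
  cases o with
  | none => exact m.succ_pos
  | some i => exact Nat.succ_lt_succ i.2

theorem code_injective {m : ℕ} : Function.Injective (code (m := m)) := by
  intro o o' h
  cases o <;> cases o' <;> simp_all [code, Fin.ext_iff]

theorem exists_code_eq {m k : ℕ} (hk : k < m + 1) : ∃ o : Option (Fin m), code o = k := by
  cases k with
  | zero => exact ⟨none, rfl⟩
  | succ k => exact ⟨some ⟨k, Nat.succ_lt_succ_iff.1 hk⟩, rfl⟩

/-- The sequence `f` lists the codes of the outcomes of the jobs in the schedule `σ`. -/
def Codes {n m : ℕ} (f : ℕ → ℕ) (σ : Fin n → Option (Fin m)) : Prop :=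
  ∀ j : Fin n, f j = code (σ j)

section Codes

variable {n m : ℕ} {f g : ℕ → ℕ} {σ τ : Fin n → Option (Fin m)}

theorem exists_codes (σ : Fin n → Option (Fin m)) : ∃ f, Codes f σ :=
  ⟨toArr (code ∘ σ), fun j => by simp [toArr]⟩

theorem exists_schedule (hf : ∀ j < n, f j < m + 1) : ∃ σ : Fin n → Option (Fin m), Codes f σ := by
  choose σ hσ using fun j : Fin n => exists_code_eq (hf j j.2)
  exact ⟨σ, fun j => (hσ j).symm⟩

theorem Codes.lt (h : Codes f σ) : ∀ j < n, f j < m + 1 := fun j hj =>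
  (h ⟨j, hj⟩).trans_lt (code_lt _)

theorem Codes.eq_iff (hf : Codes f σ) (hg : Codes g τ) (j : Fin n) : f j = g j ↔ σ j = τ j := by
  rw [hf, hg, code_injective.eq_iff]

theorem Codes.eq_zero_iff (h : Codes f σ) (j : Fin n) : f j = 0 ↔ σ j = none := by
  rw [h, ← code_injective.eq_iff]
  rfl

theorem Codes.total_eq (h : Codes f σ) (q : ℕ → ℕ) (o : Option (Fin m)) :
    total (fun j : Fin n => q j) σ o = prefixTotal q f (code o) n := by
  rw [total, prefixTotal, sum_filter, sum_range]
  exact sum_congr rfl fun j _ => by simp only [h j, code_injective.eq_iff]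

theorem Codes.deviation_eq {D : DynProg} (hf : Codes f σ) (hg : Codes D.g τ) :
    D.deviation f n = ∑ j with σ j ≠ τ j, D.p j := by
  rw [DynProg.deviation, sum_filter, sum_range]
  exact sum_congr rfl fun j _ => by simp only [ne_eq, hf.eq_iff hg]

end Codes

section ScaledMakespan

variable {ι : Type*} [Fintype ι] {m : ℕ}

/-- The makespan if machine `i` takes time `c i` for each unit of processing requirement. -/
def scaledMakespan (c : Fin m → ℕ) (p : ι → ℕ) (σ : ι → Option (Fin m)) : ℕ :=
  univ.sup fun i => c i * total p σ (some i)

variable {c : Fin m → ℕ} {p : ι → ℕ} {σ τ : ι → Option (Fin m)}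

theorem scaledMakespan_mono (h : ∀ i, total p σ (some i) ≤ total p τ (some i)) :
    scaledMakespan c p σ ≤ scaledMakespan c p τ :=
  sup_mono_fun fun i _ => Nat.mul_le_mul_left _ (h i)

theorem IsGuide.total_le_add_of_scaledMakespan_le {w : ι → ℕ} {W M : ℕ} {G : ι → Option (Fin m)}
    (hG : IsGuide p w W M c G) (hc : ∀ i, 0 < c i)
    (h : scaledMakespan c p τ ≤ scaledMakespan c p G) (i : Fin m) :
    total p τ (some i) ≤ total p G (some i) + M := by
  obtain ⟨k, -, hk⟩ := exists_mem_eq_sup univ ⟨i, mem_univ i⟩ fun i => c i * total p G (some i)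
  refine Nat.le_of_mul_le_mul_left ?_ (hc i)
  calc c i * total p τ (some i) ≤ scaledMakespan c p τ :=
        le_sup (f := fun i => c i * total p τ (some i)) (mem_univ i)
    _ ≤ scaledMakespan c p G := h
    _ = c k * total p G (some k) := hk
    _ ≤ c i * (total p G (some i) + M) := hG.balanced i k

end ScaledMakespan

namespace Instance

variable {m : ℕ} (I : Instance m)

/-- The inverse speed of a machine, multiplied by the product of the numerators of all speeds to
obtain an integer. -/
def slowness (i : Fin m) : ℕ := (∏ k, (I.q k).num) / (I.q i).num * (I.q i).den

theorem prod_num_pos : 0 < ∏ k, (I.q k).num := prod_pos fun k _ => NNRat.num_pos.2 (I.q_pos k)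

theorem slowness_pos (i : Fin m) : 0 < I.slowness i :=
  Nat.mul_pos (Nat.div_pos (Nat.le_of_dvd (I.prod_num_pos) (dvd_prod_of_mem _ (mem_univ i)))
    (NNRat.num_pos.2 (I.q_pos i))) (I.q i).den_pos

theorem cast_slowness (i : Fin m) :
    (I.slowness i : ℚ≥0) = (∏ k, (I.q k).num : ℕ) / I.q i := by
  have hnum : ((I.q i).num : ℚ≥0) ≠ 0 := by exact_mod_cast (NNRat.num_pos.2 (I.q_pos i)).ne'
  have hden : ((I.q i).den : ℚ≥0) ≠ 0 := by exact_mod_cast (I.q i).den_ne_zero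
  rw [slowness, Nat.cast_mul, Nat.cast_div (dvd_prod_of_mem _ (mem_univ i)) hnum]
  conv_rhs => rw [← NNRat.num_div_den (I.q i)]
  field_simp

theorem cast_slowness_mul_total (σ : I.Schedule) (i : Fin m) :
    ((I.slowness i * total I.p σ (some i) : ℕ) : ℚ≥0) =
      (∏ k, (I.q k).num : ℕ) * I.machineLoad σ i := by
  rw [Nat.cast_mul, cast_slowness, machineLoad, ← sum_div, total, Nat.cast_sum]
  ring

theorem cast_scaledMakespan (σ : I.Schedule) :
    (scaledMakespan I.slowness I.p σ : ℚ≥0) = (∏ k, (I.q k).num : ℕ) * I.makespan σ := by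
  have hmono : Monotone fun r : ℚ≥0 => ((∏ k, (I.q k).num : ℕ) : ℚ≥0) * r := fun _ _ h =>
    mul_le_mul_right h _
  rw [scaledMakespan, makespan,
    apply_sup_eq_sup_comp_of_linearOrder (fun k : ℕ => (k : ℚ≥0)) Nat.mono_cast Nat.cast_zero,
    apply_sup_eq_sup_comp_of_linearOrder _ hmono (mul_zero _)]
  exact sup_congr rfl fun i _ => cast_slowness_mul_total I σ i

theorem makespan_le_iff {σ τ : I.Schedule} : I.makespan σ ≤ I.makespan τ ↔
    scaledMakespan I.slowness I.p σ ≤ scaledMakespan I.slowness I.p τ := by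
  have hpos : (0 : ℚ≥0) < (∏ k, (I.q k).num : ℕ) := by exact_mod_cast I.prod_num_pos
  rw [← mul_le_mul_iff_right₀ hpos, ← cast_scaledMakespan, ← cast_scaledMakespan, Nat.cast_le]

end Instance

/-- A bound on the processing requirement of the jobs on which the guide and some optimal schedule
differ, plus the largest value of a job. -/
def radius (m M : ℕ) : ℕ := 181 * m ^ 5 * M ^ (m + 4)

theorem add_le_radius {m : ℕ} (hm : 0 < m) (M : ℕ) :
    180 * m ^ 5 * M ^ (m + 4) + M ≤ radius m M := by
  have hM : M ≤ m ^ 5 * M ^ (m + 4) :=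
    (Nat.le_self_pow (by omega) M).trans (Nat.le_mul_of_pos_left _ (by positivity))
  rw [radius]
  linarith

namespace DynProg

variable {D : DynProg} {n m : ℕ}

/-- The scaled makespan of the schedules whose load differences to the guide are coded by `x`. -/
def cost (D : DynProg) (n m : ℕ) (c : ℕ → ℕ) (x : ℕ) : ℕ :=
  (range m).sup fun i =>
    c (i + 1) * (prefixTotal D.p D.g (i + 1) n + digit D.b (i + 1) x - D.h)

theorem Represents.cost_eq {f : ℕ → ℕ} {x : ℕ} (hx : D.Represents f n x) (hK : D.K = m + 1)
    {σ : Fin n → Option (Fin m)} (hf : Codes f σ) (c : ℕ → ℕ) :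
    D.cost n m c x =
      scaledMakespan (fun i : Fin m => c (i + 1)) (fun j : Fin n => D.p j) σ := by
  have hload : ∀ i : Fin m, prefixTotal D.p D.g (i + 1) n + digit D.b (i + 1) x - D.h =
      total (fun j : Fin n => D.p j) σ (some i) := fun i => by
    have := hx.2 (i + 1) (by omega)
    rw [hf.total_eq, code, Option.elim_some]
    omega
  simp only [cost, scaledMakespan, ← hload, ← Nat.Iio_eq_range, ← Fin.map_valEmbedding_univ,
    sup_map]
  rfl

section Optimality

variable {M : ℕ} {c : ℕ → ℕ} {G : Fin n → Option (Fin m)}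

theorem exists_cost_eq (hK : D.K = m + 1) (hp : ∀ l < n, D.p l ≤ M) (hgG : Codes D.g G)
    {σ : Fin n → Option (Fin m)} (hσ : total (fun j : Fin n => D.w j) σ none ≤ D.W)
    (hnear : ∑ j with σ j ≠ G j, D.p j + M ≤ D.h) :
    ∃ x < D.b ^ D.K, D.budget n x ≠ 0 ∧
      D.cost n m c x = scaledMakespan (fun i => c (i + 1)) (fun j : Fin n => D.p j) σ := by
  obtain ⟨f, hf⟩ := exists_codes σ
  rw [← hf.deviation_eq hgG] at hnear
  obtain ⟨x, hx⟩ := exists_represents (D := D) (f := f) (l := n) (by omega)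
  have hbudget := le_budget_add_prefixTotal (hK ▸ hgG.lt) (hK ▸ hf.lt) hp hnear hx
  have hweight : prefixTotal D.w f 0 n ≤ D.W := hf.total_eq D.w none ▸ hσ
  exact ⟨x, hx.1, by omega, hx.cost_eq hK hf c⟩

theorem exists_cost_le (hm : 0 < m) (hM : 0 < M) (hc : ∀ i : Fin m, 0 < c (i + 1))
    (hK : D.K = m + 1) (hp : ∀ l < n, D.p l ≤ M) (hw : ∀ l < n, D.w l ≤ M)
    (hh : D.h = radius m M) (hgG : Codes D.g G)
    (hG : IsGuide (fun j : Fin n => D.p j) (fun j : Fin n => D.w j) D.W M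
      (fun i : Fin m => c (i + 1)) G)
    {τ : Fin n → Option (Fin m)} (hτ : total (fun j : Fin n => D.w j) τ none ≤ D.W) :
    ∃ x < D.b ^ D.K, D.budget n x ≠ 0 ∧
      D.cost n m c x ≤ scaledMakespan (fun i => c (i + 1)) (fun j : Fin n => D.p j) τ := by
  have hradius := (add_le_radius hm M).trans_eq hh.symm
  rcases le_total (scaledMakespan (fun i => c (i + 1)) (fun j : Fin n => D.p j) G)
      (scaledMakespan (fun i => c (i + 1)) (fun j : Fin n => D.p j) τ) with hle | hle
  · obtain ⟨x, hx, hbudget, hcost⟩ := exists_cost_eq (c := c) hK hp hgG hG.feasible (by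
      simp only [ne_eq, not_true_eq_false, filter_false, sum_empty]
      omega)
    exact ⟨x, hx, hbudget, hcost.trans_le hle⟩
  · have : Nonempty (Fin m) := ⟨⟨0, hm⟩⟩
    obtain ⟨σ, hσ, hloads, hdist⟩ := exists_near_guide hG hM (fun j => hp j j.2)
      (fun j => hw j j.2) hτ (hG.total_le_add_of_scaledMakespan_le hc hle)
    rw [Fintype.card_fin] at hdist
    obtain ⟨x, hx, hbudget, hcost⟩ := exists_cost_eq (c := c) hK hp hgG hσ (by omega)
    exact ⟨x, hx, hbudget, hcost.trans_le (scaledMakespan_mono hloads)⟩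

end Optimality

end DynProg

/-! ### The largest value and the slownesses -/

-- The variables and arrays of the algorithm are numbered here. The variables `jobs` and
-- `weightBound` and the arrays `sizes`, `weights`, `speedNums`, `speedDens` are those that
-- `Instance.init` fills, and `output` is the array that `Outputs` reads.
namespace Reg

abbrev jobs : ℕ := 0
abbrev weightBound : ℕ := 1
abbrev maxValue : ℕ := 2
abbrev job : ℕ := 3
abbrev machines : ℕ := 4
abbrev machine : ℕ := 5
abbrev product : ℕ := 6
abbrev pairs : ℕ := 7
abbrev pair : ℕ := 8
abbrev den : ℕ := 9
abbrev num : ℕ := 10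
abbrev strictWeight : ℕ := 11
abbrev equalWeight : ℕ := 12
abbrev bestDen : ℕ := 13
abbrev bestNum : ℕ := 14
abbrev rejectedWeight : ℕ := 15
abbrev chosen : ℕ := 16
abbrev exponent : ℕ := 17
abbrev power : ℕ := 18
abbrev window : ℕ := 19
abbrev base : ℕ := 20
abbrev codes : ℕ := 21
abbrev states : ℕ := 22
abbrev origin : ℕ := 23
abbrev place : ℕ := 24
abbrev cells : ℕ := 25
abbrev cell : ℕ := 26
abbrev state : ℕ := 27
abbrev candidate : ℕ := 28
abbrev candidateBudget : ℕ := 29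
abbrev bestBudget : ℕ := 30
abbrev bestCandidate : ℕ := 31
abbrev cost : ℕ := 32
abbrev bestCost : ℕ := 33
abbrev bestState : ℕ := 34
abbrev step : ℕ := 35

end Reg

namespace Arr

abbrev sizes : ℕ := 0
abbrev weights : ℕ := 1
abbrev speedNums : ℕ := 2
abbrev speedDens : ℕ := 3
abbrev output : ℕ := 4
abbrev slowness : ℕ := 5
abbrev guide : ℕ := 6
abbrev loads : ℕ := 7
abbrev powers : ℕ := 8
abbrev budgets : ℕ := 9
abbrev choices : ℕ := 10

end Arr

namespace Instance

variable {m : ℕ} (I : Instance m)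

/-- The processing requirements as an array, which is `0` beyond the last job. -/
abbrev size : ℕ → ℕ := toArr I.p

/-- The weights as an array, which is `0` beyond the last job. -/
abbrev weight : ℕ → ℕ := toArr I.w

/-- The largest sum of the processing requirement and the weight of a job. -/
def maxValue : ℕ := (range I.n).sup fun j => I.size j + I.weight j

variable {I}

theorem size_add_weight_le {j : ℕ} (hj : j < I.n) : I.size j + I.weight j ≤ I.maxValue :=
  le_sup (f := fun j => I.size j + I.weight j) (mem_range.2 hj)

variable (I)

/-- The largest difference of loads that the dynamic program takes into account. -/
def window : ℕ := radius m I.maxValue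

/-- The base in which the dynamic program encodes load differences as digits. -/
def base : ℕ := 2 * I.window + 1

/-- The number of states of the dynamic program. -/
def states : ℕ := I.base ^ (m + 1)

end Instance

/-- All numbers that occur when the algorithm is run on `I` are words below `B`. -/
structure WordSize {m : ℕ} (I : Instance m) (B : ℕ) : Prop where
  jobs : I.n < B
  weightBound : I.W + 1 < B
  machines : m + 1 < B
  values : (I.maxValue + 1) * (I.maxValue + 1) < B
  total : I.n * I.maxValue + 1 < B
  numerators : ∏ i, (I.q i).num < B
  scaledLoad : ∀ i, I.slowness i * (I.n * I.maxValue + I.base) + 1 < B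
  table : (I.n + 1) * I.states < B
  shift : (I.maxValue + 1) * I.states < B

namespace WordSize

variable {m B : ℕ} {I : Instance m}

theorem maxValue (h : WordSize I B) : I.maxValue + 1 < B :=
  (Nat.le_mul_of_pos_left _ (Nat.succ_pos _)).trans_lt h.values

theorem slowness (h : WordSize I B) (i : Fin m) : I.slowness i < B :=
  ((Nat.le_mul_of_pos_right _ (by rw [Instance.base]; omega)).trans (Nat.le_succ _)).trans_lt
    (h.scaledLoad i)

end WordSize

/-- The state holds the instance `I`, including the number of machines. -/
structure HasInstance {m : ℕ} (I : Instance m) (s : State) : Prop where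
  jobs : s.var Reg.jobs = I.n
  weightBound : s.var Reg.weightBound = I.W
  machines : s.var Reg.machines = m
  sizes : s.arr Arr.sizes = I.size
  weights : s.arr Arr.weights = I.weight

theorem HasInstance.frame {m : ℕ} {I : Instance m} {P : Program} {s s' : State}
    (h : HasInstance I s) (hF : Frame P s s')
    (hvar : ∀ x ∈ [Reg.jobs, Reg.weightBound, Reg.machines], x ∉ P.writtenVars := by decide)
    (harr : ∀ a ∈ [Arr.sizes, Arr.weights], a ∉ P.writtenArrs := by decide) :
    HasInstance I s' where
  jobs := (hF.var (hvar _ (by decide))).trans h.jobs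
  weightBound := (hF.var (hvar _ (by decide))).trans h.weightBound
  machines := (hF.var (hvar _ (by decide))).trans h.machines
  sizes := (hF.arr (harr _ (by decide))).trans h.sizes
  weights := (hF.arr (harr _ (by decide))).trans h.weights

/-- The processing requirement of the current job. -/
abbrev jobSize : Expr := .get Arr.sizes (.var Reg.job)

/-- The weight of the current job. -/
abbrev jobWeight : Expr := .get Arr.weights (.var Reg.job)

/-- Computes the largest sum of a processing requirement and a weight. -/
def maxValueProgram : Program :=
  Reg.maxValue ≔ .const 0 ;;
  forLoop Reg.job Reg.jobs
    (.ite (jobSize +ₑ jobWeight -ₑ .var Reg.maxValue) (Reg.maxValue ≔ jobSize +ₑ jobWeight) .skip)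

section MaxValue

variable {m B : ℕ} {I : Instance m} {s : State}

theorem wp_maxValueProgram (hB : WordSize I B) (hI : HasInstance I s) :
    WP B maxValueProgram s fun t s' => t ≤ I.n * 26 + 11 ∧ s'.var Reg.maxValue = I.maxValue := by
  rw [maxValueProgram, wp_seq, wp_assign]
  have hM := hB.maxValue
  have hn := hB.jobs
  refine ⟨by simp only [Expr.Fits]; omega, ?_⟩
  refine .mono (wp_forLoop (T := 16) I.n (fun i s' => s'.var Reg.maxValue =
    (range i).sup fun j => I.size j + I.weight j) hB.jobs (by decide) (by decide) hI.jobs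
    (fun _ _ _ h => h) rfl ?_) fun t s' h => ⟨by simp only [Expr.cost]; omega, h.2⟩
  intro i hi s' hF hx hmax
  have hI := hI.frame (.trans (.setVar (by decide) s _) hF)
  have hi' := I.size_add_weight_le hi
  have hle : s'.var Reg.maxValue ≤ I.maxValue :=
    hmax.trans_le (sup_mono (range_subset_range.2 hi.le))
  rw [range_add_one, sup_insert]
  simp only [wp_ite, wp_assign, wp_skip, Expr.val, Expr.Fits, Expr.cost, hx, hI.sizes, hI.weights,
    State.var_setVar_self]
  grind

end MaxValue

section Slowness

variable {m B : ℕ} {I : Instance m} {s : State}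

theorem toArr_coe {k : ℕ} (f : Fin k → ℕ) (i : Fin k) : toArr f i = f i := dif_pos i.2

/-- Computes the product of the numerators of the speeds. -/
def numeratorProgram : Program :=
  Reg.product ≔ .const 1 ;;
  forLoop Reg.machine Reg.machines
    (Reg.product ≔ .var Reg.product *ₑ .get Arr.speedNums (.var Reg.machine))

/-- Computes the slowness of machine `i` and stores it at the index `i + 1`, the code of `i`. -/
def inverseSpeedProgram : Program :=
  forLoop Reg.machine Reg.machines
    (.store Arr.slowness (.var Reg.machine +ₑ .const 1)
      (.var Reg.product /ₑ .get Arr.speedNums (.var Reg.machine) *ₑ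
        .get Arr.speedDens (.var Reg.machine)))

theorem wp_numeratorProgram (hB : WordSize I B) (hI : HasInstance I s)
    (hnum : s.arr Arr.speedNums = toArr fun i => (I.q i).num) :
    WP B numeratorProgram s fun t s' => t ≤ m * 15 + 11 ∧
      s'.var Reg.product = ∏ i, (I.q i).num := by
  have hm := hB.machines
  let a := toArr fun i => (I.q i).num
  have ha_eq : ∀ i : Fin m, a i = (I.q i).num := toArr_coe _
  have ha : ∀ i < m, 0 < a i := fun i hi =>
    (NNRat.num_pos.2 (I.q_pos ⟨i, hi⟩)).trans_eq (ha_eq ⟨i, hi⟩).symm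
  have hprod : ∏ i ∈ range m, a i = ∏ i, (I.q i).num := by
    rw [prod_range]
    exact prod_congr rfl fun i _ => ha_eq i
  have hle : ∀ i ≤ m, ∏ k ∈ range i, a k < B := fun i hi =>
    (prod_le_prod_of_subset_of_one_le' (range_subset_range.2 hi) fun k hk _ =>
      ha k (mem_range.1 hk)).trans_lt (hprod.trans_lt hB.numerators)
  rw [numeratorProgram, wp_seq, wp_assign]
  refine ⟨by simp only [Expr.Fits]; exact (hle 0 (Nat.zero_le m)), ?_⟩
  refine .mono (wp_forLoop (T := 5) m
    (fun i s' => s'.var Reg.product = ∏ k ∈ range i, a k) (by omega)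
    (by decide) (by decide) hI.machines (fun _ _ _ h => h) rfl ?_)
    fun t s' h => ⟨by simp only [Expr.cost]; omega, h.2.trans hprod⟩
  intro i hi s' hF hx hprod_i
  have hnum' : s'.arr Arr.speedNums = a := (hF.arr (by decide)).trans hnum
  have hlt := hle (i + 1) hi
  have hpos := prod_pos fun k (hk : k ∈ range i) => ha k ((mem_range.1 hk).trans hi)
  rw [prod_range_succ] at hlt ⊢
  simp only [wp_assign, Expr.val, Expr.Fits, Expr.cost, hx, hnum', hprod_i, State.var_setVar_self]
  exact ⟨⟨hle i hi.le, ⟨by omega, (Nat.le_mul_of_pos_left _ hpos).trans_lt hlt⟩, hlt⟩,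
    by omega, trivial⟩

theorem wp_inverseSpeedProgram (hB : WordSize I B) (hI : HasInstance I s)
    (hprod : s.var Reg.product = ∏ i, (I.q i).num)
    (hnum : s.arr Arr.speedNums = toArr fun i => (I.q i).num)
    (hden : s.arr Arr.speedDens = toArr fun i => (I.q i).den) :
    WP B inverseSpeedProgram s fun t s' => t ≤ m * 21 + 8 ∧
      ∀ i : Fin m, s'.arr Arr.slowness (i + 1) = I.slowness i := by
  have hm := hB.machines
  refine .mono (wp_forLoop (T := 11) m
    (fun i s' => ∀ k : Fin m, k < i → s'.arr Arr.slowness (k + 1) = I.slowness k) (by omega)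
    (by decide) (by decide) hI.machines (fun _ _ _ h => h) (by simp) ?_)
    fun t s' h => ⟨h.1, fun i => h.2 i i.2⟩
  intro i hi s' hF hx hstored
  let k : Fin m := ⟨i, hi⟩
  have hprod' := (hF.var (by decide)).trans hprod
  have hnum' : s'.arr Arr.speedNums i = (I.q k).num := by
    rw [hF.arr (by decide), hnum]
    exact toArr_coe _ k
  have hden' : s'.arr Arr.speedDens i = (I.q k).den := by
    rw [hF.arr (by decide), hden]
    exact toArr_coe _ k
  have hnum_pos : 0 < (I.q k).num := NNRat.num_pos.2 (I.q_pos k)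
  have hnum_le : (I.q k).num ≤ ∏ i, (I.q i).num :=
    Nat.le_of_dvd I.prod_num_pos (dvd_prod_of_mem _ (mem_univ k))
  have hden_le : (I.q k).den ≤ I.slowness k :=
    Nat.le_mul_of_pos_left _ (Nat.div_pos hnum_le hnum_pos)
  have hk := hB.slowness k
  simp only [wp_store, Expr.val, Expr.Fits, Expr.cost, hx, hprod', hnum', hden',
    State.arr_setArr_self]
  have hprod_lt := hB.numerators
  have := Nat.div_le_self (∏ i, (I.q i).num) (I.q k).num
  refine ⟨by omega, ⟨⟨hB.numerators, by omega, by omega⟩, ⟨by omega, by omega⟩, hk⟩, by omega, ?_⟩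
  intro j hj
  rcases Nat.lt_succ_iff_lt_or_eq.1 hj with hlt | heq
  · rw [Function.update_of_ne (by omega), hstored j hlt]
  · obtain rfl : j = k := Fin.ext heq
    exact Function.update_self ..

end Slowness

/-! ### The threshold ratio -/

section Threshold

theorem exists_mem_sum_le_lt {ι α : Type*} [LinearOrder α] (J : Finset ι) (ρ : ι → α) (w : ι → ℕ)
    {W : ℕ} (h : W < ∑ j ∈ J, w j) :
    ∃ k ∈ J, ∑ j ∈ J with ρ j < ρ k, w j ≤ W ∧ W < ∑ j ∈ J with ρ j ≤ ρ k, w j := by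
  have exists_exceeding : ∀ A ⊆ J, W < ∑ j ∈ A, w j →
      ∃ k ∈ A, W < ∑ j ∈ J with ρ j ≤ ρ k, w j := by
    intro A hA hW
    obtain ⟨k, hk, hmax⟩ := exists_max_image A ρ (nonempty_of_sum_ne_zero (Nat.ne_zero_of_lt hW))
    exact ⟨k, hk, hW.trans_le
      (sum_le_sum_of_subset fun j hj => mem_filter.2 ⟨hA hj, hmax j hj⟩)⟩
  obtain ⟨k₀, hk₀, hW₀⟩ := exists_exceeding J Subset.rfl h
  obtain ⟨k, hk, hmin⟩ := exists_min_image {k ∈ J | W < ∑ j ∈ J with ρ j ≤ ρ k, w j} ρ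
    ⟨k₀, mem_filter.2 ⟨hk₀, hW₀⟩⟩
  obtain ⟨hkJ, hkW⟩ := mem_filter.1 hk
  refine ⟨k, hkJ, not_lt.1 fun hlt => ?_, hkW⟩
  obtain ⟨k', hk', hW'⟩ := exists_exceeding _ (filter_subset _ _) hlt
  obtain ⟨hk'J, hk'_lt⟩ := mem_filter.1 hk'
  exact (hmin k' (mem_filter.2 ⟨hk'J, hW'⟩)).not_gt hk'_lt

/-- The total weight of the first `n` jobs of positive size with `w j / p j < u / v`. -/
def strictWeight (p w : ℕ → ℕ) (v u n : ℕ) : ℕ :=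
  ∑ j ∈ range n, if 0 < p j ∧ v * w j < p j * u then w j else 0

/-- The total weight of the first `n` jobs of positive size with `w j / p j = u / v`. -/
def equalWeight (p w : ℕ → ℕ) (v u n : ℕ) : ℕ :=
  ∑ j ∈ range n, if 0 < p j ∧ v * w j = p j * u then w j else 0

/-- The jobs of ratio `w j / p j` below `u / v` can be rejected, but not those of ratio at most
`u / v`. The pair `v = 0`, `u > 0` stands for an infinite threshold, below which all jobs lie. -/
structure IsThreshold (p w : ℕ → ℕ) (n W v u : ℕ) : Prop where
  num_pos : 0 < u
  strictWeight_le : strictWeight p w v u n ≤ W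
  lt_add_equalWeight : 0 < v → W < strictWeight p w v u n + equalWeight p w v u n

variable {p w : ℕ → ℕ} {n W M v u : ℕ}

theorem strictWeight_succ : strictWeight p w v u (n + 1) =
    strictWeight p w v u n + if 0 < p n ∧ v * w n < p n * u then w n else 0 :=
  sum_range_succ _ _

theorem equalWeight_succ : equalWeight p w v u (n + 1) =
    equalWeight p w v u n + if 0 < p n ∧ v * w n = p n * u then w n else 0 :=
  sum_range_succ _ _

theorem strictWeight_add_equalWeight : strictWeight p w v u n + equalWeight p w v u n =
    ∑ j ∈ range n with 0 < p j, if v * w j ≤ p j * u then w j else 0 := by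
  rw [strictWeight, equalWeight, ← sum_add_distrib, sum_filter]
  exact sum_congr rfl fun j _ => by grind

theorem strictWeight_add_equalWeight_le (hw : ∀ j < n, w j ≤ M) :
    strictWeight p w v u n + equalWeight p w v u n ≤ n * M := by
  induction n with
  | zero => exact Nat.zero_le _
  | succ n ih =>
    have := ih fun j hj => hw j (by omega)
    have := hw n n.lt_succ_self
    rw [strictWeight_succ, equalWeight_succ, add_one_mul]
    grind

theorem exists_isThreshold (hp : ∀ j < n, p j ≤ M) (hw : ∀ j < n, w j ≤ M) (W : ℕ) :
    ∃ v ≤ M, ∃ u ≤ M, IsThreshold p w n W v (u + 1) := by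
  let J := {j ∈ range n | 0 < p j}
  rcases le_or_gt (∑ j ∈ J, w j) W with hle | hlt
  · refine ⟨0, Nat.zero_le M, 0, Nat.zero_le M, Nat.one_pos, ?_, fun h => absurd h (lt_irrefl 0)⟩
    simpa only [strictWeight, zero_mul, zero_add, mul_one, and_self, J, sum_filter] using hle
  obtain ⟨k, hk, hstrict, hweak⟩ := exists_mem_sum_le_lt J (fun j => (w j / p j : ℚ)) w hlt
  have ratio_le_iff : ∀ i ∈ J, ∀ j ∈ J, (w i / p i : ℚ) ≤ w j / p j ↔ p j * w i ≤ p i * w j := by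
    intro i hi j hj
    have hpi : (0 : ℚ) < p i := by exact_mod_cast (mem_filter.1 hi).2
    have hpj : (0 : ℚ) < p j := by exact_mod_cast (mem_filter.1 hj).2
    rw [div_le_div_iff₀ hpi hpj, mul_comm (w i : ℚ), mul_comm (w j : ℚ)]
    exact_mod_cast Iff.rfl
  have hstrict_eq : ∑ j ∈ J with (w j / p j : ℚ) < w k / p k, w j =
      strictWeight p w (p k) (w k) n := by
    rw [filter_congr fun j hj => by rw [← not_le, ratio_le_iff k hk j hj, not_le],
      filter_filter, sum_filter, strictWeight]
  have hweak_eq : ∑ j ∈ J with (w j / p j : ℚ) ≤ w k / p k, w j =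
      strictWeight p w (p k) (w k) n + equalWeight p w (p k) (w k) n := by
    rw [strictWeight_add_equalWeight, filter_congr fun j hj => ratio_le_iff j hj k hk, sum_filter]
  rw [hstrict_eq] at hstrict
  rw [hweak_eq] at hweak
  obtain ⟨hkn, hpk⟩ := mem_filter.1 hk
  rw [mem_range] at hkn
  have hwk : 0 < w k := by
    rw [Nat.pos_iff_ne_zero]
    intro hwk
    rw [strictWeight_add_equalWeight, hwk] at hweak
    refine hweak.ne_bot ((sum_eq_zero fun j _ => ite_eq_right_iff.2 fun h => ?_))
    exact (Nat.mul_eq_zero.1 (Nat.le_zero.1 h)).resolve_left hpk.ne'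
  refine ⟨p k, hp k hkn, w k - 1, by have := hw k hkn; omega, ?_⟩
  rw [Nat.sub_add_cancel hwk]
  exact ⟨hwk, hstrict, fun _ => hweak⟩

theorem exists_isThreshold_div_mod (hp : ∀ j < n, p j ≤ M) (hw : ∀ j < n, w j ≤ M) (W : ℕ) :
    ∃ x < (M + 1) * (M + 1), IsThreshold p w n W (x / (M + 1)) (x % (M + 1) + 1) := by
  obtain ⟨v, hv, u, hu, h⟩ := exists_isThreshold hp hw W
  refine ⟨v * (M + 1) + u, by nlinarith, ?_⟩
  rwa [Nat.mul_add_mod_of_lt (by omega), Nat.add_comm, Nat.add_mul_div_right _ _ (by omega),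
    Nat.div_eq_of_lt (by omega), Nat.zero_add]

/-- Computes `strictWeight` and `equalWeight` for the ratio `Reg.num / Reg.den`. -/
def weighProgram : Program :=
  Reg.strictWeight ≔ .const 0 ;;
  Reg.equalWeight ≔ .const 0 ;;
  forLoop Reg.job Reg.jobs (.ite jobSize
    (.ite (jobSize *ₑ .var Reg.num -ₑ .var Reg.den *ₑ jobWeight)
      (Reg.strictWeight ≔ .var Reg.strictWeight +ₑ jobWeight)
      (.ite (.var Reg.den *ₑ jobWeight -ₑ jobSize *ₑ .var Reg.num) .skip
        (Reg.equalWeight ≔ .var Reg.equalWeight +ₑ jobWeight)))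
    .skip)

/-- Keeps the ratio `Reg.num / Reg.den` if it is a threshold. Since subtraction is truncated, the
first summand `1 - Reg.den` of the inner test admits the infinite ratio. -/
def thresholdTest : Program :=
  weighProgram ;;
  .ite (.var Reg.strictWeight -ₑ .var Reg.weightBound) .skip
    (.ite (.const 1 -ₑ .var Reg.den +ₑ
        (.var Reg.strictWeight +ₑ .var Reg.equalWeight -ₑ .var Reg.weightBound))
      (Reg.bestDen ≔ .var Reg.den ;;
      Reg.bestNum ≔ .var Reg.num ;;
      Reg.rejectedWeight ≔ .var Reg.strictWeight)
      .skip)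

/-- The search for the threshold ratio, over the pairs of a denominator `v ≤ M` and a numerator
`u ≤ M + 1`, numbered by `v * (M + 1) + (u - 1)`. -/
def thresholdProgram : Program :=
  Reg.pairs ≔ (.var Reg.maxValue +ₑ .const 1) *ₑ (.var Reg.maxValue +ₑ .const 1) ;;
  forLoop Reg.pair Reg.pairs
    (Reg.den ≔ .var Reg.pair /ₑ (.var Reg.maxValue +ₑ .const 1) ;;
    Reg.num ≔ .var Reg.pair -ₑ .var Reg.den *ₑ (.var Reg.maxValue +ₑ .const 1) +ₑ .const 1 ;;
    thresholdTest)

end Threshold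

section ThresholdProgram

variable {m B : ℕ} {I : Instance m} {s : State} {v u : ℕ} {P : Prop}

theorem mul_lt_of_le_maxValue (hB : WordSize I B) {a b : ℕ} (ha : a ≤ I.maxValue + 1)
    (hb : b ≤ I.maxValue + 1) : a * b < B :=
  (Nat.mul_le_mul ha hb).trans_lt hB.values

theorem wp_weighProgram (hB : WordSize I B) (hI : HasInstance I s)
    (hv : s.var Reg.den = v) (hu : s.var Reg.num = u)
    (hvM : v ≤ I.maxValue) (huM : u ≤ I.maxValue + 1) :
    WP B weighProgram s fun t s' => t ≤ I.n * 50 + 20 ∧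
      s'.var Reg.strictWeight = strictWeight I.size I.weight v u I.n ∧
      s'.var Reg.equalWeight = equalWeight I.size I.weight v u I.n := by
  have hM := hB.maxValue
  have hn := hB.jobs
  rw [weighProgram, wp_seq, wp_assign, wp_seq, wp_assign]
  refine ⟨by simp only [Expr.Fits]; omega, by simp only [Expr.Fits]; omega, ?_⟩
  refine .mono (wp_forLoop (T := 40) I.n (fun i s' =>
    s'.var Reg.strictWeight = strictWeight I.size I.weight v u i ∧
      s'.var Reg.equalWeight = equalWeight I.size I.weight v u i) hn (by decide) (by decide)
    hI.jobs (fun _ _ _ h => h) ⟨rfl, rfl⟩ ?_)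
    fun t s' h => ⟨by simp only [Expr.cost]; omega, h.2⟩
  rintro i hi s' hF hx ⟨hstrict, hequal⟩
  have hF := Frame.trans (.setVar (by decide) s _) (.trans (.setVar (by decide) _ _) hF)
  have hI := hI.frame hF
  have hv := (hF.var (by decide)).trans hv
  have hu := (hF.var (by decide)).trans hu
  have hi' := I.size_add_weight_le hi
  have hsize : I.size i * u < B := mul_lt_of_le_maxValue hB (by omega) huM
  have hweight : v * I.weight i < B := mul_lt_of_le_maxValue hB (by omega) (by omega)
  have hle := strictWeight_add_equalWeight_le (p := I.size) (v := v) (u := u) (n := i + 1)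
    fun j hj => (Nat.le_add_left _ _).trans (I.size_add_weight_le (j := j) (by omega))
  have htotal := hB.total
  have hmono : (i + 1) * I.maxValue ≤ I.n * I.maxValue := Nat.mul_le_mul_right _ hi
  rw [strictWeight_succ, equalWeight_succ] at hle ⊢
  simp (disch := decide) only [wp_ite, wp_assign, wp_skip, Expr.val, Expr.Fits, Expr.cost, hx, hv,
    hu, hI.sizes, hI.weights, hstrict, hequal, State.var_setVar_self, State.var_setVar_of_ne]
  refine ⟨by omega, fun hpos => ⟨by omega, fun hlt => ?_, fun hge =>
    ⟨by omega, fun hgt => ?_, fun hle => ?_⟩⟩, fun hzero => ?_⟩ <;> grind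

/-- The state holds a threshold ratio and the total weight of the jobs below it. -/
structure HasThreshold {m : ℕ} (I : Instance m) (s : State) : Prop where
  isThreshold : IsThreshold I.size I.weight I.n I.W (s.var Reg.bestDen) (s.var Reg.bestNum)
  den_le : s.var Reg.bestDen ≤ I.maxValue
  num_le : s.var Reg.bestNum ≤ I.maxValue + 1
  rejectedWeight : s.var Reg.rejectedWeight =
    strictWeight I.size I.weight (s.var Reg.bestDen) (s.var Reg.bestNum) I.n

theorem HasThreshold.frame {Q : Program} {s' : State} (h : HasThreshold I s) (hF : Frame Q s s')
    (hvar : ∀ x ∈ [Reg.bestDen, Reg.bestNum, Reg.rejectedWeight], x ∉ Q.writtenVars := by decide) :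
    HasThreshold I s' := by
  have hden := hF.var (hvar Reg.bestDen (by decide))
  have hnum := hF.var (hvar Reg.bestNum (by decide))
  have hrejected := hF.var (hvar Reg.rejectedWeight (by decide))
  obtain ⟨hth, hden_le, hnum_le, hrejected_eq⟩ := h
  constructor <;> simpa only [hden, hnum, hrejected]

theorem wp_thresholdTest (hB : WordSize I B) (hI : HasInstance I s)
    (hv : s.var Reg.den = v) (hu : s.var Reg.num = u)
    (hvM : v ≤ I.maxValue) (hu0 : 0 < u) (huM : u ≤ I.maxValue + 1)
    (hs : HasThreshold I s ∨ P) :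
    WP B thresholdTest s fun t s' => t ≤ I.n * 50 + 60 ∧
      (HasThreshold I s' ∨ P ∧ ¬ IsThreshold I.size I.weight I.n I.W v u) := by
  rw [thresholdTest, wp_seq]
  refine .mono (wp_weighProgram hB hI hv hu hvM huM).frame ?_
  rintro t s' ⟨⟨ht, hstrict, hequal⟩, hF⟩
  have hI := hI.frame hF
  have hv := (hF.var (by decide)).trans hv
  have hu := (hF.var (by decide)).trans hu
  have hkeep (hno : ¬ IsThreshold I.size I.weight I.n I.W v u) :
      HasThreshold I s' ∨ P ∧ ¬ IsThreshold I.size I.weight I.n I.W v u :=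
    hs.imp (fun h => h.frame hF) fun h => ⟨h, hno⟩
  have hle := strictWeight_add_equalWeight_le (p := I.size) (w := I.weight) (n := I.n) (v := v)
    (u := u) fun j hj => (Nat.le_add_left _ _).trans (I.size_add_weight_le hj)
  have htotal := hB.total
  have hword := hB.maxValue
  have hW := hB.weightBound
  simp (disch := decide) only [wp_ite, wp_seq, wp_assign, wp_skip, Expr.val, Expr.Fits, Expr.cost,
    hv, hu, hI.weightBound, hstrict, hequal, State.var_setVar_of_ne]
  refine ⟨by omega, fun hgt => ⟨by omega, hkeep fun h => ?_⟩,
    fun hle => ⟨by omega, fun hpos => ⟨by omega, by omega, by omega, by omega, .inl ?_⟩,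
      fun hzero => ⟨by omega, hkeep fun h => ?_⟩⟩⟩
  · exact absurd h.strictWeight_le (by omega)
  · have hstrict_le : strictWeight I.size I.weight v u I.n ≤ I.W := by omega
    have hlt : 0 < v →
        I.W < strictWeight I.size I.weight v u I.n + equalWeight I.size I.weight v u I.n := by omega
    exact ⟨⟨hu0, hstrict_le, hlt⟩, hvM, huM, rfl⟩
  · exact absurd (h.lt_add_equalWeight (by omega)) (by omega)

theorem wp_thresholdProgram (hB : WordSize I B) (hI : HasInstance I s)
    (hM : s.var Reg.maxValue = I.maxValue) :
    WP B thresholdProgram s fun t s' =>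
      t ≤ (I.maxValue + 1) * (I.maxValue + 1) * (I.n * 50 + 100) + 20 ∧ HasThreshold I s' := by
  have hword := hB.maxValue
  have hvalues := hB.values
  rw [thresholdProgram, wp_seq, wp_assign]
  refine ⟨by simp only [Expr.Fits, Expr.val, hM]; omega, ?_⟩
  simp only [Expr.val, hM]
  have hF₁ : Frame thresholdProgram s
      (s.setVar Reg.pairs ((I.maxValue + 1) * (I.maxValue + 1))) := .setVar (by decide) _ _
  have hI := hI.frame hF₁
  refine .mono (wp_forLoop (T := I.n * 50 + 80) _ (fun i s' => HasThreshold I s' ∨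
    ∀ x < i, ¬ IsThreshold I.size I.weight I.n I.W (x / (I.maxValue + 1))
      (x % (I.maxValue + 1) + 1)) hvalues (by decide) (by decide) (s.var_setVar_self ..)
    (fun _ _ _ h => h.imp_left fun h => ⟨h.1, h.2, h.3, h.4⟩) (.inr (by simp)) ?_) ?_
  · intro i hi s' hF hx hinv
    have hI := hI.frame hF
    have hM := ((hF.var (by decide)).trans (s.var_setVar_of_ne _ (by decide))).trans hM
    have hden : i / (I.maxValue + 1) < I.maxValue + 1 := Nat.div_lt_of_lt_mul hi
    have hnum : i % (I.maxValue + 1) < I.maxValue + 1 := Nat.mod_lt _ (Nat.succ_pos _)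
    have hmul := Nat.div_mul_le_self i (I.maxValue + 1)
    simp (disch := decide) only [wp_seq, wp_assign, Expr.val, Expr.Fits, Expr.cost, hx, hM,
      State.var_setVar_self, State.var_setVar_of_ne, ← Nat.mod_eq_sub_div_mul]
    have hF' : Frame thresholdProgram s' ((s'.setVar Reg.den (i / (I.maxValue + 1))).setVar Reg.num
        (i % (I.maxValue + 1) + 1)) := .trans (.setVar (by decide) _ _) (.setVar (by decide) _ _)
    refine ⟨by omega, by omega, .mono (wp_thresholdTest hB (hI.frame hF')
      (v := i / (I.maxValue + 1)) rfl (State.var_setVar_self ..) (by omega) (by omega)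
      (by omega) (hinv.imp_left fun h => ⟨h.1, h.2, h.3, h.4⟩)) fun t s'' h =>
      ⟨by omega, h.2.imp_right fun ⟨hlt, hi⟩ x hx => ?_⟩⟩
    rcases Nat.lt_succ_iff_lt_or_eq.1 hx with hx | rfl
    · exact hlt x hx
    · exact hi
  · rintro t s' ⟨ht, h⟩
    refine ⟨by simp only [Expr.cost]; nlinarith, h.resolve_right fun hno => ?_⟩
    obtain ⟨x, hx, hthreshold⟩ := exists_isThreshold_div_mod (p := I.size) (w := I.weight)
      (n := I.n) (fun j hj => (Nat.le_add_right _ _).trans (I.size_add_weight_le hj))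
      (fun j hj => (Nat.le_add_left _ _).trans (I.size_add_weight_le hj)) I.W
    exact hno x hx hthreshold

end ThresholdProgram

/-! ### The guide -/

section Greedy

/-- After the first `i` jobs, the greedy algorithm with threshold `u / v` has chosen the codes `g`
and obtained the loads `L`. The jobs below the threshold are rejected, so their weight is
reserved from the start: `R` is the weight of the rejected jobs and of the jobs that are still to be
rejected for this reason. The jobs at the threshold are rejected as long as `R` allows it. -/
structure IsGreedy {m : ℕ} (p w : ℕ → ℕ) (n W M v u : ℕ) (c : Fin m → ℕ) (i : ℕ) (g L : ℕ → ℕ)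
    (R : ℕ) : Prop where
  code_lt : ∀ j < i, g j < m + 1
  of_rejected : ∀ j < i, g j = 0 → 0 < p j ∧ v * w j ≤ p j * u
  of_accepted : ∀ j < i, g j ≠ 0 → 0 < p j → p j * u ≤ v * w j
  full : ∀ j < i, g j ≠ 0 → 0 < p j → p j * u = v * w j → W < R + w j
  reserved : R + strictWeight p w v u i = strictWeight p w v u n + prefixTotal w g 0 i
  reserved_le : R ≤ W
  load : ∀ k : Fin m, L (k + 1) = prefixTotal p g (k + 1) i
  balanced : ∀ k l : Fin m, c l * L (l + 1) ≤ c k * (L (k + 1) + M)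

variable {m n W M v u i R : ℕ} {p w g L : ℕ → ℕ} {c : Fin m → ℕ}

theorem prefixTotal_update (q g : ℕ → ℕ) (i k c : ℕ) :
    prefixTotal q (Function.update g i k) c (i + 1) =
      prefixTotal q g c i + if k = c then q i else 0 := by
  rw [prefixTotal_succ, Function.update_self]
  congr 1
  refine sum_congr rfl fun j hj => ?_
  rw [Function.update_of_ne (mem_range.1 hj).ne]

theorem prefixTotal_le (h : ∀ j < i, p j ≤ M) (c : ℕ) : prefixTotal p g c i ≤ i * M := by
  refine (sum_le_card_nsmul _ _ M fun j hj => ?_).trans_eq (by rw [card_range, smul_eq_mul])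
  have := h j (mem_range.1 hj)
  split_ifs <;> omega

theorem IsGreedy.reject (h : IsGreedy p w n W M v u c i g L R) (hp : 0 < p i) {R' : ℕ}
    (hR' : v * w i < p i * u ∧ R' = R ∨ p i * u = v * w i ∧ R' = R + w i ∧ R' ≤ W) :
    IsGreedy p w n W M v u c (i + 1) (Function.update g i 0) L R' where
  code_lt j hj := by
    have := h.code_lt j
    grind
  of_rejected j hj := by
    have := h.of_rejected j
    grind
  of_accepted j hj := by
    have := h.of_accepted j
    grind
  full j hj := by
    have := h.full j
    grind
  reserved := by
    have := h.reserved
    rw [strictWeight_succ, prefixTotal_update]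
    grind
  reserved_le := by
    have := h.reserved_le
    omega
  load k := by rw [prefixTotal_update, if_neg (by omega), h.load, add_zero]
  balanced := h.balanced

theorem IsGreedy.accept (h : IsGreedy p w n W M v u c i g L R) (hM : p i ≤ M)
    (hi : 0 < p i → p i * u ≤ v * w i ∧ (p i * u = v * w i → W < R + w i)) {k : Fin m}
    (hmin : ∀ l : Fin m, c k * (L (k + 1) + p i) ≤ c l * (L (l + 1) + p i)) :
    IsGreedy p w n W M v u c (i + 1) (Function.update g i (k + 1))
      (Function.update L (k + 1) (L (k + 1) + p i)) R where
  code_lt j hj := by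
    have := h.code_lt j
    grind
  of_rejected j hj := by
    have := h.of_rejected j
    grind
  of_accepted j hj := by
    have := h.of_accepted j
    grind
  full j hj := by
    have := h.full j
    grind
  reserved := by
    have := h.reserved
    rw [strictWeight_succ, prefixTotal_update]
    grind
  reserved_le := h.reserved_le
  load l := by
    have := h.load l
    rw [prefixTotal_update]
    grind
  balanced a b := by
    have le_update : ∀ l, L l ≤ Function.update L (k + 1) (L (k + 1) + p i) l := by grind
    refine le_trans ?_ (Nat.mul_le_mul_left _ (Nat.add_le_add_right (le_update (a + 1)) M))
    rcases eq_or_ne b k with rfl | hne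
    · rw [Function.update_self]
      exact (hmin a).trans (Nat.mul_le_mul_left _ (Nat.add_le_add_left hM _))
    · rw [Function.update_of_ne (by rwa [ne_eq, Nat.add_right_cancel_iff, Fin.val_inj])]
      exact h.balanced a b

namespace IsGreedy

theorem reserved_eq (h : IsGreedy p w n W M v u c n g L R) : R = prefixTotal w g 0 n := by
  have := h.reserved
  omega

theorem ratio_le (h : IsGreedy p w n W M v u c i g L R) (hu : 0 < u) {j k : ℕ} (hj : j < i)
    (hk : k < i) (hj0 : g j = 0) (hk0 : g k ≠ 0) (hpk : 0 < p k) : p k * w j ≤ p j * w k := by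
  have hrejected := (h.of_rejected j hj hj0).2
  have haccepted := h.of_accepted k hk hk0 hpk
  have hv : 0 < v := Nat.pos_of_mul_pos_right ((Nat.mul_pos hpk hu).trans_le haccepted)
  refine Nat.le_of_mul_le_mul_left ?_ hv
  calc v * (p k * w j) = p k * (v * w j) := by ring
    _ ≤ p k * (p j * u) := Nat.mul_le_mul_left _ hrejected
    _ = p j * (p k * u) := by ring
    _ ≤ p j * (v * w k) := Nat.mul_le_mul_left _ haccepted
    _ = v * (p j * w k) := by ring

theorem le_add (h : IsGreedy p w n W M v u c n g L R) (hth : IsThreshold p w n W v u)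
    (hw : ∀ j < n, w j ≤ M) {j : ℕ} (hj : j < n) (hj0 : g j ≠ 0) (hpj : 0 < p j) : W ≤ R + M := by
  by_contra! hlt
  have hv : 0 < v :=
    Nat.pos_of_mul_pos_right ((Nat.mul_pos hpj hth.num_pos).trans_le (h.of_accepted j hj hj0 hpj))
  have rejected_of_le : ∀ k < n, 0 < p k → v * w k ≤ p k * u → g k = 0 := by
    intro k hk hpk hle
    by_contra hne
    have := h.full k hk hne hpk (h.of_accepted k hk hne hpk |>.antisymm hle)
    have := hw k hk
    omega
  have hle : strictWeight p w v u n + equalWeight p w v u n ≤ prefixTotal w g 0 n := by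
    rw [strictWeight_add_equalWeight, sum_filter]
    refine sum_le_sum fun k hk => ?_
    have := rejected_of_le k (mem_range.1 hk)
    grind
  exact absurd (hth.lt_add_equalWeight hv)
    (hle.trans (h.reserved_eq ▸ h.reserved_le)).not_gt

theorem isGuide (h : IsGreedy p w n W M v u c n g L R) (hth : IsThreshold p w n W v u)
    (hw : ∀ j < n, w j ≤ M) {G : Fin n → Option (Fin m)} (hG : Codes g G) :
    IsGuide (fun j : Fin n => p j) (fun j : Fin n => w j) W M c G := by
  have hload : ∀ k : Fin m, total (fun j : Fin n => p j) G (some k) = L (k + 1) := fun k => by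
    rw [hG.total_eq, h.load]
    rfl
  have hrejected : total (fun j : Fin n => w j) G none = R := (hG.total_eq w none).trans
    h.reserved_eq.symm
  constructor
  · intro j hj hnone
    exact (h.of_rejected j j.2 ((hG.eq_zero_iff j).2 hnone)).1.ne' hj
  · intro j hj hpj
    exact Nat.pos_of_mul_pos_left ((Nat.mul_pos hpj hth.num_pos).trans_le
      (h.of_accepted j j.2 (mt (hG.eq_zero_iff j).1 hj) hpj))
  · intro j k hj hk hpk
    exact h.ratio_le hth.num_pos j.2 k.2 ((hG.eq_zero_iff j).2 hj) (mt (hG.eq_zero_iff k).1 hk) hpk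
  · exact hrejected.trans_le h.reserved_le
  · intro j hj hpj
    rw [hrejected]
    exact h.le_add hth hw j.2 (mt (hG.eq_zero_iff j).1 hj) hpj
  · intro k l
    rw [hload, hload]
    exact h.balanced k l

end IsGreedy

end Greedy

/-- The scaled load of the machine `k` after it has received the current job. -/
abbrev completion (k : Expr) : Expr :=
  .get Arr.slowness (k +ₑ .const 1) *ₑ (.get Arr.loads (k +ₑ .const 1) +ₑ jobSize)

/-- Finds a machine that completes the current job first. -/
def chooseMachineProgram : Program :=
  Reg.chosen ≔ .const 0 ;;
  forLoop Reg.machine Reg.machines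
    (.ite (completion (.var Reg.chosen) -ₑ completion (.var Reg.machine))
      (Reg.chosen ≔ .var Reg.machine) .skip)

/-- Assigns the current job to a machine that completes it first. -/
def acceptProgram : Program :=
  chooseMachineProgram ;;
  .store Arr.loads (.var Reg.chosen +ₑ .const 1)
    (.get Arr.loads (.var Reg.chosen +ₑ .const 1) +ₑ jobSize) ;;
  .store Arr.guide (.var Reg.job) (.var Reg.chosen +ₑ .const 1)

/-- Rejects the current job in the guide. -/
def rejectProgram : Program := .store Arr.guide (.var Reg.job) (.const 0)

/-- The greedy algorithm. The variable `Reg.rejectedWeight` contains the reserved weight `R` of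
`IsGreedy`. -/
def guideProgram : Program :=
  forLoop Reg.job Reg.jobs
    (.ite jobSize
      (.ite (jobSize *ₑ .var Reg.bestNum -ₑ .var Reg.bestDen *ₑ jobWeight)
        rejectProgram
        (.ite (.var Reg.bestDen *ₑ jobWeight -ₑ jobSize *ₑ .var Reg.bestNum +ₑ
            (jobWeight -ₑ (.var Reg.weightBound -ₑ .var Reg.rejectedWeight)))
          acceptProgram
          (Reg.rejectedWeight ≔ .var Reg.rejectedWeight +ₑ jobWeight ;; rejectProgram)))
      acceptProgram)

section GuideProgram

variable {m B : ℕ} {I : Instance m} {s : State}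

theorem wp_chooseMachineProgram (hB : WordSize I B) (hI : HasInstance I s) (hm : 0 < m)
    (hslow : ∀ i : Fin m, s.arr Arr.slowness (i + 1) = I.slowness i)
    {j : ℕ} (hj : s.var Reg.job = j) (hjn : j < I.n)
    (hload : ∀ i : Fin m, s.arr Arr.loads (i + 1) + I.size j ≤ I.n * I.maxValue) :
    WP B chooseMachineProgram s fun t s' => t ≤ m * 40 + 11 ∧ ∃ k : Fin m,
      s'.var Reg.chosen = k ∧ ∀ l : Fin m,
        I.slowness k * (s.arr Arr.loads (k + 1) + I.size j) ≤
          I.slowness l * (s.arr Arr.loads (l + 1) + I.size j) := by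
  have hmB := hB.machines
  have hn := hB.jobs
  have htotal := hB.total
  have hcompletion : ∀ i : Fin m, I.slowness i * (s.arr Arr.loads (i + 1) + I.size j) < B :=
    fun i => (Nat.mul_le_mul_left _ ((hload i).trans (Nat.le_add_right _ _))).trans_lt
      ((Nat.le_succ _).trans_lt (hB.scaledLoad i))
  rw [chooseMachineProgram, wp_seq, wp_assign]
  refine ⟨by simp only [Expr.Fits]; omega, ?_⟩
  refine .mono (wp_forLoop (T := 30) m (fun i s' => ∃ k : Fin m, s'.var Reg.chosen = k ∧
    ∀ l : Fin m, l < i → I.slowness k * (s.arr Arr.loads (k + 1) + I.size j) ≤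
      I.slowness l * (s.arr Arr.loads (l + 1) + I.size j)) (by omega) (by decide) (by decide)
    hI.machines (fun _ _ _ h => h) ⟨⟨0, hm⟩, rfl, fun l hl => absurd hl l.val.not_lt_zero⟩ ?_)
    fun t s' ⟨_, k, hk, hmin⟩ => ⟨by simp only [Expr.cost]; omega, k, hk, fun l => hmin l l.2⟩
  rintro i hi s' hF hx ⟨k, hk, hmin⟩
  have hF := Frame.trans (.setVar (by decide) s _) hF
  have hI := hI.frame hF
  have hj := (hF.var (by decide)).trans hj
  have hslow_eq : s'.arr Arr.slowness = s.arr Arr.slowness := hF.arr (by decide)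
  have hloads_eq : s'.arr Arr.loads = s.arr Arr.loads := hF.arr (by decide)
  have hk_lt := hcompletion k
  have hi_lt : I.slowness ⟨i, hi⟩ * (s.arr Arr.loads (i + 1) + I.size j) < B :=
    hcompletion ⟨i, hi⟩
  have hslow_i : s.arr Arr.slowness (i + 1) = I.slowness ⟨i, hi⟩ := hslow ⟨i, hi⟩
  have hslowness_k := hB.slowness k
  have hslowness_i := hB.slowness ⟨i, hi⟩
  have hload_k := hload k
  have hload_i : s.arr Arr.loads (i + 1) + I.size j ≤ I.n * I.maxValue := hload ⟨i, hi⟩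
  simp only [wp_ite, wp_assign, wp_skip, Expr.val, Expr.Fits, Expr.cost, hx, hk, hj, hI.sizes,
    hslow_eq, hslow, hslow_i, hloads_eq, State.var_setVar_self]
  refine ⟨by omega, fun hpos => ⟨by omega, by omega, ⟨i, hi⟩, rfl, fun l hl => ?_⟩,
    fun hzero => ⟨by omega, k, rfl, fun l hl => ?_⟩⟩
  · rcases Nat.lt_succ_iff_lt_or_eq.1 hl with hl | rfl
    · exact le_trans (by grind) (hmin l hl)
    · exact le_rfl
  · rcases Nat.lt_succ_iff_lt_or_eq.1 hl with hl | rfl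
    · exact hmin l hl
    · grind

theorem wp_acceptProgram (hB : WordSize I B) (hI : HasInstance I s) (hm : 0 < m)
    (hslow : ∀ i : Fin m, s.arr Arr.slowness (i + 1) = I.slowness i)
    {j : ℕ} (hj : s.var Reg.job = j) (hjn : j < I.n)
    (hload : ∀ i : Fin m, s.arr Arr.loads (i + 1) + I.size j ≤ I.n * I.maxValue) :
    WP B acceptProgram s fun t s' => t ≤ m * 40 + 30 ∧ ∃ k : Fin m,
      s'.arr Arr.guide = Function.update (s.arr Arr.guide) j (k + 1) ∧
      s'.arr Arr.loads = Function.update (s.arr Arr.loads) (k + 1)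
        (s.arr Arr.loads (k + 1) + I.size j) ∧
      ∀ l : Fin m, I.slowness k * (s.arr Arr.loads (k + 1) + I.size j) ≤
        I.slowness l * (s.arr Arr.loads (l + 1) + I.size j) := by
  have hmB := hB.machines
  have hn := hB.jobs
  have htotal := hB.total
  rw [acceptProgram, wp_seq]
  refine .mono (wp_chooseMachineProgram hB hI hm hslow hj hjn hload).frame ?_
  rintro t s' ⟨⟨ht, k, hk, hmin⟩, hF⟩
  have hI := hI.frame hF
  have hj := (hF.var (by decide)).trans hj
  have hguide_eq : s'.arr Arr.guide = s.arr Arr.guide := hF.arr (by decide)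
  have hloads_eq : s'.arr Arr.loads = s.arr Arr.loads := hF.arr (by decide)
  have hload_k := hload k
  have := k.2
  simp (disch := decide) only [wp_seq, wp_store, Expr.val, Expr.Fits, Expr.cost, hk, hj, hI.sizes,
    hguide_eq, hloads_eq, State.var_setArr, State.arr_setArr_self, State.arr_setArr_of_ne]
  exact ⟨by omega, by omega, by omega, by omega, by omega, k, rfl, rfl, hmin⟩

/-- The machine state after `i` steps of the greedy algorithm. -/
abbrev GreedyState (I : Instance m) (v u i : ℕ) (s : State) : Prop :=
  IsGreedy I.size I.weight I.n I.W I.maxValue v u I.slowness i (s.arr Arr.guide)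
    (s.arr Arr.loads) (s.var Reg.rejectedWeight)

variable {v u i : ℕ}

theorem GreedyState.load_add_le (h : GreedyState I v u i s) (hi : i < I.n) (k : Fin m) :
    s.arr Arr.loads (k + 1) + I.size i ≤ I.n * I.maxValue := by
  have hsize : ∀ j < I.n, I.size j ≤ I.maxValue := fun j hj =>
    (Nat.le_add_right _ _).trans (I.size_add_weight_le hj)
  have hle : prefixTotal I.size (s.arr Arr.guide) (k + 1) i ≤ i * I.maxValue :=
    prefixTotal_le (fun j hj => hsize j (hj.trans hi)) _
  calc s.arr Arr.loads (k + 1) + I.size i ≤ i * I.maxValue + I.maxValue :=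
        Nat.add_le_add (h.load k ▸ hle) (hsize i hi)
    _ = (i + 1) * I.maxValue := (Nat.succ_mul _ _).symm
    _ ≤ I.n * I.maxValue := Nat.mul_le_mul_right _ hi

theorem wp_acceptProgram_greedyState (hB : WordSize I B) (hI : HasInstance I s) (hm : 0 < m)
    (hslow : ∀ i : Fin m, s.arr Arr.slowness (i + 1) = I.slowness i)
    (h : GreedyState I v u i s) (hx : s.var Reg.job = i) (hi : i < I.n)
    (haccept : 0 < I.size i → I.size i * u ≤ v * I.weight i ∧
      (I.size i * u = v * I.weight i → I.W < s.var Reg.rejectedWeight + I.weight i)) :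
    WP B acceptProgram s fun t s' => t ≤ m * 40 + 30 ∧ GreedyState I v u (i + 1) s' := by
  refine .mono (wp_acceptProgram hB hI hm hslow hx hi (h.load_add_le hi)).frame ?_
  rintro t s' ⟨⟨ht, k, hguide, hloads, hmin⟩, hF⟩
  rw [GreedyState, hguide, hloads, hF.var (by decide)]
  exact ⟨ht, h.accept ((Nat.le_add_right _ _).trans (I.size_add_weight_le hi)) haccept hmin⟩

theorem greedyState_zero (hs : HasThreshold I s) (hloads : s.arr Arr.loads = fun _ => 0) :
    GreedyState I (s.var Reg.bestDen) (s.var Reg.bestNum) 0 s where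
  code_lt j hj := absurd hj j.not_lt_zero
  of_rejected j hj := absurd hj j.not_lt_zero
  of_accepted j hj := absurd hj j.not_lt_zero
  full j hj := absurd hj j.not_lt_zero
  reserved := hs.rejectedWeight
  reserved_le := hs.rejectedWeight.trans_le hs.isThreshold.strictWeight_le
  load k := congrFun hloads _
  balanced k l := by simp only [hloads, mul_zero, Nat.zero_le]

theorem wp_guideProgram (hB : WordSize I B) (hI : HasInstance I s) (hm : 0 < m)
    (hslow : ∀ i : Fin m, s.arr Arr.slowness (i + 1) = I.slowness i) (hs : HasThreshold I s)
    (hloads : s.arr Arr.loads = fun _ => 0) :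
    WP B guideProgram s fun t s' => t ≤ I.n * (m * 40 + 100) + 10 ∧
      GreedyState I (s.var Reg.bestDen) (s.var Reg.bestNum) I.n s' := by
  have hn := hB.jobs
  have htotal := hB.total
  have hW := hB.weightBound
  have hM := hB.maxValue
  refine .mono (wp_forLoop (T := m * 40 + 90) I.n
    (GreedyState I (s.var Reg.bestDen) (s.var Reg.bestNum)) hn (by decide) (by decide)
    hI.jobs (fun _ _ _ h => h) (greedyState_zero hs hloads) ?_)
    fun t s' h => ⟨by linarith [h.1], h.2⟩
  intro i hi s' hF hx hgreedy
  have hI := hI.frame hF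
  have hslow_eq : s'.arr Arr.slowness = s.arr Arr.slowness := hF.arr (by decide)
  have hnum := hF.var (x := Reg.bestNum) (by decide)
  have hden := hF.var (x := Reg.bestDen) (by decide)
  have hR := hgreedy.reserved_le
  have hi' := I.size_add_weight_le hi
  have hsize_lt : I.size i * s.var Reg.bestNum < B :=
    mul_lt_of_le_maxValue hB (by omega) hs.num_le
  have hweight_lt : (s.var Reg.bestDen + 1) * I.weight i < B :=
    mul_lt_of_le_maxValue hB (Nat.succ_le_succ hs.den_le) (by omega)
  rw [add_one_mul] at hweight_lt
  have hnum_le := hs.num_le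
  have hden_le := hs.den_le
  have haccept := wp_acceptProgram_greedyState hB hI hm (by rwa [hslow_eq]) hgreedy hx hi
  simp (disch := decide) only [rejectProgram, wp_ite, wp_seq, wp_assign, wp_store,
    Expr.val, Expr.Fits, Expr.cost, hx, hnum, hden, hI.sizes, hI.weights, hI.weightBound,
    State.var_setVar_of_ne]
  refine ⟨by omega, fun hsize => ⟨by omega, fun hbelow => ⟨by omega, by omega, by omega, ?_⟩,
    fun hle => ⟨by omega,
      fun hpos => .mono (haccept fun _ => by omega) fun t s'' h => ⟨by omega, h.2⟩,
      fun hzero => ⟨by omega, by omega, by omega, by omega, ?_⟩⟩⟩,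
    fun hzero => .mono (haccept fun hpos => absurd hzero hpos.ne') fun t s'' h => ⟨by omega, h.2⟩⟩
  · exact hgreedy.reject (by omega) (.inl ⟨by omega, rfl⟩)
  · exact hgreedy.reject (by omega) (.inr ⟨by omega, rfl, show _ + _ ≤ _ by omega⟩)

end GuideProgram

/-! ### The states of the dynamic program -/

/-- Computes `Instance.window` and `Instance.base`. -/
def windowProgram : Program :=
  Reg.exponent ≔ .var Reg.machines +ₑ .const 4 ;;
  Reg.power ≔ .const 1 ;;
  forLoop Reg.place Reg.exponent (Reg.power ≔ .var Reg.power *ₑ .var Reg.maxValue) ;;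
  Reg.window ≔ .const 181 *ₑ .var Reg.power *ₑ .var Reg.machines *ₑ .var Reg.machines *ₑ
    .var Reg.machines *ₑ .var Reg.machines *ₑ .var Reg.machines ;;
  Reg.base ≔ .const 2 *ₑ .var Reg.window +ₑ .const 1

/-- Computes the powers of the base, the number of states and the code of the zero vector. -/
def statesProgram : Program :=
  Reg.codes ≔ .var Reg.machines +ₑ .const 1 ;;
  Reg.states ≔ .const 1 ;;
  Reg.origin ≔ .const 0 ;;
  forLoop Reg.place Reg.codes
    (.store Arr.powers (.var Reg.place) (.var Reg.states) ;;
    Reg.origin ≔ .var Reg.origin +ₑ .var Reg.window *ₑ .var Reg.states ;;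
    Reg.states ≔ .var Reg.states *ₑ .var Reg.base)

/-- The state holds the parameters of the coding of load differences. -/
structure HasStates {m : ℕ} (I : Instance m) (s : State) : Prop where
  window : s.var Reg.window = I.window
  base : s.var Reg.base = I.base
  codes : s.var Reg.codes = m + 1
  states : s.var Reg.states = I.states
  origin : s.var Reg.origin = ofDigits I.base (m + 1) fun _ => I.window
  powers : ∀ c < m + 1, s.arr Arr.powers c = I.base ^ c

section States

variable {m B : ℕ} {I : Instance m} {s : State}

theorem HasStates.frame {P : Program} {s' : State} (h : HasStates I s) (hF : Frame P s s')
    (hvar : ∀ x ∈ [Reg.window, Reg.base, Reg.codes, Reg.states, Reg.origin],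
      x ∉ P.writtenVars := by decide)
    (harr : Arr.powers ∉ P.writtenArrs := by decide) : HasStates I s' where
  window := (hF.var (hvar _ (by decide))).trans h.window
  base := (hF.var (hvar _ (by decide))).trans h.base
  codes := (hF.var (hvar _ (by decide))).trans h.codes
  states := (hF.var (hvar _ (by decide))).trans h.states
  origin := (hF.var (hvar _ (by decide))).trans h.origin
  powers c hc := hF.arr harr ▸ h.powers c hc

namespace WordSize

theorem states (h : WordSize I B) : I.states < B :=
  (Nat.le_mul_of_pos_left _ (Nat.succ_pos _)).trans_lt h.table

theorem base_pow (h : WordSize I B) {c : ℕ} (hc : c ≤ m + 1) : I.base ^ c < B :=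
  (Nat.pow_le_pow_right (Nat.succ_pos _) hc).trans_lt h.states

theorem base (h : WordSize I B) : I.base < B := pow_one I.base ▸ h.base_pow (by omega)

end WordSize

theorem wp_windowProgram (hB : WordSize I B) (hI : HasInstance I s) (hm : 0 < m)
    (hM : 0 < I.maxValue) (hmax : s.var Reg.maxValue = I.maxValue) :
    WP B windowProgram s fun t s' => t ≤ m * 15 + 120 ∧
      s'.var Reg.window = I.window ∧ s'.var Reg.base = I.base := by
  have hbase : 2 * I.window + 1 < B := hB.base
  have hwindow : 181 * I.maxValue ^ (m + 4) * m ^ 5 = I.window := by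
    rw [Instance.window, radius]
    ring
  have hpow : ∀ i ≤ m + 4, ∀ k ≤ 5, 181 * I.maxValue ^ i * m ^ k ≤ I.window := fun i hi k hk => by
    rw [← hwindow]
    gcongr
  have hm_le : m ≤ I.window := (pow_one m).symm.trans_le <|
    (Nat.le_mul_of_pos_left _ (by positivity)).trans (hpow 0 (by omega) 1 (by omega))
  have h181 := hpow 0 (by omega) 0 (by omega)
  rw [pow_zero, pow_zero] at h181
  have hM_lt := hB.maxValue
  rw [windowProgram, wp_seq, wp_assign, wp_seq, wp_assign, wp_seq]
  simp only [Expr.val, Expr.Fits, Expr.cost, hI.machines]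
  refine ⟨by omega, by omega, .mono (.frame (wp_forLoop (T := 5) (m + 4)
    (fun i s' => s'.var Reg.power = I.maxValue ^ i) (by omega) (by decide) (by decide) rfl
    (fun _ _ _ h => h) rfl ?_)) ?_⟩
  · intro i hi s' hF _ hpower
    have hmax := (hF.var (x := Reg.maxValue) (by decide)).trans hmax
    have hi_le := hpow i hi.le 0 (by omega)
    have hsucc_le := hpow (i + 1) hi 0 (by omega)
    rw [pow_zero, mul_one] at hi_le hsucc_le
    rw [pow_succ] at hsucc_le ⊢
    simp only [wp_assign, Expr.val, Expr.Fits, Expr.cost, hmax, hpower, State.var_setVar_self]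
    exact ⟨⟨by omega, by omega, by omega⟩, by omega, trivial⟩
  · rintro t s' ⟨⟨ht, hpower⟩, hF⟩
    have hmachines : s'.var Reg.machines = m := (hF.var (by decide)).trans hI.machines
    have hle := hpow (m + 4) le_rfl
    have h0 := hle 0
    have h1 := hle 1
    have h2 := hle 2
    have h3 := hle 3
    have h4 := hle 4
    simp only [pow_succ m, pow_zero, one_mul, mul_one, ← mul_assoc] at h0 h1 h2 h3 h4 hwindow
    simp (disch := decide) only [wp_seq, wp_assign, Expr.val, Expr.Fits, Expr.cost, hpower,
      hmachines, State.var_setVar_self, State.var_setVar_of_ne]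
    refine ⟨by omega, by omega, by omega, hwindow, ?_⟩
    rw [Instance.base, hwindow]

theorem wp_statesProgram (hB : WordSize I B) (hI : HasInstance I s)
    (hwindow : s.var Reg.window = I.window) (hbase : s.var Reg.base = I.base) :
    WP B statesProgram s fun t s' => t ≤ (m + 1) * 30 + 20 ∧ HasStates I s' := by
  have hm := hB.machines
  have hn := hB.states
  rw [statesProgram, wp_seq, wp_assign, wp_seq, wp_assign, wp_seq, wp_assign]
  simp only [Expr.val, Expr.Fits, Expr.cost, hI.machines]
  refine ⟨by omega, by omega, by omega, ?_⟩
  refine .mono (.frame (wp_forLoop (T := 20) (m + 1) (fun i s' => s'.var Reg.states = I.base ^ i ∧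
    s'.var Reg.origin = ofDigits I.base i (fun _ => I.window) ∧
    ∀ c < i, s'.arr Arr.powers c = I.base ^ c) hm (by decide) (by decide) rfl
    (fun _ _ _ h => h) ⟨rfl, rfl, fun c hc => absurd hc c.not_lt_zero⟩ ?_)) ?_
  · rintro i hi s' hF hx ⟨hstates, horigin, hpowers⟩
    have hwindow := (hF.var (x := Reg.window) (by decide)).trans hwindow
    have hbase := (hF.var (x := Reg.base) (by decide)).trans hbase
    have horigin_lt := ofDigits_lt (b := I.base) (K := i + 1) (d := fun _ => I.window)
      fun _ _ => by rw [Instance.base]; omega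
    have hpow := hB.base_pow hi
    have hpow' := hB.base_pow hi.le
    have hbase_lt : 2 * I.window + 1 < B := hB.base
    rw [ofDigits, sum_range_succ, ← ofDigits] at horigin_lt
    rw [ofDigits, sum_range_succ, ← ofDigits]
    rw [pow_succ] at hpow horigin_lt ⊢
    simp (disch := decide) only [wp_seq, wp_assign, wp_store, Expr.val, Expr.Fits, Expr.cost, hx,
      hstates, horigin, hwindow, hbase, State.var_setVar_self, State.var_setVar_of_ne,
      State.arr_setVar, State.var_setArr, State.arr_setArr_self]
    refine ⟨by omega, hpow', ⟨by omega, ⟨by omega, hpow', by omega⟩, by omega⟩,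
      ⟨hpow', hbase_lt, hpow⟩, by omega, trivial, trivial, fun c hc => ?_⟩
    rcases Nat.lt_succ_iff_lt_or_eq.1 hc with hlt | rfl
    · rw [Function.update_of_ne hlt.ne, hpowers c hlt]
    · exact Function.update_self ..
  · rintro t s' ⟨⟨ht, hstates, horigin, hpowers⟩, hF⟩
    exact ⟨by omega, (hF.var (by decide)).trans hwindow, (hF.var (by decide)).trans hbase,
      hF.var (by decide), hstates, horigin, hpowers⟩

end States

/-! ### The table of budgets -/

section Expressions

/-- The digit of the current state at position `c`. -/
def digitExpr (c : Expr) : Expr :=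
  .var Reg.state /ₑ .get Arr.powers c -ₑ
    .var Reg.state /ₑ .get Arr.powers c /ₑ .var Reg.base *ₑ .var Reg.base

/-- The outcome of the current job in the guide. -/
abbrev guideCode : Expr := .get Arr.guide (.var Reg.job)

/-- The state before the current job if this job has the outcome `Reg.candidate`. -/
def prevExpr : Expr :=
  .var Reg.state +ₑ jobSize *ₑ .get Arr.powers guideCode -ₑ
    jobSize *ₑ .get Arr.powers (.var Reg.candidate)

/-- The dynamic program that is run on the instance `I` with the guide `g`. -/
def Instance.dynProg {m : ℕ} (I : Instance m) (g : ℕ → ℕ) : DynProg :=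
  ⟨m + 1, I.window, I.W, I.size, I.weight, g⟩

/-- The machine is at job `l` and state `x` of the dynamic program with the guide `g`. -/
structure AtCell {m : ℕ} (I : Instance m) (g : ℕ → ℕ) (l x : ℕ) (s : State) : Prop
    extends HasInstance I s, HasStates I s where
  guide : s.arr Arr.guide = g
  job : s.var Reg.job = l
  state : s.var Reg.state = x
  job_lt : l < I.n
  state_lt : x < I.states
  guide_lt : g l < m + 1

variable {m B l x c : ℕ} {I : Instance m} {g : ℕ → ℕ} {s : State} {e : Expr}

theorem AtCell.frame {P : Program} {s' : State} (h : AtCell I g l x s) (hF : Frame P s s')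
    (hvar : ∀ x ∈ [Reg.jobs, Reg.weightBound, Reg.machines, Reg.window, Reg.base, Reg.codes,
      Reg.states, Reg.origin, Reg.job, Reg.state], x ∉ P.writtenVars := by decide)
    (harr : ∀ a ∈ [Arr.sizes, Arr.weights, Arr.powers, Arr.guide], a ∉ P.writtenArrs := by
      decide) : AtCell I g l x s' where
  toHasInstance := h.toHasInstance.frame hF (fun _ hx => hvar _ (by grind))
    fun _ ha => harr _ (by grind)
  toHasStates := h.toHasStates.frame hF (fun _ hx => hvar _ (by grind)) (harr _ (by decide))
  guide := (hF.arr (harr _ (by decide))).trans h.guide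
  job := (hF.var (hvar _ (by decide))).trans h.job
  state := (hF.var (hvar _ (by decide))).trans h.state
  job_lt := h.job_lt
  state_lt := h.state_lt
  guide_lt := h.guide_lt

theorem digitExpr_cost : (digitExpr e).cost = 2 * e.cost + 11 := by
  simp only [digitExpr, Expr.cost]
  omega

theorem digitExpr_val (hS : HasStates I s) (hx : s.var Reg.state = x) (he : e.val s = c)
    (hc : c < m + 1) : (digitExpr e).val s = digit I.base c x := by
  simp only [digitExpr, Expr.val, hx, he, hS.powers c hc, hS.base]
  rw [digit, Nat.mod_eq_sub_div_mul]

theorem digitExpr_fits (hB : WordSize I B) (hS : HasStates I s) (hx : s.var Reg.state = x)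
    (hxS : x < I.states) (he : e.val s = c) (hc : c < m + 1) (hfits : e.Fits B s) :
    (digitExpr e).Fits B s := by
  have hpow := hB.base_pow hc.le
  have hbase := hB.base
  have hstates := hB.states
  have hle := (Nat.div_mul_le_self (x / I.base ^ c) I.base).trans (Nat.div_le_self _ _)
  simp only [digitExpr, Expr.Fits, Expr.val, hx, he, hS.powers c hc, hS.base]
  exact ⟨⟨by omega, hfits, hpow⟩, ⟨⟨by omega, hfits, hpow⟩, hbase⟩, hbase, by omega⟩

theorem prevExpr_cost : prevExpr.cost = 14 := rfl

theorem prevExpr_val (h : AtCell I g l x s) (hc : s.var Reg.candidate = c) (hcm : c < m + 1) :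
    prevExpr.val s = (I.dynProg g).prev l x c := by
  simp only [prevExpr, Expr.val, h.sizes, h.guide, h.job, h.state, hc, h.powers _ h.guide_lt,
    h.powers c hcm]
  rfl

theorem mul_pow_add_lt (hB : WordSize I B) (hl : l < I.n) (hx : x < I.states) (hc : c < m + 1) :
    x + I.size l * I.base ^ c < B := by
  have hle : I.base ^ c ≤ I.states := Nat.pow_le_pow_right (Nat.succ_pos _) hc.le
  have hsize : I.size l ≤ I.maxValue := (Nat.le_add_right _ _).trans (I.size_add_weight_le hl)
  have := Nat.mul_le_mul hsize hle
  have := hB.shift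
  rw [add_one_mul] at this
  omega

theorem prevExpr_fits (hB : WordSize I B) (h : AtCell I g l x s) (hc : s.var Reg.candidate = c)
    (hcm : c < m + 1) : prevExpr.Fits B s := by
  have hn := hB.jobs
  have hl := h.job_lt
  have hmB := hB.machines
  have hM := hB.maxValue
  have hsize := I.size_add_weight_le hl
  have hg := h.guide_lt
  have hg_lt := mul_pow_add_lt hB hl h.state_lt hg
  have hc_lt := mul_pow_add_lt hB hl h.state_lt hcm
  have hg_pow := hB.base_pow hg.le
  have hc_pow := hB.base_pow hcm.le
  have hstates := hB.states
  have hx := h.state_lt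
  simp only [prevExpr, Expr.Fits, Expr.val, h.sizes, h.guide, h.job, h.state, hc,
    h.powers _ h.guide_lt, h.powers c hcm]
  omega

end Expressions

/-- Updates the best outcome if the outcome `Reg.candidate` leaves a larger budget. -/
def improveProgram : Program :=
  Reg.candidateBudget ≔ .get Arr.budgets (.var Reg.job *ₑ .var Reg.states +ₑ prevExpr) -ₑ
    (.const 1 -ₑ .var Reg.candidate) *ₑ jobWeight ;;
  .ite (.var Reg.candidateBudget -ₑ .var Reg.bestBudget)
    (Reg.bestBudget ≔ .var Reg.candidateBudget ;; Reg.bestCandidate ≔ .var Reg.candidate)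
    .skip

/-- Considers the outcome `Reg.candidate` unless the move of digits is impossible. -/
def candidateProgram : Program :=
  .ite (jobSize -ₑ digitExpr (.var Reg.candidate)) .skip
    (.ite (digitExpr guideCode +ₑ jobSize +ₑ .const 1 -ₑ .var Reg.base) .skip improveProgram)

/-- Finds an outcome of the current job that leaves the largest budget before it. -/
def chooseProgram : Program :=
  Reg.bestBudget ≔ .const 0 ;;
  Reg.bestCandidate ≔ .const 0 ;;
  forLoop Reg.candidate Reg.codes candidateProgram

/-- Computes the budget after the current job and the choice for it in one state. -/
def cellProgram : Program :=
  Reg.job ≔ .var Reg.cell /ₑ .var Reg.states ;;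
  Reg.state ≔ .var Reg.cell -ₑ .var Reg.job *ₑ .var Reg.states ;;
  chooseProgram ;;
  .store Arr.budgets (.var Reg.cell +ₑ .var Reg.states) (.var Reg.bestBudget) ;;
  .store Arr.choices (.var Reg.cell) (.var Reg.bestCandidate)

/-- The entry of `Arr.budgets` for the first `l` jobs and the state `x` is at the position
`l * I.states + x`, and so is the choice for job `l` in `Arr.choices`. -/
def tableProgram : Program :=
  .store Arr.budgets (.var Reg.origin) (.var Reg.weightBound +ₑ .const 1) ;;
  Reg.cells ≔ .var Reg.jobs *ₑ .var Reg.states ;;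
  forLoop Reg.cell Reg.cells cellProgram

section Table

variable {m B l x c : ℕ} {I : Instance m} {g : ℕ → ℕ} {s : State}

theorem table_lt (hB : WordSize I B) (hl : l ≤ I.n) (hx : x < I.states) :
    l * I.states + x < B :=
  calc l * I.states + x < (l + 1) * I.states := by rw [add_one_mul]; omega
    _ ≤ (I.n + 1) * I.states := Nat.mul_le_mul_right _ (Nat.succ_le_succ hl)
    _ < B := hB.table

theorem base_add_maxValue_lt (hB : WordSize I B) : I.base + I.maxValue < B := by
  have hle : I.base ≤ I.states := Nat.le_self_pow (by omega) _
  have := Nat.le_mul_of_pos_right I.maxValue ((Nat.succ_pos _).trans_le hle)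
  have := hB.shift
  rw [add_one_mul] at this
  omega

/-- The effect of considering the outcome `c` on the best budget and the best outcome. -/
abbrev IsImproved (V c : ℕ) (s s' : State) : Prop :=
  if s.var Reg.bestBudget < V then s'.var Reg.bestBudget = V ∧ s'.var Reg.bestCandidate = c
  else s'.var Reg.bestBudget = s.var Reg.bestBudget ∧
    s'.var Reg.bestCandidate = s.var Reg.bestCandidate

theorem wp_improveProgram (hB : WordSize I B) (h : AtCell I g l x s)
    (hc : s.var Reg.candidate = c) (hcm : c < m + 1) (hbest : s.var Reg.bestBudget ≤ I.W + 1)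
    (hbudgets : ∀ y < I.states,
      s.arr Arr.budgets (l * I.states + y) = (I.dynProg g).budget l y)
    (huse : (I.dynProg g).CanUse l x c) :
    WP B improveProgram s fun t s' => t ≤ 50 ∧
      IsImproved ((I.dynProg g).choiceBudget l x c) c s s' := by
  have hn := hB.jobs
  have hmB := hB.machines
  have hM := hB.maxValue
  have hW := hB.weightBound
  have hstates := hB.states
  have hl := h.job_lt
  have hweight := I.size_add_weight_le hl
  have hprev : (I.dynProg g).prev l x c < I.states :=
    DynProg.prev_lt h.state_lt h.guide_lt hcm huse
  have hpos := table_lt hB hl.le hprev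
  have hle : (I.dynProg g).budget l ((I.dynProg g).prev l x c) ≤ I.W + 1 := DynProg.budget_le _ _
  have hvalue : _ = _ - (1 - c) * I.weight l := DynProg.choiceBudget_of_canUse huse
  have hweight_le : (1 - c) * I.weight l ≤ I.weight l :=
    (Nat.mul_le_mul_right _ (Nat.sub_le 1 c)).trans_eq (one_mul _)
  simp (disch := decide) only [improveProgram, wp_ite, wp_skip, wp_seq, wp_assign, Expr.val,
    Expr.Fits, Expr.cost, prevExpr_cost, hc, h.job, h.weights, h.states, prevExpr_val h hc hcm,
    prevExpr_fits hB h hc hcm, hbudgets _ hprev, ← hvalue, State.var_setVar_self,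
    State.var_setVar_of_ne, IsImproved, true_and, and_true]
  refine ⟨by omega, by omega, fun hpos => ?_, fun hle => ?_⟩
  · rw [if_pos (by omega)]
    exact ⟨by omega, by omega, by omega, trivial⟩
  · rw [if_neg (by omega)]
    exact ⟨by omega, trivial⟩

theorem wp_candidateProgram (hB : WordSize I B) (h : AtCell I g l x s)
    (hc : s.var Reg.candidate = c) (hcm : c < m + 1) (hbest : s.var Reg.bestBudget ≤ I.W + 1)
    (hbudgets : ∀ y < I.states,
      s.arr Arr.budgets (l * I.states + y) = (I.dynProg g).budget l y) :
    WP B candidateProgram s fun t s' => t ≤ 90 ∧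
      IsImproved ((I.dynProg g).choiceBudget l x c) c s s' := by
  have hn := hB.jobs
  have hmB := hB.machines
  have hbase := base_add_maxValue_lt hB
  have hl := h.job_lt
  have hsize := I.size_add_weight_le hl
  have hg_val : guideCode.val s = g l := by simp only [Expr.val, h.job, h.guide]
  have hg_fits : guideCode.Fits B s := by
    simp only [Expr.Fits, Expr.val, h.job, h.guide]
    exact ⟨by omega, h.guide_lt.trans hmB⟩
  have hc_fits : (Expr.var Reg.candidate).Fits B s := (hc.trans_lt hcm).trans hmB
  have hg_lt : digit I.base (g l) x < I.base := Nat.mod_lt _ (Nat.succ_pos _)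
  have huse_iff : (I.dynProg g).CanUse l x c ↔
    I.size l ≤ digit I.base c x ∧ digit I.base (g l) x + I.size l < I.base := Iff.rfl
  simp only [candidateProgram, wp_ite, wp_skip, Expr.val, Expr.Fits, Expr.cost, digitExpr_cost,
    digitExpr_val h.toHasStates h.state hg_val h.guide_lt,
    digitExpr_val h.toHasStates h.state (e := .var Reg.candidate) hc hcm, h.job, h.sizes, h.base,
    digitExpr_fits hB h.toHasStates h.state h.state_lt hg_val h.guide_lt hg_fits,
    digitExpr_fits hB h.toHasStates h.state h.state_lt (e := .var Reg.candidate) hc hcm hc_fits,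
    true_and, and_true]
  have unchanged : ¬(I.dynProg g).CanUse l x c →
      IsImproved ((I.dynProg g).choiceBudget l x c) c s s := fun huse => by
    rw [IsImproved, DynProg.choiceBudget_of_not_canUse huse, if_neg (Nat.not_lt_zero _)]
    exact ⟨rfl, rfl⟩
  refine ⟨by omega, fun hlarge => ⟨by omega, unchanged (mt huse_iff.1 (by omega))⟩,
    fun hsmall => ⟨by omega, fun hlarge => ⟨by omega, unchanged (mt huse_iff.1 (by omega))⟩,
    fun hsmall' => ?_⟩⟩
  exact .mono (wp_improveProgram hB h hc hcm hbest hbudgets (huse_iff.2 ⟨by omega, by omega⟩))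
    fun t s' h => ⟨by omega, h.2⟩

theorem wp_chooseProgram (hB : WordSize I B) (h : AtCell I g l x s)
    (hbudgets : ∀ y < I.states,
      s.arr Arr.budgets (l * I.states + y) = (I.dynProg g).budget l y) :
    WP B chooseProgram s fun t s' => t ≤ (m + 1) * 100 + 20 ∧
      s'.var Reg.bestBudget = (I.dynProg g).budget (l + 1) x ∧
      s'.var Reg.bestCandidate < m + 1 ∧ ((I.dynProg g).budget (l + 1) x ≠ 0 →
        (I.dynProg g).IsBestChoice l x (s'.var Reg.bestCandidate)) := by
  have hmB := hB.machines
  have hbudget_le := DynProg.budget_le (D := I.dynProg g) (l + 1) x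
  rw [chooseProgram, wp_seq, wp_assign, wp_seq, wp_assign]
  simp only [Expr.val, Expr.Fits, Expr.cost]
  refine ⟨by omega, by omega, ?_⟩
  refine .mono (wp_forLoop (T := 90) (m + 1) (fun i s' =>
    s'.var Reg.bestBudget = (range i).sup ((I.dynProg g).choiceBudget l x) ∧
    s'.var Reg.bestCandidate < m + 1 ∧ (s'.var Reg.bestBudget ≠ 0 →
      (I.dynProg g).choiceBudget l x (s'.var Reg.bestCandidate) = s'.var Reg.bestBudget)) hmB
    (by decide) (by decide) h.codes (fun _ _ _ h => h)
    ⟨rfl, Nat.succ_pos _, fun h => absurd rfl h⟩ ?_) ?_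
  · rintro i hi s' hF hx ⟨hbest, hlt, hchoice⟩
    have hF := Frame.trans (.setVar (by decide) s _) (.trans (.setVar (by decide) _ _) hF)
    have hle : s'.var Reg.bestBudget ≤ I.W + 1 :=
      (hbest.trans_le (sup_mono (range_subset_range.2 hi.le))).trans hbudget_le
    refine .mono (wp_candidateProgram hB (h.frame hF) hx hi hle
      (by rwa [hF.arr (by decide)])) fun t s'' h => ⟨h.1, ?_⟩
    rw [range_add_one, sup_insert, ← hbest]
    grind
  · rintro t s' ⟨ht, hbest, hlt, hchoice⟩
    rw [hbest] at hchoice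
    exact ⟨by omega, hbest, hlt, fun hne =>
      DynProg.isBestChoice_of_choiceBudget_eq hlt (hchoice hne) hne⟩

/-- The first `e` cells of the table have been processed. -/
structure HasTable (I : Instance m) (g : ℕ → ℕ) (e : ℕ) (s : State) : Prop where
  budgets : ∀ l, ∀ x < I.states, l * I.states + x < e + I.states →
    s.arr Arr.budgets (l * I.states + x) = (I.dynProg g).budget l x
  choices : ∀ l, ∀ x < I.states, l * I.states + x < e → (I.dynProg g).budget (l + 1) x ≠ 0 →
    (I.dynProg g).IsBestChoice l x (s.arr Arr.choices (l * I.states + x))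

theorem mul_add_inj {S a b y z : ℕ} (hy : y < S) (hz : z < S) :
    a * S + y = b * S + z ↔ a = b ∧ y = z := by
  refine ⟨fun h => ?_, by rintro ⟨rfl, rfl⟩; rfl⟩
  have hmod := congrArg (· % S) h
  simp only [Nat.mul_add_mod', Nat.mod_eq_of_lt hy, Nat.mod_eq_of_lt hz] at hmod
  rw [hmod, Nat.add_right_cancel_iff] at h
  exact ⟨Nat.eq_of_mul_eq_mul_right (by omega) h, hmod⟩

theorem HasTable.succ {s' : State} (hx : x < I.states) (h : HasTable I g (l * I.states + x) s)
    {k : ℕ} (hk : (I.dynProg g).budget (l + 1) x ≠ 0 → (I.dynProg g).IsBestChoice l x k)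
    (hbudgets : s'.arr Arr.budgets = Function.update (s.arr Arr.budgets)
      (l * I.states + x + I.states) ((I.dynProg g).budget (l + 1) x))
    (hchoices : s'.arr Arr.choices = Function.update (s.arr Arr.choices) (l * I.states + x) k) :
    HasTable I g (l * I.states + x + 1) s' := by
  constructor
  · intro a y hy hlt
    rw [hbudgets]
    by_cases hcell : a * I.states + y = (l + 1) * I.states + x
    · obtain ⟨rfl, rfl⟩ := (mul_add_inj hy hx).1 hcell
      rw [add_one_mul, add_right_comm, Function.update_self]
    · rw [add_one_mul, add_right_comm] at hcell
      rw [Function.update_of_ne hcell, h.budgets a y hy (by omega)]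
  · intro a y hy hlt hne
    rw [hchoices]
    by_cases hcell : a * I.states + y = l * I.states + x
    · obtain ⟨rfl, rfl⟩ := (mul_add_inj hy hx).1 hcell
      rw [Function.update_self]
      exact hk hne
    · rw [Function.update_of_ne hcell]
      exact h.choices a y hy (by omega) hne

theorem wp_cellProgram (hB : WordSize I B) (hI : HasInstance I s) (hS : HasStates I s)
    (hg : s.arr Arr.guide = g) (hgm : ∀ l < I.n, g l < m + 1) {e : ℕ} (he : s.var Reg.cell = e)
    (hen : e < I.n * I.states) (hT : HasTable I g e s) :
    WP B cellProgram s fun t s' => t ≤ (m + 1) * 100 + 60 ∧ HasTable I g (e + 1) s' := by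
  have hn := hB.jobs
  have hmB := hB.machines
  have hW := hB.weightBound
  have hstates := hB.states
  have hl : e / I.states < I.n := Nat.div_lt_of_lt_mul (Nat.mul_comm _ _ ▸ hen)
  have hx : e % I.states < I.states := Nat.mod_lt _ (pow_pos (Nat.succ_pos _) _)
  have heq : e / I.states * I.states + e % I.states = e := Nat.div_add_mod' e I.states
  have hlt : e + I.states < B := by
    have := hB.table
    rw [add_one_mul] at this
    omega
  rw [cellProgram, wp_seq, wp_assign, wp_seq, wp_assign, wp_seq]
  simp (disch := decide) only [Expr.val, Expr.Fits, Expr.cost, he, hS.states,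
    State.var_setVar_self, State.var_setVar_of_ne]
  refine ⟨by omega, by omega, ?_⟩
  refine .mono (.frame (wp_chooseProgram (l := e / I.states) (x := e % I.states) (g := g) hB
    ⟨⟨hI.1, hI.2, hI.3, hI.4, hI.5⟩, ⟨hS.1, hS.2, hS.3, hS.4, hS.5, hS.6⟩, hg, rfl, ?_, hl, hx,
      hgm _ hl⟩ fun y hy => hT.budgets _ y hy (by omega))) ?_
  · rw [State.var_setVar_self, Nat.mod_eq_sub_div_mul]
  · rintro t s' ⟨⟨ht, hbest, hlt', hchoice⟩, hF⟩
    have hcell : s'.var Reg.cell = e := (hF.var (by decide)).trans he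
    have hstates' : s'.var Reg.states = I.states := (hF.var (by decide)).trans hS.states
    have hbudgets : s'.arr Arr.budgets = s.arr Arr.budgets := hF.arr (by decide)
    have hchoices : s'.arr Arr.choices = s.arr Arr.choices := hF.arr (by decide)
    have hbudget_le : s'.var Reg.bestBudget ≤ I.W + 1 := hbest.trans_le (DynProg.budget_le _ _)
    simp only [wp_seq, wp_store, Expr.val, Expr.Fits, Expr.cost, State.var_setArr, hcell, hstates']
    refine ⟨by omega, by omega, by omega, by omega, by omega, ?_⟩
    rw [← heq] at hT ⊢
    refine hT.succ hx hchoice ?_ ?_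
    · rw [State.arr_setArr_of_ne _ _ _ (by decide), State.arr_setArr_self, heq, ← hbest, hbudgets]
    · rw [State.arr_setArr_self, State.arr_setArr_of_ne _ _ _ (by decide), heq, hchoices]

theorem wp_tableProgram (hB : WordSize I B) (hI : HasInstance I s) (hS : HasStates I s)
    (hg : s.arr Arr.guide = g) (hgm : ∀ l < I.n, g l < m + 1)
    (hbudgets : s.arr Arr.budgets = fun _ => 0) :
    WP B tableProgram s fun t s' =>
      t ≤ I.n * I.states * ((m + 1) * 100 + 70) + 30 ∧ HasTable I g (I.n * I.states) s' := by
  have hn := hB.jobs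
  have hW := hB.weightBound
  have hstates := hB.states
  have hcells := hB.table
  rw [add_one_mul] at hcells
  have horigin : s.var Reg.origin = (I.dynProg g).origin := hS.origin
  have horigin_lt : (I.dynProg g).origin < I.states := DynProg.origin_lt
  rw [tableProgram, wp_seq, wp_store, wp_seq, wp_assign]
  simp (disch := decide) only [Expr.val, Expr.Fits, Expr.cost, horigin, hI.weightBound,
    hI.jobs, hS.states, State.var_setArr]
  refine ⟨by omega, by omega, by omega, ?_⟩
  refine .mono (wp_forLoop (T := (m + 1) * 100 + 60) (I.n * I.states) (HasTable I g)
    (by omega) (by decide) (by decide) rfl (fun _ _ _ h => ⟨h.1, h.2⟩) ⟨?_, ?_⟩ ?_)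
    fun t s' h => ⟨by linarith [h.1], h.2⟩
  · intro l x _ hlt
    obtain rfl : l = 0 := Nat.eq_zero_of_not_pos fun hl => by
      have := Nat.le_mul_of_pos_left I.states hl
      omega
    rw [zero_mul, zero_add]
    change Function.update (s.arr Arr.budgets) _ _ x = _
    rw [hbudgets, Function.update_apply]
    rfl
  · intro l x _ hlt
    omega
  · intro e he s' hF hx hT
    have hF : Frame tableProgram s s' := .trans (.setArr (by decide) s _ _)
      (.trans (.setVar (by decide) _ _) (hF.mono (by decide) (by decide)))
    exact wp_cellProgram hB (hI.frame hF) (hS.frame hF) ((hF.arr (by decide)).trans hg) hgm hx he hT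

end Table

/-! ### The best final state and its schedule -/

/-- Computes the scaled makespan of the current final state. -/
def costProgram : Program :=
  Reg.cost ≔ .const 0 ;;
  forLoop Reg.machine Reg.machines
    (Reg.cost ≔ .var Reg.cost +ₑ (.get Arr.slowness (.var Reg.machine +ₑ .const 1) *ₑ
      (.get Arr.loads (.var Reg.machine +ₑ .const 1) +ₑ
        digitExpr (.var Reg.machine +ₑ .const 1) -ₑ .var Reg.window) -ₑ .var Reg.cost))

/-- Updates the best final state if the current one is cheaper or the first one found. -/
def improveStateProgram : Program :=
  costProgram ;;
  .ite ((.const 1 -ₑ .var Reg.bestCost) +ₑ (.var Reg.bestCost -ₑ (.var Reg.cost +ₑ .const 1)))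
    (Reg.bestCost ≔ .var Reg.cost +ₑ .const 1 ;; Reg.bestState ≔ .var Reg.state)
    .skip

/-- Finds a cheapest final state. The value `0` of `Reg.bestCost` means that no state with a
positive budget has been found; otherwise it is one more than the cost of `Reg.bestState`. -/
def bestStateProgram : Program :=
  Reg.bestCost ≔ .const 0 ;;
  forLoop Reg.state Reg.states
    (.ite (.get Arr.budgets (.var Reg.jobs *ₑ .var Reg.states +ₑ .var Reg.state))
      improveStateProgram .skip)

/-- Outputs the choice for the current job and moves to the state before this job. -/
def outputProgram : Program :=
  Reg.candidate ≔ .get Arr.choices (.var Reg.job *ₑ .var Reg.states +ₑ .var Reg.state) ;;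
  .store Arr.output (.var Reg.job) (.var Reg.candidate) ;;
  Reg.state ≔ prevExpr

/-- Follows the choices back from the best final state. -/
def traceProgram : Program :=
  Reg.state ≔ .var Reg.bestState ;;
  forLoop Reg.step Reg.jobs
    (Reg.job ≔ .var Reg.jobs -ₑ .const 1 -ₑ .var Reg.step ;; outputProgram)

/-- The loads of the guide `g` and the last row of the table have been computed, and the slowness
of machine `i` is `c (i + 1)`. -/
structure HasFinalRow {m : ℕ} (I : Instance m) (g c : ℕ → ℕ) (s : State) : Prop
    extends HasInstance I s, HasStates I s where
  slowness : s.arr Arr.slowness = c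
  loads : ∀ i : Fin m, s.arr Arr.loads (i + 1) = prefixTotal I.size g (i + 1) I.n
  budgets : ∀ x < I.states, s.arr Arr.budgets (I.n * I.states + x) = (I.dynProg g).budget I.n x

section BestState

variable {m B x : ℕ} {I : Instance m} {g c : ℕ → ℕ} {s : State}

theorem HasFinalRow.frame {P : Program} {s' : State} (h : HasFinalRow I g c s)
    (hF : Frame P s s')
    (hvar : ∀ x ∈ [Reg.jobs, Reg.weightBound, Reg.machines, Reg.window, Reg.base, Reg.codes,
      Reg.states, Reg.origin], x ∉ P.writtenVars := by decide)
    (harr : ∀ a ∈ [Arr.sizes, Arr.weights, Arr.powers, Arr.slowness, Arr.loads, Arr.budgets],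
      a ∉ P.writtenArrs := by decide) : HasFinalRow I g c s' where
  toHasInstance := h.toHasInstance.frame hF (fun _ hx => hvar _ (by grind))
    fun _ ha => harr _ (by grind)
  toHasStates := h.toHasStates.frame hF (fun _ hx => hvar _ (by grind)) (harr _ (by decide))
  slowness := (hF.arr (harr _ (by decide))).trans h.slowness
  loads i := hF.arr (harr Arr.loads (by decide)) ▸ h.loads i
  budgets x hx := hF.arr (harr Arr.budgets (by decide)) ▸ h.budgets x hx

theorem scaledLoad_lt (hB : WordSize I B) (hc : ∀ i : Fin m, c (i + 1) = I.slowness i) (g : ℕ → ℕ)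
    (x : ℕ) {i : ℕ} (hi : i < m) :
    c (i + 1) * (prefixTotal I.size g (i + 1) I.n + digit I.base (i + 1) x) + 1 < B := by
  have hload : prefixTotal I.size g (i + 1) I.n ≤ I.n * I.maxValue :=
    prefixTotal_le (fun j hj => (Nat.le_add_right _ _).trans (I.size_add_weight_le hj)) _
  have hdigit : digit I.base (i + 1) x ≤ I.base := (Nat.mod_lt _ (Nat.succ_pos _)).le
  have := Nat.mul_le_mul_left (c (i + 1)) (Nat.add_le_add hload hdigit)
  have := hc ⟨i, hi⟩ ▸ hB.scaledLoad ⟨i, hi⟩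
  simp only at this
  omega

theorem cost_lt (hB : WordSize I B) (hc : ∀ i : Fin m, c (i + 1) = I.slowness i) (g : ℕ → ℕ)
    (x : ℕ) : (I.dynProg g).cost I.n m c x + 1 < B := by
  have hmB := hB.machines
  rw [← Nat.lt_sub_iff_add_lt, DynProg.cost, Finset.sup_lt_iff (by simp only [bot_eq_zero]; omega)]
  intro i hi
  have h := scaledLoad_lt hB hc g x (mem_range.1 hi)
  rw [← Nat.lt_sub_iff_add_lt] at h
  exact (Nat.mul_le_mul_left _ (Nat.sub_le _ _)).trans_lt h

theorem wp_costProgram (hB : WordSize I B) (hc : ∀ i : Fin m, c (i + 1) = I.slowness i)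
    (h : HasFinalRow I g c s) (hx : s.var Reg.state = x) (hxS : x < I.states) :
    WP B costProgram s fun t s' => t ≤ m * 60 + 11 ∧
      s'.var Reg.cost = (I.dynProg g).cost I.n m c x := by
  have hmB := hB.machines
  have hwindow : 2 * I.window + 1 < B := hB.base
  rw [costProgram, wp_seq, wp_assign]
  refine ⟨by simp only [Expr.Fits]; omega, ?_⟩
  refine .mono (wp_forLoop (T := 50) m (fun i s' => s'.var Reg.cost =
    (range i).sup fun i => c (i + 1) * (prefixTotal I.size g (i + 1) I.n +
      digit I.base (i + 1) x - I.window)) (by omega) (by decide) (by decide) h.machines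
    (fun _ _ _ h => h) rfl ?_) fun t s' h => ⟨by simp only [Expr.cost]; omega, h.2⟩
  intro i hi s' hF hmachine hcost
  have hF := Frame.trans (.setVar (by decide) s _) hF
  have hle : s'.var Reg.cost ≤ (I.dynProg g).cost I.n m c x :=
    hcost.trans_le (sup_mono (range_subset_range.2 hi.le))
  have h := h.frame hF
  have hx := (hF.var (by decide)).trans hx
  have hload : s'.arr Arr.loads (i + 1) = prefixTotal I.size g (i + 1) I.n := h.loads ⟨i, hi⟩
  have hpos : 0 < c (i + 1) := hc ⟨i, hi⟩ ▸ I.slowness_pos ⟨i, hi⟩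
  have hscaled := scaledLoad_lt hB hc g x hi
  have hload_lt := (Nat.le_mul_of_pos_left _ hpos).trans_lt ((Nat.le_succ _).trans_lt hscaled)
  have hslow_lt : c (i + 1) < B := hc ⟨i, hi⟩ ▸ hB.slowness ⟨i, hi⟩
  have hcost_lt := cost_lt hB hc g x
  have hterm := Nat.mul_le_mul_left (c (i + 1)) (Nat.sub_le
    (prefixTotal I.size g (i + 1) I.n + digit I.base (i + 1) x) I.window)
  have hval : (Expr.var Reg.machine +ₑ .const 1).val s' = i + 1 := by
    simp only [Expr.val, hmachine]
  have hfits : (Expr.var Reg.machine +ₑ .const 1).Fits B s' := by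
    simp only [Expr.Fits, Expr.val, hmachine]
    omega
  simp only [wp_assign, Expr.val, Expr.Fits, Expr.cost, digitExpr_cost, hmachine, h.slowness, hload,
    h.window, digitExpr_val h.toHasStates hx hval (by omega), State.var_setVar_self, range_add_one,
    sup_insert, ← hcost, digitExpr_fits hB h.toHasStates hx hxS hval (by omega) hfits, true_and]
  omega

theorem wp_improveStateProgram (hB : WordSize I B) (hc : ∀ i : Fin m, c (i + 1) = I.slowness i)
    (h : HasFinalRow I g c s) (hx : s.var Reg.state = x) (hxS : x < I.states)
    (hbest : s.var Reg.bestCost < B) :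
    WP B improveStateProgram s fun t s' => t ≤ m * 60 + 40 ∧
      if s.var Reg.bestCost = 0 ∨ (I.dynProg g).cost I.n m c x + 1 < s.var Reg.bestCost then
        s'.var Reg.bestCost = (I.dynProg g).cost I.n m c x + 1 ∧ s'.var Reg.bestState = x
      else s'.var Reg.bestCost = s.var Reg.bestCost ∧
        s'.var Reg.bestState = s.var Reg.bestState := by
  have hcost := cost_lt hB hc g x
  have hstates := hB.states
  rw [improveStateProgram, wp_seq]
  refine .mono (wp_costProgram hB hc h hx hxS).frame ?_
  rintro t s' ⟨⟨ht, hcost'⟩, hF⟩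
  simp (disch := decide) only [wp_ite, wp_seq, wp_assign, wp_skip, Expr.val, Expr.Fits, Expr.cost,
    hF.var (show Reg.bestCost ∉ _ by decide), hF.var (show Reg.bestState ∉ _ by decide),
    hF.var (show Reg.state ∉ _ by decide), hcost', hx, State.var_setVar_self,
    State.var_setVar_of_ne, and_true]
  refine ⟨by omega, fun hpos => ?_, fun hzero => ?_⟩
  · rw [if_pos (by omega), and_true]
    omega
  · rw [if_neg (by omega), and_true]
    omega

theorem wp_bestStateProgram (hB : WordSize I B) (hc : ∀ i : Fin m, c (i + 1) = I.slowness i)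
    (h : HasFinalRow I g c s) (hex : ∃ x < I.states, (I.dynProg g).budget I.n x ≠ 0) :
    WP B bestStateProgram s fun t s' => t ≤ I.states * (m * 60 + 70) + 20 ∧
      s'.var Reg.bestState < I.states ∧ (I.dynProg g).budget I.n (s'.var Reg.bestState) ≠ 0 ∧
      ∀ x < I.states, (I.dynProg g).budget I.n x ≠ 0 →
        (I.dynProg g).cost I.n m c (s'.var Reg.bestState) ≤ (I.dynProg g).cost I.n m c x := by
  have hn := hB.jobs
  have hstates := hB.states
  rw [bestStateProgram, wp_seq, wp_assign]
  refine ⟨by simp only [Expr.Fits]; omega, ?_⟩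
  refine .mono (wp_forLoop (T := m * 60 + 60) I.states (fun i s' =>
    (s'.var Reg.bestCost ≠ 0 → s'.var Reg.bestState < I.states ∧
      (I.dynProg g).budget I.n (s'.var Reg.bestState) ≠ 0 ∧
      s'.var Reg.bestCost = (I.dynProg g).cost I.n m c (s'.var Reg.bestState) + 1) ∧
    ∀ x < i, (I.dynProg g).budget I.n x ≠ 0 → s'.var Reg.bestCost ≠ 0 ∧
      s'.var Reg.bestCost ≤ (I.dynProg g).cost I.n m c x + 1) hstates (by decide) (by decide)
    h.states (fun _ _ _ h => h) ⟨fun h => absurd rfl h, fun _ hx => absurd hx (Nat.not_lt_zero _)⟩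
    ?_) ?_
  · rintro x hx s' hF hstate ⟨hbest, hmin⟩
    have h := h.frame (.trans (.setVar (by decide) s _) hF)
    have hbest_lt : s'.var Reg.bestCost < B := by
      have := cost_lt hB hc g (s'.var Reg.bestState)
      omega
    have htable := table_lt hB le_rfl hx
    have hbudget_lt := (DynProg.budget_le (D := I.dynProg g) I.n x).trans_lt hB.weightBound
    simp only [wp_ite, wp_skip, Expr.val, Expr.Fits, Expr.cost, h.jobs, h.states, hstate,
      h.budgets x hx]
    refine ⟨by omega, fun hpos => .mono (wp_improveStateProgram hB hc h hstate hx hbest_lt)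
      fun t s'' _ => ?_, fun hzero => ?_⟩
    · grind
    · grind
  · rintro t s' ⟨ht, hbest, hmin⟩
    obtain ⟨x, hx, hx0⟩ := hex
    obtain ⟨hlt, hne, heq⟩ := hbest (hmin x hx hx0).1
    refine ⟨by simp only [Expr.cost]; linarith, hlt, hne, fun y hy hy0 => ?_⟩
    have := (hmin y hy hy0).2
    omega

end BestState

section Trace

variable {m B l z k : ℕ} {I : Instance m} {g : ℕ → ℕ} {s s' : State}

theorem wp_outputProgram (hB : WordSize I B) (h : AtCell I g l x s)
    (hbest : (I.dynProg g).IsBestChoice l x (s.arr Arr.choices (l * I.states + x))) :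
    WP B outputProgram s fun t s' => t ≤ 30 ∧ ∃ k, (I.dynProg g).IsBestChoice l x k ∧
      s'.arr Arr.output = Function.update (s.arr Arr.output) l k ∧
      s'.var Reg.state = (I.dynProg g).prev l x k := by
  have hn := hB.jobs
  have hl := h.job_lt
  have hmB := hB.machines
  have htable := table_lt hB hl.le h.state_lt
  have hstates := hB.states
  have := h.state_lt
  have hcode : s.arr Arr.choices (l * I.states + x) < m + 1 := hbest.1
  rw [outputProgram, wp_seq, wp_assign, wp_seq, wp_store, wp_assign]
  simp (disch := decide) only [Expr.val, Expr.Fits, Expr.cost, h.job, h.states, h.state,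
    State.var_setVar_self, State.var_setVar_of_ne, State.arr_setVar]
  set k := s.arr Arr.choices (l * I.states + x)
  have h' : AtCell I g l x ((s.setVar Reg.candidate k).setArr Arr.output l k) :=
    ⟨⟨h.jobs, h.weightBound, h.machines, h.sizes, h.weights⟩,
      ⟨h.window, h.base, h.codes, h.states, h.origin, h.powers⟩, h.guide, h.job, h.state,
      h.job_lt, h.state_lt, h.guide_lt⟩
  have hk : ((s.setVar Reg.candidate k).setArr Arr.output l k).var Reg.candidate = k := by
    rw [State.var_setArr, State.var_setVar_self]
  refine ⟨by omega, by omega, by omega, prevExpr_fits hB h' hk hcode, ?_, k, hbest, ?_, ?_⟩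
  · rw [prevExpr_cost]
    omega
  · rw [State.arr_setArr_self, State.arr_setVar]
  · rw [prevExpr_val h' hk hcode]

/-- The machine has written the outcomes of the jobs `l, ..., n - 1` in an optimal schedule that
ends in the state `z`, and it is now in the state of this schedule before job `l`. -/
structure IsTraced (I : Instance m) (g : ℕ → ℕ) (z l : ℕ) (s : State) : Prop where
  state_lt : s.var Reg.state < I.states
  budget_ne_zero : (I.dynProg g).budget l (s.var Reg.state) ≠ 0
  code_lt : ∀ j < I.n, l ≤ j → s.arr Arr.output j < m + 1
  attains : ∀ f : ℕ → ℕ, (∀ j < I.n, l ≤ j → f j = s.arr Arr.output j) →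
    (I.dynProg g).Attains f l (s.var Reg.state) → (I.dynProg g).Attains f I.n z

theorem IsTraced.succ (h : IsTraced I g z (l + 1) s) (hl : l < I.n) (hg : g l < m + 1)
    (hbest : (I.dynProg g).IsBestChoice l (s.var Reg.state) k)
    (houtput : s'.arr Arr.output = Function.update (s.arr Arr.output) l k)
    (hstate : s'.var Reg.state = (I.dynProg g).prev l (s.var Reg.state) k) :
    IsTraced I g z l s' := by
  have hlater : ∀ j, l ≤ j → j ≠ l → l + 1 ≤ j := fun j hj hne => by omega
  refine ⟨hstate ▸ DynProg.prev_lt h.state_lt hg hbest.1 hbest.2.1,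
    hstate ▸ hbest.budget_prev_ne_zero h.budget_ne_zero, fun j hj hlj => ?_,
    fun f hf hattains => ?_⟩
  · rw [houtput, Function.update_apply]
    split_ifs with hjl
    · exact hbest.1
    · exact h.code_lt j hj (hlater j hlj hjl)
  · obtain rfl : f l = k := by rw [hf l hl le_rfl, houtput, Function.update_self]
    refine h.attains f (fun j hj hlj => ?_)
      (.succ h.state_lt hg hbest h.budget_ne_zero (hstate ▸ hattains))
    rw [hf j hj (by omega), houtput, Function.update_of_ne (by omega)]

theorem wp_traceProgram (hB : WordSize I B) (hI : HasInstance I s) (hS : HasStates I s)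
    (hg : s.arr Arr.guide = g) (hgm : ∀ l < I.n, g l < m + 1)
    (hT : HasTable I g (I.n * I.states) s) (hz : s.var Reg.bestState = z) (hzS : z < I.states)
    (hz0 : (I.dynProg g).budget I.n z ≠ 0) :
    WP B traceProgram s fun t s' => t ≤ I.n * 60 + 20 ∧
      (∀ j < I.n, s'.arr Arr.output j < m + 1) ∧
      (I.dynProg g).Attains (s'.arr Arr.output) I.n z := by
  have hn := hB.jobs
  have hstates := hB.states
  rw [traceProgram, wp_seq, wp_assign]
  simp only [Expr.Fits, Expr.val, Expr.cost, hz]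
  refine ⟨by omega, ?_⟩
  refine .mono (wp_forLoop (T := 40) I.n (fun i s' => IsTraced I g z (I.n - i) s') hn (by decide)
    (by decide) hI.jobs (fun _ _ _ h => ⟨h.1, h.2, h.3, h.4⟩)
    ⟨hzS, hz0, fun j hj hnj => absurd hj hnj.not_gt, fun _ _ h => h⟩ ?_) ?_
  · intro i hi s' hF hx h
    have hF := Frame.trans (.setVar (by decide) s _) hF
    have hI := hI.frame hF
    have hS := hS.frame hF
    have hguide := (hF.arr (by decide)).trans hg
    have hchoices := hF.arr (show Arr.choices ∉ _ by decide)
    obtain ⟨l, hl⟩ : ∃ l, I.n - i = l + 1 := Nat.exists_eq_succ_of_ne_zero (by omega)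
    have hln : l < I.n := by omega
    have hpred : I.n - 1 - i = l := by omega
    rw [hl] at h
    have hstate_lt := h.state_lt
    have hcell := Nat.mul_le_mul_right I.states (Nat.succ_le_of_lt hln)
    rw [Nat.succ_mul] at hcell
    rw [wp_seq, wp_assign]
    simp only [Expr.Fits, Expr.val, Expr.cost, hI.jobs, hx, hpred]
    refine ⟨by omega, .mono (wp_outputProgram hB (x := s'.var Reg.state) (g := g)
      ⟨⟨hI.1, hI.2, hI.3, hI.4, hI.5⟩, ⟨hS.1, hS.2, hS.3, hS.4, hS.5, hS.6⟩, hguide,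
        State.var_setVar_self .., rfl, hln, hstate_lt, hgm l hln⟩ ?_) ?_⟩
    · rw [State.arr_setVar, hchoices]
      exact hT.choices l _ hstate_lt (by omega) h.budget_ne_zero
    · rintro t s'' ⟨ht, k, hbest, houtput, hstate⟩
      rw [show I.n - (i + 1) = l by omega]
      exact ⟨by omega, h.succ hln (hgm l hln) hbest houtput hstate⟩
  · rintro t s' ⟨ht, h⟩
    rw [Nat.sub_self] at h
    exact ⟨by omega, fun j hj => h.code_lt j hj (Nat.zero_le j),
      h.attains _ (fun _ _ _ => rfl) (DynProg.attains_zero h.budget_ne_zero)⟩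

end Trace

/-! ### The algorithm -/

namespace Instance

variable {m : ℕ} {I : Instance m}

theorem size_comp_val : (fun j : Fin I.n => I.size j) = I.p := funext (toArr_coe I.p)

theorem weight_comp_val : (fun j : Fin I.n => I.weight j) = I.w := funext (toArr_coe I.w)

theorem exists_cost_le (hm : 0 < m) (hM : 0 < I.maxValue) {g c : ℕ → ℕ}
    (hc : ∀ i : Fin m, c (i + 1) = I.slowness i) {G : I.Schedule} (hgG : Codes g G)
    (hG : IsGuide I.p I.w I.W I.maxValue I.slowness G) {τ : I.Schedule} (hτ : I.Feasible τ) :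
    ∃ x < I.states, (I.dynProg g).budget I.n x ≠ 0 ∧
      (I.dynProg g).cost I.n m c x ≤ scaledMakespan I.slowness I.p τ := by
  have hc' : (fun i : Fin m => c (i + 1)) = I.slowness := funext hc
  rw [← size_comp_val, ← weight_comp_val, ← hc'] at hG
  rw [← size_comp_val, ← hc']
  rw [Feasible, rejectedWeight, ← weight_comp_val] at hτ
  exact DynProg.exists_cost_le (D := I.dynProg g) hm hM (fun i => hc i ▸ I.slowness_pos i) rfl
    (fun j hj => (Nat.le_add_right _ _).trans (I.size_add_weight_le hj))
    (fun j hj => (Nat.le_add_left _ _).trans (I.size_add_weight_le hj)) rfl hgG hG hτ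

theorem isOptimal_of_attains (hm : 0 < m) (hM : 0 < I.maxValue) {g c : ℕ → ℕ}
    (hc : ∀ i : Fin m, c (i + 1) = I.slowness i) {G : I.Schedule} (hgG : Codes g G)
    (hG : IsGuide I.p I.w I.W I.maxValue I.slowness G) {f : ℕ → ℕ} {σ : I.Schedule}
    (hf : Codes f σ) {x : ℕ} (hx : (I.dynProg g).Attains f I.n x)
    (hx0 : (I.dynProg g).budget I.n x ≠ 0)
    (hmin : ∀ y < I.states, (I.dynProg g).budget I.n y ≠ 0 →
      (I.dynProg g).cost I.n m c x ≤ (I.dynProg g).cost I.n m c y) : I.IsOptimal σ := by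
  refine ⟨?_, fun τ hτ => I.makespan_le_iff.2 ?_⟩
  · have hweight := hf.total_eq I.weight none
    have hbudget : (I.dynProg g).budget I.n x + prefixTotal I.weight f 0 I.n = I.W + 1 := hx.2
    rw [weight_comp_val] at hweight
    change total I.w σ none ≤ I.W
    rw [hweight]
    change prefixTotal I.weight f 0 I.n ≤ I.W
    omega
  · obtain ⟨y, hy, hy0, hcost⟩ := exists_cost_le hm hM hc hgG hG hτ
    calc scaledMakespan I.slowness I.p σ = (I.dynProg g).cost I.n m c x := by
          rw [hx.1.cost_eq rfl hf c, funext hc]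
          exact congrArg (scaledMakespan _ · σ) size_comp_val.symm
      _ ≤ (I.dynProg g).cost I.n m c y := hmin y hy hy0
      _ ≤ scaledMakespan I.slowness I.p τ := hcost

variable (I)

theorem maxValue_le_window (hm : 0 < m) : I.maxValue ≤ I.window :=
  (Nat.le_add_left _ _).trans (add_le_radius hm I.maxValue)

theorem states_pos : 0 < I.states := pow_pos (Nat.succ_pos _) _

theorem sq_le_states (hm : 0 < m) : (I.maxValue + 1) * (I.maxValue + 1) ≤ I.states := by
  have hbase : I.maxValue + 1 ≤ I.base := by
    have := I.maxValue_le_window hm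
    rw [base]
    omega
  calc (I.maxValue + 1) * (I.maxValue + 1) = (I.maxValue + 1) ^ 2 := (sq _).symm
    _ ≤ I.base ^ 2 := Nat.pow_le_pow_left hbase 2
    _ ≤ I.states := Nat.pow_le_pow_right (Nat.succ_pos _) (by omega)

end Instance

/-- Computes the slownesses of the machines. -/
def speedProgram : Program := maxValueProgram ;; numeratorProgram ;; inverseSpeedProgram

/-- Computes the guide. -/
def greedyProgram : Program := thresholdProgram ;; guideProgram

/-- Computes the table of budgets. -/
def dynamicProgram : Program := windowProgram ;; statesProgram ;; tableProgram

/-- Outputs an optimal schedule, read off the table of budgets. -/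
def recoverProgram : Program := bestStateProgram ;; traceProgram

/-- The algorithm for `m` machines. -/
def scheduleProgram (m : ℕ) : Program :=
  Reg.machines ≔ .const m ;; speedProgram ;; greedyProgram ;; dynamicProgram ;; recoverProgram

section ScheduleProgram

variable {m B : ℕ} {I : Instance m} {s : State}

theorem wp_speedProgram (hB : WordSize I B) (hI : HasInstance I s)
    (hnum : s.arr Arr.speedNums = toArr fun i => (I.q i).num)
    (hden : s.arr Arr.speedDens = toArr fun i => (I.q i).den) :
    WP B speedProgram s fun t s' => t ≤ I.n * 26 + m * 36 + 32 ∧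
      s'.var Reg.maxValue = I.maxValue ∧
      ∀ i : Fin m, s'.arr Arr.slowness (i + 1) = I.slowness i := by
  rw [speedProgram, wp_seq]
  refine (wp_maxValueProgram hB hI).frame.mono ?_
  rintro t₁ s₁ ⟨⟨ht₁, hmax⟩, hF₁⟩
  have hI₁ := hI.frame hF₁
  have hnum₁ := (hF₁.arr (by decide)).trans hnum
  rw [wp_seq]
  refine (wp_numeratorProgram hB hI₁ hnum₁).frame.mono ?_
  rintro t₂ s₂ ⟨⟨ht₂, hprod⟩, hF₂⟩
  have hnum₂ := (hF₂.arr (by decide)).trans hnum₁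
  have hden₂ := (hF₂.arr (by decide)).trans ((hF₁.arr (by decide)).trans hden)
  refine (wp_inverseSpeedProgram hB (hI₁.frame hF₂) hprod hnum₂ hden₂).frame.mono ?_
  rintro t₃ s₃ ⟨⟨ht₃, hslow⟩, hF₃⟩
  refine ⟨?_, (hF₃.var (by decide)).trans ((hF₂.var (by decide)).trans hmax), hslow⟩
  linarith

/-- The array of codes in the state is a guide for the instance `I`, with known loads. -/
structure HasGuide (I : Instance m) (G : I.Schedule) (s : State) : Prop where
  codes : Codes (s.arr Arr.guide) G
  isGuide : IsGuide I.p I.w I.W I.maxValue I.slowness G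
  loads : ∀ i : Fin m, s.arr Arr.loads (i + 1) =
    prefixTotal I.size (s.arr Arr.guide) (i + 1) I.n

theorem wp_greedyProgram (hB : WordSize I B) (hI : HasInstance I s) (hm : 0 < m)
    (hmax : s.var Reg.maxValue = I.maxValue)
    (hslow : ∀ i : Fin m, s.arr Arr.slowness (i + 1) = I.slowness i)
    (hloads : s.arr Arr.loads = fun _ => 0) :
    WP B greedyProgram s fun t s' =>
      t ≤ (I.maxValue + 1) * (I.maxValue + 1) * (I.n * 50 + 100) + I.n * (m * 40 + 100) + 31 ∧
      ∃ G, HasGuide I G s' := by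
  rw [greedyProgram, wp_seq]
  refine (wp_thresholdProgram hB hI hmax).frame.mono ?_
  rintro t₁ s₁ ⟨⟨ht₁, hth⟩, hF₁⟩
  have hslow₁ : ∀ i : Fin m, s₁.arr Arr.slowness (i + 1) = I.slowness i := fun i =>
    hF₁.arr (a := Arr.slowness) (by decide) ▸ hslow i
  refine (wp_guideProgram hB (hI.frame hF₁) hm hslow₁ hth
    ((hF₁.arr (by decide)).trans hloads)).mono ?_
  rintro t₂ s₂ ⟨ht₂, hgreedy⟩
  obtain ⟨G, hG⟩ := exists_schedule hgreedy.code_lt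
  have hguide := hgreedy.isGuide hth.isThreshold
    (fun j hj => (Nat.le_add_left _ _).trans (I.size_add_weight_le hj)) hG
  rw [I.size_comp_val, I.weight_comp_val] at hguide
  exact ⟨by linarith, G, hG, hguide, hgreedy.load⟩

theorem HasGuide.frame {G : I.Schedule} {P : Program} {s' : State} (h : HasGuide I G s)
    (hF : Frame P s s')
    (harr : ∀ a ∈ [Arr.guide, Arr.loads], a ∉ P.writtenArrs := by decide) : HasGuide I G s' where
  codes := hF.arr (harr Arr.guide (by decide)) ▸ h.codes
  isGuide := h.isGuide
  loads := by
    rw [hF.arr (harr Arr.guide (by decide)), hF.arr (harr Arr.loads (by decide))]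
    exact h.loads

theorem wp_dynamicProgram (hB : WordSize I B) (hI : HasInstance I s) (hm : 0 < m)
    (hM : 0 < I.maxValue) (hmax : s.var Reg.maxValue = I.maxValue)
    (hg : ∀ l < I.n, s.arr Arr.guide l < m + 1) (hbudgets : s.arr Arr.budgets = fun _ => 0) :
    WP B dynamicProgram s fun t s' =>
      t ≤ I.n * I.states * ((m + 1) * 100 + 70) + m * 45 + 202 ∧ HasStates I s' ∧
      HasTable I (s'.arr Arr.guide) (I.n * I.states) s' := by
  rw [dynamicProgram, wp_seq]
  refine (wp_windowProgram hB hI hm hM hmax).frame.mono ?_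
  rintro t₁ s₁ ⟨⟨ht₁, hwindow, hbase⟩, hF₁⟩
  have hI₁ := hI.frame hF₁
  rw [wp_seq]
  refine (wp_statesProgram hB hI₁ hwindow hbase).frame.mono ?_
  rintro t₂ s₂ ⟨⟨ht₂, hS⟩, hF₂⟩
  have hbudgets₂ := (hF₂.arr (by decide)).trans ((hF₁.arr (by decide)).trans hbudgets)
  have hguide₂ : s₂.arr Arr.guide = s.arr Arr.guide :=
    (hF₂.arr (by decide)).trans (hF₁.arr (by decide))
  refine (wp_tableProgram hB (hI₁.frame hF₂) hS hguide₂ hg hbudgets₂).frame.mono ?_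
  rintro t₃ s₃ ⟨⟨ht₃, hT⟩, hF₃⟩
  refine ⟨by linarith, hS.frame hF₃, ?_⟩
  rwa [hF₃.arr (by decide), hguide₂]

theorem wp_recoverProgram (hB : WordSize I B) (hI : HasInstance I s) (hm : 0 < m)
    (hM : 0 < I.maxValue) (hslow : ∀ i : Fin m, s.arr Arr.slowness (i + 1) = I.slowness i)
    {G : I.Schedule} (hG : HasGuide I G s) (hS : HasStates I s)
    (hT : HasTable I (s.arr Arr.guide) (I.n * I.states) s) :
    WP B recoverProgram s fun t s' =>
      t ≤ I.states * (m * 60 + 70) + I.n * 60 + 41 ∧ ∃ σ, I.Outputs s' σ ∧ I.IsOptimal σ := by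
  have hrow : HasFinalRow I (s.arr Arr.guide) (s.arr Arr.slowness) s :=
    ⟨hI, hS, rfl, hG.loads, fun x hx => hT.budgets _ x hx (Nat.add_lt_add_left hx _)⟩
  obtain ⟨x, hx, hx0, -⟩ := Instance.exists_cost_le hm hM hslow hG.codes hG.isGuide
    hG.isGuide.feasible
  rw [recoverProgram, wp_seq]
  refine (wp_bestStateProgram hB hslow hrow ⟨x, hx, hx0⟩).frame.mono ?_
  rintro t₁ s₁ ⟨⟨ht₁, hz, hz0, hmin⟩, hF⟩
  have hT₁ : HasTable I (s.arr Arr.guide) (I.n * I.states) s₁ :=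
    ⟨hF.arr (a := Arr.budgets) (by decide) ▸ hT.budgets,
      hF.arr (a := Arr.choices) (by decide) ▸ hT.choices⟩
  refine (wp_traceProgram hB (hI.frame hF) (hS.frame hF) (hF.arr (by decide)) hG.codes.lt hT₁ rfl
    hz hz0).mono ?_
  rintro t₂ s₂ ⟨ht₂, hcode, hattains⟩
  obtain ⟨σ, hσ⟩ := exists_schedule hcode
  exact ⟨by linarith, σ, hσ,
    Instance.isOptimal_of_attains hm hM hslow hG.codes hG.isGuide hσ hattains hz0 hmin⟩

theorem run_time_le {n S M m t₁ t₂ t₃ t₄ : ℕ} (hn : 0 < n) (hS : 0 < S)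
    (hM : (M + 1) * (M + 1) ≤ S) (h₁ : t₁ ≤ n * 26 + m * 36 + 32)
    (h₂ : t₂ ≤ (M + 1) * (M + 1) * (n * 50 + 100) + n * (m * 40 + 100) + 31)
    (h₃ : t₃ ≤ n * S * ((m + 1) * 100 + 70) + m * 45 + 202)
    (h₄ : t₄ ≤ S * (m * 60 + 70) + n * 60 + 41) :
    2 + (t₁ + (t₂ + (t₃ + t₄ + 1) + 1) + 1) + 1 ≤ (m * 300 + 1000) * (n * S) := by
  have hn' : n ≤ n * S := Nat.le_mul_of_pos_right _ hS
  have hS' : S ≤ n * S := Nat.le_mul_of_pos_left _ hn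
  have hmn : m * n ≤ m * (n * S) := Nat.mul_le_mul_left _ hn'
  have hmS : m * S ≤ m * (n * S) := Nat.mul_le_mul_left _ hS'
  have hm : m * 1 ≤ m * (n * S) := Nat.mul_le_mul_left _ (Nat.mul_pos hn hS)
  have hthreshold : (M + 1) * (M + 1) * (n * 50 + 100) ≤ S * (n * 50 + 100) :=
    Nat.mul_le_mul_right _ hM
  nlinarith

theorem wp_scheduleProgram (hB : WordSize I B) (hm : 0 < m) (hn : 0 < I.n)
    (hM : 0 < I.maxValue) :
    WP B (scheduleProgram m) I.init fun t s' =>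
      t ≤ (m * 300 + 1000) * (I.n * I.states) ∧ ∃ σ, I.Outputs s' σ ∧ I.IsOptimal σ := by
  rw [scheduleProgram, wp_seq, wp_assign, wp_seq]
  refine ⟨(Nat.lt_succ_self m).trans hB.machines, ?_⟩
  have hI : HasInstance I (I.init.setVar Reg.machines m) := ⟨rfl, rfl, rfl, rfl, rfl⟩
  refine (wp_speedProgram hB hI rfl rfl).frame.mono ?_
  rintro t₁ s₁ ⟨⟨ht₁, hmax, hslow⟩, hF₁⟩
  have hI₁ := hI.frame hF₁
  rw [wp_seq]
  refine (wp_greedyProgram hB hI₁ hm hmax hslow (hF₁.arr (by decide))).frame.mono ?_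
  rintro t₂ s₂ ⟨⟨ht₂, G, hG⟩, hF₂⟩
  have hI₂ := hI₁.frame hF₂
  have hmax₂ := (hF₂.var (by decide)).trans hmax
  have hbudgets₂ : s₂.arr Arr.budgets = fun _ => 0 :=
    (hF₂.arr (by decide)).trans (hF₁.arr (by decide))
  have hslow₂ : ∀ i : Fin m, s₂.arr Arr.slowness (i + 1) = I.slowness i := fun i =>
    hF₂.arr (a := Arr.slowness) (by decide) ▸ hslow i
  rw [wp_seq]
  refine (wp_dynamicProgram hB hI₂ hm hM hmax₂ hG.codes.lt hbudgets₂).frame.mono ?_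
  rintro t₃ s₃ ⟨⟨ht₃, hS, hT⟩, hF₃⟩
  have hslow₃ : ∀ i : Fin m, s₃.arr Arr.slowness (i + 1) = I.slowness i := fun i =>
    hF₃.arr (a := Arr.slowness) (by decide) ▸ hslow₂ i
  refine (wp_recoverProgram hB (hI₂.frame hF₃) hm hM hslow₃ (hG.frame hF₃) hS hT).mono ?_
  rintro t₄ s₄ ⟨ht₄, hσ⟩
  exact ⟨run_time_le hn I.states_pos (I.sq_le_states hm) ht₁ ht₂ ht₃ ht₄, hσ⟩

end ScheduleProgram

namespace Instance

variable {m : ℕ} (I : Instance m)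

theorem maxValue_le : I.maxValue ≤ I.pmax + I.wmax := by
  refine Finset.sup_le fun j hj => ?_
  obtain ⟨j, rfl⟩ : ∃ j' : Fin I.n, (j' : ℕ) = j := ⟨⟨j, mem_range.1 hj⟩, rfl⟩
  rw [size, weight, toArr_coe, toArr_coe]
  exact Nat.add_le_add (le_sup (f := I.p) (mem_univ j)) (le_sup (f := I.w) (mem_univ j))

theorem maxValue_pos (h : 0 < I.pmax + I.wmax) : 0 < I.maxValue := by
  have hle : ∀ j : Fin I.n, I.p j + I.w j ≤ I.maxValue := fun j => by
    rw [← toArr_coe I.p, ← toArr_coe I.w]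
    exact I.size_add_weight_le j.2
  have hp : I.pmax ≤ I.maxValue :=
    Finset.sup_le fun j _ => (Nat.le_add_right _ _).trans (hle j)
  have hw : I.wmax ≤ I.maxValue :=
    Finset.sup_le fun j _ => (Nat.le_add_left _ _).trans (hle j)
  omega

theorem base_le (hm : 0 < m) (hM : 0 < I.maxValue) :
    I.base ≤ 543 * m ^ 5 * I.maxValue ^ (m + 4) := by
  have : 0 < m ^ 5 * I.maxValue ^ (m + 4) := by positivity
  rw [base, window, radius]
  linarith

theorem states_le (hm : 0 < m) (hD : 0 < I.pmax + I.wmax) :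
    I.states ≤ (543 * m ^ 5) ^ (m + 1) * (I.pmax + I.wmax) ^ ((m + 2) * (m + 3)) :=
  calc I.states ≤ (543 * m ^ 5 * I.maxValue ^ (m + 4)) ^ (m + 1) :=
        Nat.pow_le_pow_left (I.base_le hm (I.maxValue_pos hD)) _
    _ = (543 * m ^ 5) ^ (m + 1) * I.maxValue ^ ((m + 4) * (m + 1)) := by rw [mul_pow, ← pow_mul]
    _ ≤ (543 * m ^ 5) ^ (m + 1) * (I.pmax + I.wmax) ^ ((m + 4) * (m + 1)) :=
        Nat.mul_le_mul_left _ (Nat.pow_le_pow_left I.maxValue_le _)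
    _ ≤ (543 * m ^ 5) ^ (m + 1) * (I.pmax + I.wmax) ^ ((m + 2) * (m + 3)) :=
        Nat.mul_le_mul_left _ (Nat.pow_le_pow_right hD (by linarith))

theorem two_le_magnitude : 2 ≤ I.magnitude := by rw [magnitude]; omega

theorem num_add_den_le_magnitude (i : Fin m) : (I.q i).num + (I.q i).den ≤ I.magnitude :=
  (single_le_sum (f := fun i => (I.q i).num + (I.q i).den) (fun _ _ => Nat.zero_le _)
    (mem_univ i)).trans (Nat.le_add_left _ _)

theorem maxValue_lt_magnitude : I.maxValue < I.magnitude := by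
  have := I.maxValue_le
  rw [magnitude]
  omega

theorem prod_num_le : ∏ i, (I.q i).num ≤ I.magnitude ^ m := by
  simpa using prod_le_pow_card univ (fun i => (I.q i).num) I.magnitude fun i _ =>
    (Nat.le_add_right _ _).trans (I.num_add_den_le_magnitude i)

theorem slowness_le (i : Fin m) : I.slowness i ≤ I.magnitude ^ (m + 1) := by
  rw [pow_succ]
  exact Nat.mul_le_mul ((Nat.div_le_self _ _).trans I.prod_num_le)
    ((Nat.le_add_left _ _).trans (I.num_add_den_le_magnitude i))

theorem lt_magnitude_pow : m < I.magnitude ^ m :=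
  Nat.lt_two_pow_self.trans_le (Nat.pow_le_pow_left I.two_le_magnitude m)

theorem base_le_magnitude_pow (hm : 0 < m) (hM : 0 < I.maxValue) :
    I.base ≤ I.magnitude ^ (6 * m + 14) :=
  calc I.base ≤ 543 * m ^ 5 * I.maxValue ^ (m + 4) := I.base_le hm hM
    _ ≤ I.magnitude ^ 10 * (I.magnitude ^ m) ^ 5 * I.magnitude ^ (m + 4) := by
      gcongr
      · exact le_trans (by norm_num) (Nat.pow_le_pow_left I.two_le_magnitude 10)
      · exact I.lt_magnitude_pow.le
      · exact I.maxValue_lt_magnitude.le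
    _ = I.magnitude ^ (6 * m + 14) := by ring

theorem pow_mul_states_lt (hm : 0 < m) (hM : 0 < I.maxValue) {k : ℕ} (hk : k ≤ m + 4) :
    I.magnitude ^ k * I.states < I.magnitude ^ ((6 * m + 14) * (m + 1) + m + 5) :=
  calc I.magnitude ^ k * I.states
      ≤ I.magnitude ^ (m + 4) * (I.magnitude ^ (6 * m + 14)) ^ (m + 1) :=
        Nat.mul_le_mul (Nat.pow_le_pow_right (by linarith [I.two_le_magnitude]) hk)
          (Nat.pow_le_pow_left (I.base_le_magnitude_pow hm hM) _)
    _ = I.magnitude ^ ((6 * m + 14) * (m + 1) + m + 4) := by ring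
    _ < I.magnitude ^ ((6 * m + 14) * (m + 1) + m + 5) :=
        Nat.pow_lt_pow_right I.two_le_magnitude (Nat.lt_succ_self _)

theorem slowness_mul_add_base_succ_le (i : Fin m) :
    I.slowness i * (I.n * I.maxValue + I.base) + 1 ≤ I.magnitude ^ (m + 4) * I.states := by
  have hN := I.two_le_magnitude
  have hn : I.n + 1 ≤ I.magnitude := by rw [magnitude]; omega
  have hM := I.maxValue_lt_magnitude
  have hS := I.states_pos
  have hload : I.n * I.maxValue + 1 ≤ I.magnitude ^ 2 := by nlinarith
  have hbase : I.base ≤ I.states := Nat.le_self_pow (by omega) _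
  have hsum : I.n * I.maxValue + I.base + 1 ≤ I.magnitude ^ 3 * I.states := by
    have h₁ : I.magnitude ^ 2 * 1 ≤ I.magnitude ^ 2 * I.states := Nat.mul_le_mul_left _ hS
    have h₂ : 1 * I.states ≤ I.magnitude ^ 2 * I.states :=
      Nat.mul_le_mul_right _ (Nat.one_le_pow _ _ (by omega))
    have h₃ : 2 * (I.magnitude ^ 2 * I.states) ≤ I.magnitude * (I.magnitude ^ 2 * I.states) :=
      Nat.mul_le_mul_right _ hN
    linarith
  have hpow : 1 ≤ I.magnitude ^ (m + 1) := Nat.one_le_pow _ _ (by omega)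
  calc I.slowness i * (I.n * I.maxValue + I.base) + 1
      ≤ I.magnitude ^ (m + 1) * (I.n * I.maxValue + I.base) + I.magnitude ^ (m + 1) :=
        Nat.add_le_add (Nat.mul_le_mul_right _ (I.slowness_le i)) hpow
    _ = I.magnitude ^ (m + 1) * (I.n * I.maxValue + I.base + 1) := by ring
    _ ≤ I.magnitude ^ (m + 1) * (I.magnitude ^ 3 * I.states) := Nat.mul_le_mul_left _ hsum
    _ = I.magnitude ^ (m + 4) * I.states := by ring

theorem wordSize_magnitude_pow (hm : 0 < m) (hM : 0 < I.maxValue) :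
    WordSize I (I.magnitude ^ ((6 * m + 14) * (m + 1) + m + 5)) := by
  have hn : I.n + 1 ≤ I.magnitude := by rw [magnitude]; omega
  have hW : I.W + 1 ≤ I.magnitude := by rw [magnitude]; omega
  have hM' : I.maxValue + 1 ≤ I.magnitude := I.maxValue_lt_magnitude
  have hstates {a k : ℕ} (hk : k ≤ m + 4) (ha : a ≤ I.magnitude ^ k) :
      a * I.states < I.magnitude ^ ((6 * m + 14) * (m + 1) + m + 5) :=
    (Nat.mul_le_mul_right _ ha).trans_lt (I.pow_mul_states_lt hm hM hk)
  have hpow {a k : ℕ} (hk : k ≤ m + 4) (ha : a ≤ I.magnitude ^ k) :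
      a < I.magnitude ^ ((6 * m + 14) * (m + 1) + m + 5) :=
    (Nat.le_mul_of_pos_right _ I.states_pos).trans_lt (hstates hk ha)
  exact {
    jobs := hpow (k := 1) (by omega) (by rw [pow_one]; omega)
    weightBound := hpow (k := 1) (by omega) (by rwa [pow_one])
    machines := hpow (k := m) (by omega) I.lt_magnitude_pow
    values := hpow (k := 2) (by omega) (by rw [sq]; exact Nat.mul_le_mul hM' hM')
    total := hpow (k := 2) (by omega) (by nlinarith)
    numerators := hpow (k := m) (by omega) I.prod_num_le
    scaledLoad := fun i => (I.slowness_mul_add_base_succ_le i).trans_lt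
      (I.pow_mul_states_lt hm hM le_rfl)
    table := hstates (k := 1) (by omega) (by rwa [pow_one])
    shift := hstates (k := 1) (by omega) (by rwa [pow_one]) }

theorem solves_scheduleProgram (hm : 0 < m) (hn : 0 < I.n) (hD : 0 < I.pmax + I.wmax) :
    Solves (scheduleProgram m) I (I.magnitude ^ ((6 * m + 14) * (m + 1) + m + 5))
      ((m * 300 + 1000) * (543 * m ^ 5) ^ (m + 1) *
        ((I.pmax + I.wmax) ^ ((m + 2) * (m + 3)) * I.n)) := by
  have hM := I.maxValue_pos hD
  obtain ⟨t, s, hrun, ht, σ, hout, hopt⟩ :=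
    wp_scheduleProgram (I.wordSize_magnitude_pow hm hM) hm hn hM
  refine ⟨t, s, σ, hrun, ?_, hout, hopt⟩
  calc t ≤ (m * 300 + 1000) * (I.n * I.states) := ht
    _ ≤ (m * 300 + 1000) * (I.n *
          ((543 * m ^ 5) ^ (m + 1) * (I.pmax + I.wmax) ^ ((m + 2) * (m + 3)))) := by
        gcongr
        exact I.states_le hm hD
    _ = (m * 300 + 1000) * (543 * m ^ 5) ^ (m + 1) *
          ((I.pmax + I.wmax) ^ ((m + 2) * (m + 3)) * I.n) := by ring

end Instance

end SchedRej

theorem mainTheorem3 (m : ℕ) (hm : 0 < m) :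
    ∃ (P : SchedRej.Program) (κ c k : ℕ), ∀ I : SchedRej.Instance m,
      0 < I.n → 0 < I.pmax + I.wmax →
        SchedRej.Solves P I (I.magnitude ^ κ)
          (c * ((I.pmax + I.wmax) ^ ((m + 2) * (m + 3)) * I.n) *
            Nat.log 2 (I.n + I.pmax + I.wmax) ^ k) := by
  refine ⟨SchedRej.scheduleProgram m, (6 * m + 14) * (m + 1) + m + 5,
    (m * 300 + 1000) * (543 * m ^ 5) ^ (m + 1), 0, fun I hn hD => ?_⟩
  rw [pow_zero, mul_one]
  exact I.solves_scheduleProgram hm hn hD
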